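/- Let $p\ge 2$, let $\mathbb S^{p-1}$ be the unit sphere of $\mathbb R^p$ with surface measure $\omega_{p-1}(dv)$, let $\omega_{p-1}=2\pi^{p/2}/\Gamma(p/2)$ be its total area, $\omega_{p-2}=2\pi^{(p-1)/2}/\Gamma((p-1)/2)$, and $\mathbb R^+=(0,\infty)$. Let $Y_1,Y_2,\dots$ be i.i.d. random vectors in $\mathbb R^p$, $U_i=\|Y_i\|$, $V_i=Y_i/\|Y_i\|$, and suppose that $(U_i,V_i)$ has a density $f$ on $\mathbb R^+\times\mathbb S^{p-1}$ with respect to $du\,\omega_{p-1}(dv)$. Put $f_U(u)=\int_{\mathbb S^{p-1}}f(u,v)\,\omega_{p-1}(dv)$ and $$\mathcal M^2=\min_{g}\int_{\mathbb R^+}\int_{\mathbb S^{p-1}}\big(f(u,v)-\omega_{p-1}^{-1}g(u)\big)^2\,du\,\omega_{p-1}(dv),$$ the minimum being over all probability densities $g$ on $\mathbb R^+$. Assume: (i) $f$ is twice differentiable on $\mathbb R^+\times\mathbb S^{p-1}$; for each $u$ the second derivative $\mathcal D_f^2(u,v)$ with respect to $v$ is uniformly continuous in $v\in\mathbb S^{p-1}$,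 and for each $v$ the derivative $\partial^2 f(u,v)/\partial u^2$ is uniformly continuous in $u\in\mathbb R^+$ (derivatives in $v$ are those of the extension $x\mapsto f(u,x/\|x\|)$); (ii) $\int_{\mathbb R^+}\int_{\mathbb S^{p-1}}f\,(f-\omega_{p-1}^{-1}f_U)^2\,du\,\omega_{p-1}(dv)<\infty$; (iii) $K$ is a symmetric probability density supported on $(-1,1)$ with $\int_{-1}^1K^4(u)\,du<\infty$. For $\kappa>0$ let $$L(\kappa t)=\frac{\kappa^{p/2-1}e^{\kappa t}}{(2\pi)^{p/2}\mathcal I_{p/2-1}(\kappa)},\qquad \mathcal I_\nu(\kappa)=\frac{(\kappa/2)^\nu}{\Gamma(\nu+1/2)\Gamma(1/2)}\int_{-1}^1e^{\kappa t}(1-t^2)^{\nu-1/2}\,dt,$$ $c_1(\kappa)=\omega_{p-2}\int_0^\pi L(\kappa\cos\theta)(\sin\theta)^{p-2}\,d\theta$, and for bandwidths $h=h_n>0$, $\kappa=\kappa_n>0$ let $$\hat{\mathcal M}_n^2=\frac1{n(n-1)c_1(\kappa)h}\sum_{1\le i\ne j\le n}K\Big(\frac{U_i-U_j}h\Big)L(\kappa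 V_i^\top V_j)-\frac{\omega_{p-1}^{-1}}{n(n-1)h}\sum_{1\le i\ne j\le n}K\Big(\frac{U_i-U_j}h\Big).$$ Theorem. If $\kappa_n\to\infty$, $h_n\to0$, $\kappa_n^{(p-1)/2}/(nh_n)\to0$ as $n\to\infty$, and the distribution of $Y_1$ is not spherically symmetric, that is $\mathcal M^2>0$, then $\hat{\mathcal M}_n^2$ is integrable for every $n\ge 2$ and $$\sqrt n\big(\hat{\mathcal M}_n^2-\mathbb E[\hat{\mathcal M}_n^2]\big)\ \xrightarrow{d}\ \mathcal N(0,4\sigma^2),$$ where $$\sigma^2=\int_{\mathbb R^+}\int_{\mathbb S^{p-1}}f(u,v)\big(f(u,v)-\omega_{p-1}^{-1}f_U(u)\big)^2\,du\,\omega_{p-1}(dv)-(\mathcal M^2)^2\ \ge 0 .$$ ($\mathcal N(0,0)$ is the point mass at $0$.) -/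

import Mathlib

open MeasureTheory ProbabilityTheory Filter Topology Set

noncomputable section

namespace SphericalDeviation

/-- Euclidean space of dimension `p`. -/
abbrev E (p : ℕ) : Type := EuclideanSpace ℝ (Fin p)

/-- The unit sphere of `E p`. -/
abbrev Sph (p : ℕ) : Type := Metric.sphere (0 : E p) 1

/-- Surface area `2 π ^ (m / 2) / Γ (m / 2)` of the unit sphere of an `m`-dimensional Euclidean
space; it is `ω_{p-1}` for `m = p` and `ω_{p-2}` for `m = p - 1`. -/
def sphereArea (m : ℕ) : ℝ :=
  2 * Real.pi ^ ((m : ℝ) / 2) / Real.Gamma ((m : ℝ) / 2)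

/-- The surface measure `ω_{p-1}(dv)` on the unit sphere. -/
def surf (p : ℕ) : Measure (Sph p) := (volume : Measure (E p)).toSphere

/-- The reference measure `du ω_{p-1}(dv)` on `ℝ⁺` times the unit sphere. -/
def polarMeasure (p : ℕ) : Measure (ℝ × Sph p) :=
  (volume.restrict (Ioi (0 : ℝ))).prod (surf p)

/-- Direction `y / ‖y‖`. -/
def direction {p : ℕ} (y : E p) : E p := ‖y‖⁻¹ • y

/-- `(U, V) = (‖Y‖, Y / ‖Y‖)` has the (nonnegative) density `f` with respect to
`du ω_{p-1}(dv)`. -/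
structure HasPolarDensity {Ω : Type*} [MeasurableSpace Ω] {p : ℕ} (P : Measure Ω)
    (Y : Ω → E p) (f : ℝ → Sph p → ℝ) : Prop where
  nonneg : ∀ u > 0, ∀ v, 0 ≤ f u v
  aemeasurable : AEMeasurable (fun z : ℝ × Sph p => f z.1 z.2) (polarMeasure p)
  map_eq : P.map (fun ω => (‖Y ω‖, direction (Y ω))) =
    ((polarMeasure p).withDensity (fun z => ENNReal.ofReal (f z.1 z.2))).map
      (fun z => (z.1, (z.2 : E p)))

/-- Marginal density `f_U(u) = ∫ f(u, v) ω_{p-1}(dv)` of the radius. -/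
def marginal {p : ℕ} (f : ℝ → Sph p → ℝ) (u : ℝ) : ℝ := ∫ v, f u v ∂(surf p)

/-- `g` is a probability density on `ℝ⁺`. -/
def IsRadialDensity (g : ℝ → ℝ) : Prop :=
  (∀ u > 0, 0 ≤ g u) ∧ AEMeasurable g (volume.restrict (Ioi (0 : ℝ))) ∧
    ∫⁻ u in Ioi (0 : ℝ), ENNReal.ofReal (g u) = 1

/-- Squared `L²` distance of `f` from the spherical density `g(u) ω_{p-1}⁻¹`. -/
def sqDist {p : ℕ} (f : ℝ → Sph p → ℝ) (g : ℝ → ℝ) : ENNReal :=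
  ∫⁻ z, ENNReal.ofReal ((f z.1 z.2 - g z.1 * (sphereArea p)⁻¹) ^ 2) ∂(polarMeasure p)

/-- `𝓜²`: the minimal squared `L²` distance of `f` from the densities of spherically symmetric
distributions. -/
def deviation {p : ℕ} (f : ℝ → Sph p → ℝ) : ℝ :=
  (⨅ (g : ℝ → ℝ) (_ : IsRadialDensity g), sqDist f g).toReal

/-- Integrand of the first term of the asymptotic variance. -/
def varIntegrand {p : ℕ} (f : ℝ → Sph p → ℝ) (z : ℝ × Sph p) : ℝ :=
  f z.1 z.2 * (f z.1 z.2 - (sphereArea p)⁻¹ * marginal f z.1) ^ 2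

/-- `σ² = ∫∫ f (f - ω_{p-1}⁻¹ f_U)² du ω_{p-1}(dv) - (𝓜²)²`. -/
def asympVar {p : ℕ} (f : ℝ → Sph p → ℝ) : ℝ :=
  (∫ z, varIntegrand f z ∂(polarMeasure p)) - (deviation f) ^ 2

/-- The extension of a function of the direction which is constant along rays (and zero at the
origin); derivatives with respect to the direction are those of this extension. -/
def radialExt {p : ℕ} (φ : Sph p → ℝ) (x : E p) : ℝ :=
  if hx : x ≠ 0 then φ ⟨‖x‖⁻¹ • x, by simp [norm_smul, hx]⟩ else 0

/-- The radial extension of `f` on `ℝ⁺ × (E p ∖ {0})`. -/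
def polarExt {p : ℕ} (f : ℝ → Sph p → ℝ) (z : ℝ × E p) : ℝ := radialExt (f z.1) z.2

/-- Smoothness assumption: `f` is twice differentiable on `ℝ⁺` times the sphere, with second
derivatives uniformly continuous in the direction for each fixed radius, and in the radius for each
fixed direction. -/
structure SmoothDensity {p : ℕ} (f : ℝ → Sph p → ℝ) : Prop where
  differentiable : DifferentiableOn ℝ (polarExt f) (Ioi (0 : ℝ) ×ˢ {x : E p | x ≠ 0})
  twice_differentiable :
    DifferentiableOn ℝ (fderiv ℝ (polarExt f)) (Ioi (0 : ℝ) ×ˢ {x : E p | x ≠ 0})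
  unif_direction : ∀ u > 0,
    UniformContinuousOn (fderiv ℝ (fderiv ℝ (radialExt (f u)))) (Metric.sphere (0 : E p) 1)
  unif_radius : ∀ v, UniformContinuousOn (deriv (deriv (fun u => f u v))) (Ioi (0 : ℝ))

/-- Assumption on the radial kernel: a symmetric density supported on `(-1, 1)` with a finite
integral of its fourth power. -/
structure RadialKernel (K : ℝ → ℝ) : Prop where
  nonneg : ∀ x, 0 ≤ K x
  symm : ∀ x, K (-x) = K x
  support_subset : Function.support K ⊆ Ioo (-1 : ℝ) 1
  measurable : Measurable K
  integral_eq_one : ∫⁻ x, ENNReal.ofReal (K x) = 1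
  integrable_pow_four : Integrable (fun x => K x ^ 4)

/-- Modified Bessel function of the first kind, for order `ν > -1/2` and argument `κ > 0`. -/
def besselI (ν κ : ℝ) : ℝ :=
  (κ / 2) ^ ν / (Real.Gamma (ν + 1 / 2) * Real.Gamma (1 / 2)) *
    ∫ t in (-1 : ℝ)..1, Real.exp (κ * t) * (1 - t ^ 2) ^ (ν - 1 / 2)

/-- The Langevin (Fisher-von Mises) kernel `L(κ t)`. -/
def langevin (p : ℕ) (κ t : ℝ) : ℝ :=
  κ ^ ((p : ℝ) / 2 - 1) * ((2 * Real.pi) ^ ((p : ℝ) / 2) * besselI ((p : ℝ) / 2 - 1) κ)⁻¹ *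
    Real.exp (κ * t)

/-- `c₁(κ) = ω_{p-2} ∫₀^π L(κ cos θ) (sin θ)^{p-2} dθ`. -/
def c1 (p : ℕ) (κ : ℝ) : ℝ :=
  sphereArea (p - 1) * ∫ θ in (0 : ℝ)..Real.pi, langevin p κ (Real.cos θ) * Real.sin θ ^ (p - 2)

/-- The estimator of `∫ f_U²`, as a function of the sample `y 0, …, y (n - 1)`. -/
def estRadial {p : ℕ} (K : ℝ → ℝ) (h : ℝ) (n : ℕ) (y : ℕ → E p) : ℝ :=
  ((n : ℝ) * ((n : ℝ) - 1) * h)⁻¹ *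
    ∑ i ∈ Finset.range n, ∑ j ∈ (Finset.range n).erase i, K ((‖y i‖ - ‖y j‖) / h)

/-- The estimator of `∫∫ f²`, as a function of the sample `y 0, …, y (n - 1)`. -/
def estJoint {p : ℕ} (K : ℝ → ℝ) (h κ : ℝ) (n : ℕ) (y : ℕ → E p) : ℝ :=
  ((n : ℝ) * ((n : ℝ) - 1) * c1 p κ * h)⁻¹ *
    ∑ i ∈ Finset.range n, ∑ j ∈ (Finset.range n).erase i,
      K ((‖y i‖ - ‖y j‖) / h) * langevin p κ (inner ℝ (direction (y i)) (direction (y j)))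

/-- The U-statistic estimating `𝓜²`. -/
def estDeviation {p : ℕ} (K : ℝ → ℝ) (h κ : ℝ) (n : ℕ) (y : ℕ → E p) : ℝ :=
  estJoint K h κ n y - (sphereArea p)⁻¹ * estRadial K h n y

end SphericalDeviation

end

/-! Almost surely the estimator is a U-statistic of order two in the i.i.d. points `(U_i, V_i)`,
whose law is written `ν`. Its kernel is `H_n = K_h · (L / c₁ - ω⁻¹)`, where `ω` is the area of the
sphere. The Hoeffding decomposition writes the centred and rescaled statistic as twice a normalized
sum of centred projections `g_n(z) = ∫ H_n(z, z') dν(z')`, plus a degenerate remainder. The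
remainder has second moment of order `E[H_n²] / n`. Since `L / c₁` is at most a constant times `κ ^
((p-1)/2)`, this is of order `κ ^ ((p-1)/2) / (n h)`, which tends to zero. Integrating `H_n` against
`f` amounts to averaging `d = f - ω⁻¹ f_U` with the Markov kernel `K_h ⊗ L / c₁`, which concentrates
on the diagonal. Hence `g_n → d` in `L²(ν)`, and the classical central limit theorem for the
`d(Z_i)` gives the limit. In the unweighted `L²`, `d` is orthogonal to functions of the radius, so
its `ν`-mean is `𝓜²`. Thus `σ²` is the variance of `d` under `ν`, which also shows `σ² ≥ 0`.

The delicate point is that `L²(ν)` is weighted by `f`, and `f` is not assumed bounded. The remedy is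
`f ∈ L³`: Hölder bounds the weighted error by `‖f‖₃` times the squared `L³` norm of the increments
of `d`, and approximate identities converge in `L³`. For almost every direction `f` is integrable
along the ray with a uniformly continuous second derivative, hence bounded there, so `f` is
uniformly bounded off a small set of directions. Wherever the directional mean `r = ω⁻¹ f_U` is
large, it must come from that small set, and there the integrable function `f (f - r)²` controls
`r³`, and then `f³`.

The argument rests on `tendstoInDistribution_uStatistic`, `lintegral_surf_inner`,
`exists_langevinDensity_le`, `bounded_of_uniformContinuousOn_deriv_deriv`,
`integrable_cube_of_mean`, `tendsto_eLpNorm_increment` and `ae_integral_deviationKernel`. -/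

noncomputable section

namespace SphericalDeviation

/-! ### Hoeffding decomposition and a central limit theorem for U-statistics with varying kernels.
-/

section UStatistic

set_option linter.unusedSectionVars false

variable {Ω : Type*} [MeasurableSpace Ω] {P : Measure Ω} [IsProbabilityMeasure P]
  {S : Type*} [MeasurableSpace S] {ν : Measure S} [IsProbabilityMeasure ν] {Z : ℕ → Ω → S}

/-- The pair of two distinct members of an i.i.d. sequence has the product law. -/
lemma measurePreserving_pair (hZm : ∀ i, Measurable (Z i)) (hZi : iIndepFun Z P)
    (hZl : ∀ i, P.map (Z i) = ν) {i j : ℕ} (hij : i ≠ j) :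
    MeasurePreserving (fun ω => (Z i ω, Z j ω)) P (ν.prod ν) := by
  refine ⟨(hZm i).prodMk (hZm j), ?_⟩
  rw [(indepFun_iff_map_prod_eq_prod_map_map (hZm i).aemeasurable (hZm j).aemeasurable).1
    (hZi.indepFun hij), hZl, hZl]

lemma indepFun_triple (hZm : ∀ i, Measurable (Z i)) (hZi : iIndepFun Z P) {i j k l : ℕ}
    (hi : l ≠ i) (hj : l ≠ j) (hk : l ≠ k) :
    IndepFun (fun ω => (Z i ω, Z j ω, Z k ω)) (Z l) P := by
  have h := hZi.indepFun_finset {i, j, k} {l} (by simp [hi, hj, hk]) hZm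
  have mi : i ∈ ({i, j, k} : Finset ℕ) := by simp
  have mj : j ∈ ({i, j, k} : Finset ℕ) := by simp
  have mk : k ∈ ({i, j, k} : Finset ℕ) := by simp
  have ml : l ∈ ({l} : Finset ℕ) := by simp
  have hl : Measurable (fun x : ({l} : Finset ℕ) → S => x ⟨l, ml⟩) := measurable_pi_apply _
  exact h.comp (φ := fun x => (x ⟨i, mi⟩, x ⟨j, mj⟩, x ⟨k, mk⟩)) (ψ := fun x => x ⟨l, ml⟩)
    (by fun_prop) hl

/-- Given the triple `(Z i, Z j, Z k)`, the variable `Z l` still has law `ν`, and integrating over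
it first kills the factor `R (Z k, Z l)`. The index `k` may coincide with `i` or `j`, which is why
the triple is treated as a single variable. -/
lemma integral_mul_eq_zero_of_degenerate (hZm : ∀ i, Measurable (Z i)) (hZi : iIndepFun Z P)
    (hZl : ∀ i, P.map (Z i) = ν) {R : S × S → ℝ} (hR : Measurable R)
    (hR2 : MemLp R 2 (ν.prod ν)) (hdeg : ∀ᵐ z ∂ν, ∫ z', R (z, z') ∂ν = 0) {i j k l : ℕ}
    (hij : i ≠ j) (hi : l ≠ i) (hj : l ≠ j) (hk : l ≠ k) :
    ∫ ω, R (Z i ω, Z j ω) * R (Z k ω, Z l ω) ∂P = 0 := by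
  have hint : Integrable (fun ω => R (Z i ω, Z j ω) * R (Z k ω, Z l ω)) P :=
    MemLp.integrable_mul
      (hR2.comp_measurePreserving (measurePreserving_pair hZm hZi hZl hij))
      (hR2.comp_measurePreserving (measurePreserving_pair hZm hZi hZl hk.symm))
  set T : Ω → S × S × S := fun ω => (Z i ω, Z j ω, Z k ω) with hT
  have hTm : Measurable T := (hZm i).prodMk ((hZm j).prodMk (hZm k))
  have : IsProbabilityMeasure (P.map T) := Measure.isProbabilityMeasure_map hTm.aemeasurable
  have hmp : MeasurePreserving (fun ω => (T ω, Z l ω)) P ((P.map T).prod ν) := by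
    refine ⟨hTm.prodMk (hZm l), ?_⟩
    rw [(indepFun_iff_map_prod_eq_prod_map_map hTm.aemeasurable (hZm l).aemeasurable).1
      (indepFun_triple hZm hZi hi hj hk), hZl]
  set Q : (S × S × S) × S → ℝ := fun x => R (x.1.1, x.1.2.1) * R (x.1.2.2, x.2) with hQ
  have hQm : Measurable Q := by fun_prop
  have hQi : Integrable Q ((P.map T).prod ν) := by
    rw [← hmp.map_eq, integrable_map_measure hQm.aestronglyMeasurable hmp.measurable.aemeasurable]
    exact hint
  have e : ∫ ω, R (Z i ω, Z j ω) * R (Z k ω, Z l ω) ∂P = ∫ x, Q x ∂((P.map T).prod ν) := by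
    rw [← hmp.map_eq, integral_map hmp.measurable.aemeasurable hQm.aestronglyMeasurable]
  rw [e, integral_prod _ hQi]
  have hae : ∀ᵐ t ∂(P.map T), ∫ z', R (t.2.2, z') ∂ν = 0 := by
    have h1 : Measurable (fun t : S × S × S => t.2.2) := by fun_prop
    have h2 : (P.map T).map (fun t : S × S × S => t.2.2) = ν := by
      rw [Measure.map_map h1 hTm]; exact hZl k
    refine ae_of_ae_map (p := fun z => ∫ z', R (z, z') ∂ν = 0) h1.aemeasurable ?_
    rwa [h2]
  refine integral_eq_zero_of_ae ?_
  filter_upwards [hae] with t ht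
  simp [hQ, integral_const_mul, ht]

/-- Second moment of a degenerate `U`-statistic of order two. -/
lemma integral_sq_degenerate_sum (hZm : ∀ i, Measurable (Z i)) (hZi : iIndepFun Z P)
    (hZl : ∀ i, P.map (Z i) = ν) {R : S × S → ℝ} (hR : Measurable R)
    (hsymm : ∀ x y, R (x, y) = R (y, x))
    (hR2 : MemLp R 2 (ν.prod ν)) (hdeg : ∀ᵐ z ∂ν, ∫ z', R (z, z') ∂ν = 0) (n : ℕ) :
    ∫ ω, (∑ q ∈ (Finset.range n).offDiag, R (Z q.1 ω, Z q.2 ω)) ^ 2 ∂P =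
      2 * (n * (n - 1)) * ∫ x, R x ^ 2 ∂(ν.prod ν) := by
  have hL : ∀ q ∈ (Finset.range n).offDiag, MemLp (fun ω => R (Z q.1 ω, Z q.2 ω)) 2 P := by
    intro q hq
    exact hR2.comp_measurePreserving
      (measurePreserving_pair hZm hZi hZl (Finset.mem_offDiag.1 hq).2.2)
  have hsq : ∀ q ∈ (Finset.range n).offDiag,
      ∫ ω, R (Z q.1 ω, Z q.2 ω) * R (Z q.1 ω, Z q.2 ω) ∂P = ∫ x, R x ^ 2 ∂(ν.prod ν) := by
    intro q hq
    have hmp := measurePreserving_pair hZm hZi hZl (Finset.mem_offDiag.1 hq).2.2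
    rw [← hmp.map_eq, integral_map hmp.measurable.aemeasurable (by fun_prop)]
    simp [sq]
  have hoff : ∀ q ∈ (Finset.range n).offDiag, ∀ q' ∈ (Finset.range n).offDiag,
      q' ≠ q → q' ≠ q.swap → ∫ ω, R (Z q.1 ω, Z q.2 ω) * R (Z q'.1 ω, Z q'.2 ω) ∂P = 0 := by
    rintro ⟨i, j⟩ hq ⟨k, l⟩ hq' h1 h2
    simp only [Finset.mem_offDiag, Prod.swap, ne_eq, Prod.mk.injEq] at *
    -- Two pairs that differ even up to order share at most one index, so `k` or `l` lies outside
    -- `{i, j}`. By symmetry of the kernel that index may be placed last.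
    by_cases hl : l ≠ i ∧ l ≠ j
    · exact integral_mul_eq_zero_of_degenerate hZm hZi hZl hR hR2 hdeg hq.2.2 hl.1 hl.2
        (fun h => hq'.2.2 h.symm)
    · have hk : k ≠ i ∧ k ≠ j := by grind
      simp_rw [hsymm (Z k _) (Z l _)]
      exact integral_mul_eq_zero_of_degenerate hZm hZi hZl hR hR2 hdeg hq.2.2 hk.1 hk.2 hq'.2.2
  simp_rw [sq (∑ q ∈ _, _), Finset.sum_mul_sum]
  have hLL : ∀ q ∈ (Finset.range n).offDiag, ∀ q' ∈ (Finset.range n).offDiag,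
      Integrable (fun ω => R (Z q.1 ω, Z q.2 ω) * R (Z q'.1 ω, Z q'.2 ω)) P :=
    fun q hq q' hq' => (hL q hq).integrable_mul (hL q' hq')
  rw [integral_finsetSum _ fun q hq => integrable_finsetSum _ (hLL q hq)]
  have hinner : ∀ q ∈ (Finset.range n).offDiag,
      ∫ ω, ∑ q' ∈ (Finset.range n).offDiag, R (Z q.1 ω, Z q.2 ω) * R (Z q'.1 ω, Z q'.2 ω) ∂P =
        2 * ∫ x, R x ^ 2 ∂(ν.prod ν) := by
    intro q hq
    rw [integral_finsetSum _ (hLL q hq)]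
    have hne : q ≠ q.swap := by
      intro h; exact (Finset.mem_offDiag.1 hq).2.2 (congrArg Prod.fst h)
    -- Only the pair itself and its swap contribute to the inner sum, whence the factor 2.
    have hsub : ({q, q.swap} : Finset (ℕ × ℕ)) ⊆ (Finset.range n).offDiag := by
      intro x hx
      rcases Finset.mem_insert.1 hx with rfl | hx
      · exact hq
      · rw [Finset.mem_singleton.1 hx]
        simp only [Finset.mem_offDiag, Prod.swap] at hq ⊢
        exact ⟨hq.2.1, hq.1, hq.2.2.symm⟩
    rw [← Finset.sum_subset hsub, Finset.sum_pair hne, hsq q hq]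
    · have : ∀ ω, R (Z q.swap.1 ω, Z q.swap.2 ω) = R (Z q.1 ω, Z q.2 ω) := fun ω => hsymm _ _
      simp_rw [this, hsq q hq]; ring
    · intro q' hq' hn
      simp only [Finset.mem_insert, Finset.mem_singleton, not_or] at hn
      exact hoff q hq q' hq' hn.1 hn.2
  rw [Finset.sum_congr rfl hinner, Finset.sum_const, Finset.offDiag_card, Finset.card_range,
    nsmul_eq_mul]
  have : ((n * n - n : ℕ) : ℝ) = n * (n - 1) := by
    rw [Nat.cast_sub (Nat.le_mul_self n)]; push_cast; ring
  rw [this]; ring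

/-- Second moment of a centered sum of i.i.d. variables. -/
lemma integral_sq_centered_sum (hZm : ∀ i, Measurable (Z i)) (hZi : iIndepFun Z P)
    (hZl : ∀ i, P.map (Z i) = ν) {e : S → ℝ} (he : Measurable e) (he2 : MemLp e 2 ν) (n : ℕ) :
    ∫ ω, (∑ i ∈ Finset.range n, (e (Z i ω) - ∫ z, e z ∂ν)) ^ 2 ∂P ≤ n * ∫ z, e z ^ 2 ∂ν := by
  have hmp : ∀ i, MeasurePreserving (Z i) P ν := fun i => ⟨hZm i, hZl i⟩
  have hL : ∀ i, MemLp (fun ω => e (Z i ω)) 2 P := fun i => he2.comp_measurePreserving (hmp i)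
  have hE : ∀ i, ∫ ω, e (Z i ω) ∂P = ∫ z, e z ∂ν := fun i => by
    rw [← hZl i, integral_map (hZm i).aemeasurable (by fun_prop)]
  have hV : ∀ i, Var[fun ω => e (Z i ω); P] ≤ ∫ z, e z ^ 2 ∂ν := fun i => by
    refine (variance_le_expectation_sq (hL i).aestronglyMeasurable).trans (le_of_eq ?_)
    rw [← hZl i, integral_map (hZm i).aemeasurable (by fun_prop)]
    rfl
  have hvs := IndepFun.variance_sum (X := fun i ω => e (Z i ω)) (s := Finset.range n) (μ := P)
    (fun i _ => hL i) (fun i _ j _ hij => (hZi.indepFun hij).comp he he)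
  have : Var[∑ i ∈ Finset.range n, fun ω => e (Z i ω); P] =
      ∫ ω, (∑ i ∈ Finset.range n, (e (Z i ω) - ∫ z, e z ∂ν)) ^ 2 ∂P := by
    rw [variance_eq_integral (memLp_finsetSum' _ fun i _ => hL i).aemeasurable]
    simp only [Finset.sum_apply]
    rw [integral_finsetSum _ fun i _ => (hL i).integrable (by norm_num)]
    simp [hE, Finset.sum_sub_distrib]
  rw [← this, hvs]
  calc _ ≤ ∑ i ∈ Finset.range n, ∫ z, e z ^ 2 ∂ν := Finset.sum_le_sum fun i _ => hV i
    _ = _ := by simp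

lemma tendstoInMeasure_zero_of_integral_sq {X : ℕ → Ω → ℝ} (hX : ∀ n, MemLp (X n) 2 P)
    (h : Tendsto (fun n => ∫ ω, X n ω ^ 2 ∂P) atTop (𝓝 0)) :
    TendstoInMeasure P X atTop 0 := by
  refine tendstoInMeasure_of_tendsto_eLpNorm (p := 2) (by norm_num)
    (fun n => (hX n).aestronglyMeasurable) aestronglyMeasurable_zero ?_
  have : ∀ n, eLpNorm (X n - 0) 2 P = ENNReal.ofReal ((∫ ω, X n ω ^ 2 ∂P) ^ (1 / 2 : ℝ)) := by
    intro n
    rw [sub_zero, (hX n).eLpNorm_eq_integral_rpow_norm (by norm_num) (by norm_num)]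
    simp
  simp_rw [this]
  rw [← ENNReal.ofReal_zero]
  refine ENNReal.tendsto_ofReal ?_
  simpa using h.rpow_const (p := 1 / 2) (Or.inr (by norm_num))

/-- The projection `g(z) = ∫ H(z, z') dν(z')` of a square-integrable kernel. -/
lemma sq_integral_le {φ : S → ℝ} (hφ : MemLp φ 2 ν) :
    (∫ z, φ z ∂ν) ^ 2 ≤ ∫ z, φ z ^ 2 ∂ν := by
  have := variance_nonneg φ ν
  rw [variance_eq_sub hφ] at this
  simpa using this

lemma ae_memLp_section {H : S × S → ℝ} (hH : Measurable H) (hH2 : MemLp H 2 (ν.prod ν)) :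
    ∀ᵐ z ∂ν, MemLp (fun z' => H (z, z')) 2 ν := by
  have h := ((memLp_two_iff_integrable_sq hH.aestronglyMeasurable).1 hH2).prod_right_ae
  filter_upwards [h] with z hz
  exact (memLp_two_iff_integrable_sq (hH.comp measurable_prodMk_left).aestronglyMeasurable).2 hz

lemma measurable_section_integral {H : S × S → ℝ} (hH : Measurable H) :
    Measurable (fun z => ∫ z', H (z, z') ∂ν) :=
  hH.stronglyMeasurable.integral_prod_right'.measurable

/-- Jensen's inequality in almost every section, followed by Fubini: projecting contracts the `L²`
norm. -/
lemma memLp_projection {H : S × S → ℝ} (hH : Measurable H) (hH2 : MemLp H 2 (ν.prod ν)) :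
    MemLp (fun z => ∫ z', H (z, z') ∂ν) 2 ν ∧
      ∫ z, (∫ z', H (z, z') ∂ν) ^ 2 ∂ν ≤ ∫ x, H x ^ 2 ∂(ν.prod ν) := by
  have hm := measurable_section_integral (ν := ν) hH
  have hi := (memLp_two_iff_integrable_sq hH.aestronglyMeasurable).1 hH2
  have hle : ∀ᵐ z ∂ν, (∫ z', H (z, z') ∂ν) ^ 2 ≤ ∫ z', H (z, z') ^ 2 ∂ν := by
    filter_upwards [ae_memLp_section hH hH2] with z hz using sq_integral_le hz
  have hI : Integrable (fun z => (∫ z', H (z, z') ∂ν) ^ 2) ν := by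
    refine hi.integral_prod_left.mono' (hm.pow_const 2).aestronglyMeasurable ?_
    filter_upwards [hle] with z hz
    simpa using hz
  refine ⟨(memLp_two_iff_integrable_sq hm.aestronglyMeasurable).2 hI, ?_⟩
  rw [integral_prod _ hi]
  exact integral_mono_ae hI hi.integral_prod_left hle

/-- The degenerate part in the Hoeffding decomposition of a kernel. -/
def degeneratePart (ν : Measure S) (H : S × S → ℝ) (x : S × S) : ℝ :=
  H x - (∫ z, H (x.1, z) ∂ν) - (∫ z, H (x.2, z) ∂ν) + ∫ y, H y ∂(ν.prod ν)

lemma memLp_fst_comp {g : S → ℝ} (hg : MemLp g 2 ν) :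
    MemLp (fun x : S × S => g x.1) 2 (ν.prod ν) :=
  hg.comp_measurePreserving measurePreserving_fst

lemma memLp_snd_comp {g : S → ℝ} (hg : MemLp g 2 ν) :
    MemLp (fun x : S × S => g x.2) 2 (ν.prod ν) :=
  hg.comp_measurePreserving measurePreserving_snd

lemma degeneratePart_spec {H : S × S → ℝ} (hH : Measurable H)
    (hH2 : MemLp H 2 (ν.prod ν)) :
    Measurable (degeneratePart ν H) ∧ MemLp (degeneratePart ν H) 2 (ν.prod ν) ∧
      (∀ᵐ z ∂ν, ∫ z', degeneratePart ν H (z, z') ∂ν = 0) ∧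
      ∫ x, degeneratePart ν H x ^ 2 ∂(ν.prod ν) ≤ 16 * ∫ x, H x ^ 2 ∂(ν.prod ν) := by
  have hm := measurable_section_integral (ν := ν) hH
  obtain ⟨hg, hgle⟩ := memLp_projection hH hH2
  have hL : MemLp (degeneratePart ν H) 2 (ν.prod ν) :=
    ((hH2.sub (memLp_fst_comp hg)).sub (memLp_snd_comp hg)).add (memLp_const _)
  refine ⟨((hH.sub (hm.comp measurable_fst)).sub (hm.comp measurable_snd)).add_const _, hL, ?_, ?_⟩
  · have hgi : Integrable (fun z => ∫ z', H (z, z') ∂ν) ν := hg.integrable (by norm_num)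
    filter_upwards [ae_memLp_section hH hH2] with z hz
    have hzi : Integrable (fun z' => H (z, z')) ν := hz.integrable (by norm_num)
    simp only [degeneratePart]
    have h1 : Integrable (fun z' => H (z, z') - ∫ z', H (z, z') ∂ν) ν :=
      hzi.sub (integrable_const _)
    have h2 : Integrable (fun z' => H (z, z') - (∫ z', H (z, z') ∂ν) - ∫ y, H (z', y) ∂ν) ν :=
      h1.sub hgi
    rw [integral_add h2 (integrable_const _), integral_sub h1 hgi, integral_sub hzi (integrable_const _),
      integral_prod _ (hH2.integrable (by norm_num))]
    simp
  · have h1 := hH2.integrable_sq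
    have h2 := (memLp_fst_comp hg).integrable_sq
    have h3 := (memLp_snd_comp hg).integrable_sq
    have e2 : ∫ x : S × S, (∫ z', H (x.1, z') ∂ν) ^ 2 ∂(ν.prod ν) =
        ∫ z, (∫ z', H (z, z') ∂ν) ^ 2 ∂ν := by
      rw [integral_fun_fst (fun z => (∫ z', H (z, z') ∂ν) ^ 2)]; simp
    have e3 : ∫ x : S × S, (∫ z', H (x.2, z') ∂ν) ^ 2 ∂(ν.prod ν) =
        ∫ z, (∫ z', H (z, z') ∂ν) ^ 2 ∂ν := by
      rw [integral_fun_snd (fun z => (∫ z', H (z, z') ∂ν) ^ 2)]; simp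
    have h4 : (∫ y, H y ∂(ν.prod ν)) ^ 2 ≤ ∫ x, H x ^ 2 ∂(ν.prod ν) := sq_integral_le hH2
    have h12 : Integrable (fun x : S × S => H x ^ 2 + (∫ z', H (x.1, z') ∂ν) ^ 2) (ν.prod ν) :=
      h1.add h2
    have h123 : Integrable (fun x : S × S => H x ^ 2 + (∫ z', H (x.1, z') ∂ν) ^ 2 +
        (∫ z', H (x.2, z') ∂ν) ^ 2) (ν.prod ν) := h12.add h3
    calc ∫ x, degeneratePart ν H x ^ 2 ∂(ν.prod ν)
        ≤ ∫ x, 4 * (H x ^ 2 + (∫ z', H (x.1, z') ∂ν) ^ 2 + (∫ z', H (x.2, z') ∂ν) ^ 2 +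
          (∫ y, H y ∂(ν.prod ν)) ^ 2) ∂(ν.prod ν) := by
          refine integral_mono hL.integrable_sq
            ((h123.add (integrable_const _)).const_mul 4) fun x => ?_
          simp only [degeneratePart]
          generalize H x = a
          generalize (∫ z', H (x.1, z') ∂ν) = b
          generalize (∫ z', H (x.2, z') ∂ν) = c
          generalize (∫ y, H y ∂(ν.prod ν)) = m
          -- Cauchy–Schwarz for the four terms `a, -b, -c, m`; the hints are the six squared
          -- differences in Lagrange's identity. Each term has second moment at most that of `H`, so
          -- the constant is 4 · 4 = 16.
          nlinarith [sq_nonneg (a + b), sq_nonneg (a + c), sq_nonneg (a - m), sq_nonneg (b - c),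
            sq_nonneg (b + m), sq_nonneg (c + m)]
      _ ≤ _ := by
          rw [integral_const_mul, integral_add h123 (integrable_const _),
            integral_add h12 h3, integral_add h1 h2, e2, e3]
          simp only [integral_const, probReal_univ, one_smul]
          linarith

/-- Hoeffding decomposition of a `U`-statistic of order two. -/
lemma sum_eq_degenerate_add (H : S × S → ℝ) (z : ℕ → S) (n : ℕ) :
    ∑ i ∈ Finset.range n, ∑ j ∈ (Finset.range n).erase i, H (z i, z j) =
      ∑ q ∈ (Finset.range n).offDiag, degeneratePart ν H (z q.1, z q.2) +
        2 * (n - 1) * (∑ i ∈ Finset.range n, ∫ y, H (z i, y) ∂ν) -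
        n * (n - 1) * ∫ y, H y ∂(ν.prod ν) := by
  have hoff : ∀ φ : ℕ × ℕ → ℝ, ∑ q ∈ (Finset.range n).offDiag, φ q =
      ∑ i ∈ Finset.range n, ∑ j ∈ (Finset.range n).erase i, φ (i, j) := fun φ =>
    Finset.sum_finset_product _ _ _ fun q => by
      simp only [Finset.mem_offDiag, Finset.mem_erase]; grind
  have herase : ∀ i ∈ Finset.range n, ∀ φ : ℕ → ℝ,
      ∑ j ∈ (Finset.range n).erase i, φ j = ∑ j ∈ Finset.range n, φ j - φ i := fun i hi φ => by
    rw [← Finset.add_sum_erase _ _ hi]; ring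
  rw [hoff]
  simp only [degeneratePart]
  rw [Finset.sum_congr rfl fun i hi => herase i hi _,
    Finset.sum_congr rfl fun i hi => herase i hi _]
  simp only [Finset.sum_sub_distrib, Finset.sum_add_distrib, Finset.sum_const, Finset.card_range,
    nsmul_eq_mul, ← Finset.mul_sum]
  ring

/-- **Central limit theorem for `U`-statistics of order two with varying kernels.** -/
theorem tendstoInDistribution_uStatistic (hZm : ∀ i, Measurable (Z i)) (hZi : iIndepFun Z P)
    (hZl : ∀ i, P.map (Z i) = ν) {H : ℕ → S × S → ℝ} (hH : ∀ n, Measurable (H n))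
    (hsymm : ∀ n x y, H n (x, y) = H n (y, x)) (hH2 : ∀ n, MemLp (H n) 2 (ν.prod ν))
    (hlim : Tendsto (fun n : ℕ => (∫ x, H n x ^ 2 ∂(ν.prod ν)) / n) atTop (𝓝 0))
    {d : S → ℝ} (hd : Measurable d) (hd2 : MemLp d 2 ν)
    (hproj : Tendsto (fun n => ∫ z, ((∫ z', H n (z, z') ∂ν) - d z) ^ 2 ∂ν) atTop (𝓝 0)) :
    TendstoInDistribution
      (fun (n : ℕ) (ω : Ω) => Real.sqrt n *
        (((n : ℝ) * (n - 1))⁻¹ * (∑ i ∈ Finset.range n, ∑ j ∈ (Finset.range n).erase i,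
            H n (Z i ω, Z j ω)) -
          ∫ ω', ((n : ℝ) * (n - 1))⁻¹ * (∑ i ∈ Finset.range n, ∑ j ∈ (Finset.range n).erase i,
            H n (Z i ω', Z j ω')) ∂P))
      atTop (id : ℝ → ℝ) (fun _ => P) (gaussianReal 0 (Real.toNNReal (4 * Var[d; ν]))) := by
  have hmp : ∀ i, MeasurePreserving (Z i) P ν := fun i => ⟨hZm i, hZl i⟩
  have hm : ∀ n, Measurable (fun z => ∫ z', H n (z, z') ∂ν) :=
    fun n => measurable_section_integral (hH n)
  have hg : ∀ n, MemLp (fun z => ∫ z', H n (z, z') ∂ν) 2 ν :=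
    fun n => (memLp_projection (hH n) (hH2 n)).1
  have hR := fun n => degeneratePart_spec (ν := ν) (hH n) (hH2 n)
  have hRs : ∀ n x y, degeneratePart ν (H n) (x, y) = degeneratePart ν (H n) (y, x) := by
    intro n x y; simp only [degeneratePart, hsymm n x y]; ring
  set e : ℕ → S → ℝ := fun n z => (∫ z', H n (z, z') ∂ν) - d z with he
  have hem : ∀ n, Measurable (e n) := fun n => (hm n).sub hd
  have he2 : ∀ n, MemLp (e n) 2 ν := fun n => (hg n).sub hd2
  have hRL : ∀ n, ∀ q ∈ (Finset.range n).offDiag,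
      MemLp (fun ω => degeneratePart ν (H n) (Z q.1 ω, Z q.2 ω)) 2 P := fun n q hq =>
    (hR n).2.1.comp_measurePreserving
      (measurePreserving_pair hZm hZi hZl (Finset.mem_offDiag.1 hq).2.2)
  have hHL : ∀ n, ∀ i ∈ Finset.range n, ∀ j ∈ (Finset.range n).erase i,
      MemLp (fun ω => H n (Z i ω, Z j ω)) 2 P := fun n i _ j hj =>
    (hH2 n).comp_measurePreserving
      (measurePreserving_pair hZm hZi hZl (Finset.ne_of_mem_erase hj).symm)
  -- the mean of the statistic
  have hmean : ∀ n : ℕ, 2 ≤ n →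
      ∫ ω', ((n : ℝ) * (n - 1))⁻¹ * (∑ i ∈ Finset.range n, ∑ j ∈ (Finset.range n).erase i,
        H n (Z i ω', Z j ω')) ∂P = ∫ y, H n y ∂(ν.prod ν) := by
    intro n hn
    have hij : ∀ i ∈ Finset.range n, ∀ j ∈ (Finset.range n).erase i,
        ∫ ω, H n (Z i ω, Z j ω) ∂P = ∫ y, H n y ∂(ν.prod ν) := fun i _ j hj => by
      have := measurePreserving_pair hZm hZi hZl (Finset.ne_of_mem_erase hj).symm
      rw [← this.map_eq, integral_map this.measurable.aemeasurable (hH n).aestronglyMeasurable]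
    have hint := fun i hi j hj => (hHL n i hi j hj).integrable (q := 2) (by norm_num)
    rw [integral_const_mul, integral_finsetSum _ fun i hi => integrable_finsetSum _ (hint i hi),
      Finset.sum_congr rfl fun i hi => (integral_finsetSum _ (hint i hi)).trans
        (Finset.sum_congr rfl (hij i hi)),
      Finset.sum_congr rfl fun i hi => by rw [Finset.sum_const, Finset.card_erase_of_mem hi]]
    have h2 : (2 : ℝ) ≤ n := by exact_mod_cast hn
    simp only [Finset.card_range, Finset.sum_const, nsmul_eq_mul,
      Nat.cast_sub (by omega : 1 ≤ n), Nat.cast_one]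
    have h3 : (n : ℝ) - 1 ≠ 0 := by linarith
    field_simp
  -- The rescaled statistic is `A + B + C`: `A` is the i.i.d. sum of the limit projection `d`, `B`
  -- the degenerate part, and `C` the error of replacing the `n`-th projection by `d`.
  set A : ℕ → Ω → ℝ := fun n ω => 2 * ((Real.sqrt n)⁻¹ *
    (∑ i ∈ Finset.range n, d (Z i ω) - n * ∫ ω, d (Z 0 ω) ∂P)) with hA
  set B : ℕ → Ω → ℝ := fun n ω => Real.sqrt n * ((n : ℝ) * (n - 1))⁻¹ *
      (∑ q ∈ (Finset.range n).offDiag, degeneratePart ν (H n) (Z q.1 ω, Z q.2 ω)) with hB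
  set C : ℕ → Ω → ℝ := fun n ω => 2 * (Real.sqrt n)⁻¹ *
      ∑ i ∈ Finset.range n, (e n (Z i ω) - ∫ z, e n z ∂ν) with hC
  have hBL : ∀ n, MemLp (B n) 2 P := fun n => (memLp_finsetSum _ (hRL n)).const_mul _
  have hCL : ∀ n, MemLp (C n) 2 P := fun n =>
    (memLp_finsetSum _ fun i _ => ((he2 n).comp_measurePreserving (hmp i)).sub
      (memLp_const _)).const_mul _
  have hsum : TendstoInDistribution (fun n => A n + (B n + C n)) atTop (id : ℝ → ℝ) (fun _ => P)
      (gaussianReal 0 (Real.toNNReal (4 * Var[d; ν]))) := by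
    have hAlim : TendstoInDistribution A atTop (id : ℝ → ℝ) (fun _ => P)
        (gaussianReal 0 (Real.toNNReal (4 * Var[d; ν]))) := by
      have hVar : Var[fun ω => d (Z 0 ω); P] = Var[d; ν] := by
        rw [← hZl 0, variance_map hd.aemeasurable (hZm 0).aemeasurable]; rfl
      -- The limit of the i.i.d. sum is realized as `x / 2` under the final Gaussian law, so that
      -- the factor 2 in `A` turns it into the identity.
      have hlaw : HasLaw (fun x : ℝ => x / 2)
          (gaussianReal 0 Var[fun ω => d (Z 0 ω); P].toNNReal)
          (gaussianReal 0 (Real.toNNReal (4 * Var[d; ν]))) := by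
        refine ⟨by fun_prop, ?_⟩
        rw [gaussianReal_map_div_const, hVar, zero_div]
        congr 1
        ext
        rw [NNReal.coe_div, Real.coe_toNNReal _ (by positivity [variance_nonneg d ν]),
          Real.coe_toNNReal _ (variance_nonneg d ν)]
        simp only [NNReal.coe_mk]
        ring
      have hclt := tendstoInDistribution_inv_sqrt_mul_sum_sub (X := fun i ω => d (Z i ω)) hlaw
        (hd2.comp_measurePreserving (hmp 0)) (hZi.comp (fun _ => d) fun _ => hd)
        (fun i => (IdentDistrib.mk (hZm i).aemeasurable (hZm 0).aemeasurable
          (by rw [hZl, hZl])).comp hd)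
      refine (hclt.continuous_comp (g := fun x => 2 * x) (by fun_prop)).congr
        (fun n => Filter.EventuallyEq.rfl) (Filter.Eventually.of_forall fun x => ?_)
      simp only [Function.comp, id]; ring
    have hBC : TendstoInMeasure P (fun n => B n + C n) atTop (fun _ => (0 : ℝ)) := by
      refine tendstoInMeasure_zero_of_integral_sq (fun n => (hBL n).add (hCL n)) ?_
      -- The degenerate part contributes `2 / (n - 1) ≤ 4 / n` times 16, the i.i.d. error sum
      -- contributes 4, and `(B + C)² ≤ 2 B² + 2 C²` doubles both.
      have hbound : ∀ n : ℕ, 2 ≤ n → ∫ ω, (B n + C n) ω ^ 2 ∂P ≤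
          128 * ((∫ x, H n x ^ 2 ∂(ν.prod ν)) / n) + 8 * ∫ z, e n z ^ 2 ∂ν := by
        intro n hn
        have h2 : (2 : ℝ) ≤ n := by exact_mod_cast hn
        have hB2 : ∫ ω, B n ω ^ 2 ∂P ≤ 64 * ((∫ x, H n x ^ 2 ∂(ν.prod ν)) / n) := by
          simp only [hB, mul_pow, integral_const_mul]
          rw [integral_sq_degenerate_sum hZm hZi hZl (hR n).1 (hRs n) (hR n).2.1 (hR n).2.2.1,
            Real.sq_sqrt (by positivity)]
          have h16 := (hR n).2.2.2
          have h0 : 0 ≤ ∫ x, H n x ^ 2 ∂(ν.prod ν) := integral_nonneg fun x => sq_nonneg _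
          have hn1 : (0 : ℝ) < n - 1 := by linarith
          calc (n : ℝ) * ((n : ℝ) * (n - 1))⁻¹ ^ 2 * (2 * (n * (n - 1)) *
                ∫ x, degeneratePart ν (H n) x ^ 2 ∂(ν.prod ν))
              = 2 / (n - 1) * ∫ x, degeneratePart ν (H n) x ^ 2 ∂(ν.prod ν) := by field_simp
            _ ≤ 4 / n * (16 * ∫ x, H n x ^ 2 ∂(ν.prod ν)) := by
                refine mul_le_mul ?_ h16 (integral_nonneg fun x => sq_nonneg _) (by positivity)
                rw [div_le_div_iff₀ hn1 (by linarith)]; linarith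
            _ = _ := by ring
        have hC2 : ∫ ω, C n ω ^ 2 ∂P ≤ 4 * ∫ z, e n z ^ 2 ∂ν := by
          simp only [hC, mul_pow, integral_const_mul]
          have := integral_sq_centered_sum hZm hZi hZl (hem n) (he2 n) n
          rw [inv_pow, Real.sq_sqrt (by positivity)]
          calc _ ≤ 2 ^ 2 * (n : ℝ)⁻¹ * (n * ∫ z, e n z ^ 2 ∂ν) := by gcongr
            _ = _ := by field_simp; ring
        calc ∫ ω, (B n + C n) ω ^ 2 ∂P ≤ ∫ ω, (2 * B n ω ^ 2 + 2 * C n ω ^ 2) ∂P := by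
              refine integral_mono ((hBL n).add (hCL n)).integrable_sq
                (((hBL n).integrable_sq.const_mul 2).add ((hCL n).integrable_sq.const_mul 2))
                fun ω => ?_
              simp only [Pi.add_apply]
              nlinarith [sq_nonneg (B n ω - C n ω)]
          _ = 2 * ∫ ω, B n ω ^ 2 ∂P + 2 * ∫ ω, C n ω ^ 2 ∂P := by
              rw [integral_add ((hBL n).integrable_sq.const_mul 2)
                ((hCL n).integrable_sq.const_mul 2), integral_const_mul, integral_const_mul]
          _ ≤ _ := by linarith
      refine tendsto_of_tendsto_of_tendsto_of_le_of_le' tendsto_const_nhds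
        (h := fun n : ℕ => 128 * ((∫ x, H n x ^ 2 ∂(ν.prod ν)) / n) + 8 * ∫ z, e n z ^ 2 ∂ν) ?_
        (Eventually.of_forall fun n => integral_nonneg fun x => sq_nonneg _)
        ((eventually_ge_atTop 2).mono hbound)
      simpa using (hlim.const_mul 128).add (hproj.const_mul 8)
    refine (hAlim.add_of_tendstoInMeasure_const hBC
      fun n => ((hBL n).add (hCL n)).aemeasurable).congr (fun n => Filter.EventuallyEq.rfl)
      (Filter.Eventually.of_forall fun x => ?_)
    simp
  have hdecomp : ∀ n : ℕ, 2 ≤ n → ∀ ω, A n ω + (B n ω + C n ω) = Real.sqrt n *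
        (((n : ℝ) * (n - 1))⁻¹ * (∑ i ∈ Finset.range n, ∑ j ∈ (Finset.range n).erase i,
            H n (Z i ω, Z j ω)) -
          ∫ ω', ((n : ℝ) * (n - 1))⁻¹ * (∑ i ∈ Finset.range n, ∑ j ∈ (Finset.range n).erase i,
            H n (Z i ω', Z j ω')) ∂P) := by
    intro n hn ω
    have h2 : (2 : ℝ) ≤ n := by exact_mod_cast hn
    have hn1 : (n : ℝ) - 1 ≠ 0 := by linarith
    have hn0 : (n : ℝ) ≠ 0 := by linarith
    have hs0 : Real.sqrt n ≠ 0 := (Real.sqrt_pos.2 (by linarith)).ne'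
    have hs : (Real.sqrt n)⁻¹ = Real.sqrt n * (n : ℝ)⁻¹ := by
      field_simp; rw [Real.sq_sqrt (by linarith)]
    have hd0 : ∫ ω, d (Z 0 ω) ∂P = ∫ z, d z ∂ν := by
      rw [← hZl 0, integral_map (hZm 0).aemeasurable hd.aestronglyMeasurable]
    have he0 : ∫ z, e n z ∂ν = ∫ y, H n y ∂(ν.prod ν) - ∫ z, d z ∂ν := by
      rw [integral_prod _ ((hH2 n).integrable (by norm_num)),
        ← integral_sub ((hg n).integrable (by norm_num)) (hd2.integrable (by norm_num))]
    rw [hmean n hn, sum_eq_degenerate_add (ν := ν)]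
    simp only [hA, hB, hC, hd0, he0, hs]
    simp only [he, Finset.sum_sub_distrib, Finset.sum_const, Finset.card_range, nsmul_eq_mul]
    field_simp
    ring
  have hmeas : ∀ n : ℕ, AEMeasurable (fun ω => Real.sqrt n *
        (((n : ℝ) * (n - 1))⁻¹ * (∑ i ∈ Finset.range n, ∑ j ∈ (Finset.range n).erase i,
            H n (Z i ω, Z j ω)) -
          ∫ ω', ((n : ℝ) * (n - 1))⁻¹ * (∑ i ∈ Finset.range n, ∑ j ∈ (Finset.range n).erase i,
            H n (Z i ω', Z j ω')) ∂P)) P := fun n =>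
    (((Finset.aemeasurable_fun_sum _ fun i hi => Finset.aemeasurable_fun_sum _ fun j hj =>
      (hHL n i hi j hj).aemeasurable).const_mul _).sub_const _).const_mul _
  -- The decomposition needs `n ≥ 2`, so the two sequences are compared through their difference,
  -- which is eventually zero.
  refine tendstoInDistribution_of_tendstoInMeasure_sub _ _ hsum ?_ hmeas
  refine (tendstoInMeasure_zero_of_integral_sq (fun n => MemLp.zero) (by simp)).congr' ?_
    Filter.EventuallyEq.rfl
  filter_upwards [eventually_ge_atTop 2] with n hn
  refine Filter.Eventually.of_forall fun ω => ?_
  simp only [Pi.sub_apply, Pi.zero_apply, Pi.add_apply]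
  rw [hdecomp n hn ω, sub_self]

end UStatistic

/-! ### Surface measure of the sphere and integration of zonal functions. -/

section SphereIntegration

open scoped ENNReal

/-- Integration in polar coordinates. -/
lemma lintegral_eq_lintegral_surf {p : ℕ} (hp : 1 ≤ p) {Φ : E p → ℝ≥0∞} (hΦ : Measurable Φ) :
    ∫⁻ x, Φ x = ∫⁻ w : Sph p, (∫⁻ r in Ioi (0 : ℝ),
      ENNReal.ofReal (r ^ (p - 1)) * Φ (r • (w : E p))) ∂(surf p) := by
  have : Nonempty (Fin p) := ⟨⟨0, hp⟩⟩
  have hmp := (volume : Measure (E p)).measurePreserving_homeomorphUnitSphereProd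
  have hdim : Module.finrank ℝ (E p) = p := by simp
  have hmeas : Measurable fun y : Sph p × Ioi (0 : ℝ) => Φ ((y.2 : ℝ) • (y.1 : E p)) := by
    fun_prop
  calc ∫⁻ x, Φ x = ∫⁻ x : ({(0 : E p)}ᶜ : Set (E p)), Φ (x : E p) ∂((volume : Measure (E p)).comap (↑)) := by
        rw [lintegral_subtype_comap (measurableSet_singleton _).compl, restrict_compl_singleton]
    _ = ∫⁻ y, Φ ((y.2 : ℝ) • (y.1 : E p)) ∂((volume : Measure (E p)).toSphere.prod
          (Measure.volumeIoiPow (Module.finrank ℝ (E p) - 1))) := by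
        rw [← hmp.map_eq, lintegral_map hmeas (Homeomorph.measurable _)]
        refine lintegral_congr fun x => ?_
        congr 1
        have hx : ‖(x : E p)‖ ≠ 0 := norm_ne_zero_iff.2 x.2
        simp [smul_smul, mul_inv_cancel₀ hx]
    _ = _ := by
        rw [lintegral_prod _ hmeas.aemeasurable, hdim]
        refine lintegral_congr fun w => ?_
        rw [Measure.volumeIoiPow, lintegral_withDensity_eq_lintegral_mul _ (by fun_prop)
          (by fun_prop), ← lintegral_subtype_comap measurableSet_Ioi]
        rfl

lemma surf_univ {p : ℕ} (hp : 1 ≤ p) : surf p univ = ENNReal.ofReal (sphereArea p) := by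
  have : Nonempty (Fin p) := ⟨⟨0, hp⟩⟩
  have hp0 : (0 : ℝ) < p := by exact_mod_cast hp
  rw [surf, Measure.toSphere_apply_univ, EuclideanSpace.volume_ball]
  simp only [finrank_euclideanSpace, Fintype.card_fin, ENNReal.ofReal_one, one_pow, one_mul]
  rw [← ENNReal.ofReal_natCast, ← ENNReal.ofReal_mul hp0.le]
  congr 1
  rw [sphereArea, Real.Gamma_add_one (by positivity), Real.sqrt_eq_rpow, ← Real.rpow_natCast,
    ← Real.rpow_mul Real.pi_pos.le]
  have := (Real.Gamma_pos_of_pos (by positivity : 0 < (p : ℝ) / 2)).ne'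
  field_simp

lemma sphereArea_pos {p : ℕ} (hp : 1 ≤ p) : 0 < sphereArea p := by
  have hp0 : (0 : ℝ) < p := by exact_mod_cast hp
  exact div_pos (by positivity) (Real.Gamma_pos_of_pos (by positivity))

lemma surf_real_univ {p : ℕ} (hp : 1 ≤ p) : (surf p).real univ = sphereArea p := by
  rw [measureReal_def, surf_univ hp, ENNReal.toReal_ofReal (sphereArea_pos hp).le]

instance (p : ℕ) : IsFiniteMeasure (surf p) := by unfold surf; infer_instance

lemma lintegral_radial {p : ℕ} (hp : 1 ≤ p) {φ : ℝ → ℝ≥0∞} (hφ : Measurable φ) :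
    ∫⁻ x : E p, φ ‖x‖ = ENNReal.ofReal (sphereArea p) *
      ∫⁻ r in Ioi (0 : ℝ), ENNReal.ofReal (r ^ (p - 1)) * φ r := by
  rw [lintegral_eq_lintegral_surf hp (by fun_prop), mul_comm, ← surf_univ hp, ← lintegral_const]
  refine lintegral_congr fun w => setLIntegral_congr_fun measurableSet_Ioi fun r hr => ?_
  have : ‖(w : E p)‖ = 1 := by simp
  simp [norm_smul, this, abs_of_pos (mem_Ioi.1 hr)]

lemma lintegral_first_coord {k : ℕ} {φ : ℝ → ℝ → ℝ≥0∞}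
    (hφ : Measurable (Function.uncurry φ)) :
    ∫⁻ x : E (k + 1), φ (x 0) ‖x‖ = ∫⁻ s : ℝ, ∫⁻ y : E k, φ s (√(s ^ 2 + ‖y‖ ^ 2)) := by
  rw [← (PiLp.volume_preserving_toLp (Fin (k + 1))).lintegral_comp_emb
    (MeasurableEquiv.toLp 2 _).measurableEmbedding,
    ← (volume_preserving_piFinSuccAbove (fun _ : Fin (k + 1) => ℝ) 0).symm.lintegral_comp_emb
    (MeasurableEquiv.measurableEmbedding _), Measure.volume_eq_prod, lintegral_prod]
  · refine lintegral_congr fun s => ?_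
    rw [← (PiLp.volume_preserving_toLp (Fin k)).lintegral_comp_emb
      (MeasurableEquiv.toLp 2 _).measurableEmbedding]
    refine lintegral_congr fun y => ?_
    congr 1
    · rw [EuclideanSpace.norm_eq, EuclideanSpace.norm_eq, Fin.sum_univ_succ,
        Real.sq_sqrt (by positivity)]
      simp [MeasurableEquiv.piFinSuccAbove, Fin.insertNthEquiv]
  · have : Measurable fun x : E (k + 1) => φ (x 0) ‖x‖ :=
      hφ.comp (f := fun x : E (k + 1) => (x 0, ‖x‖)) (by fun_prop)
    exact (this.comp ((MeasurableEquiv.toLp 2 _).measurable.comp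
      (MeasurableEquiv.measurable _))).aemeasurable

/-- Plane polar coordinates `s = r cos θ`, `ρ = r sin θ`: the half-plane `ρ > 0` is `0 < θ < π`, and
the Jacobian `r` turns `ρ ^ (k - 1)` into `r ^ k sin θ ^ (k - 1)`. -/
lemma lintegral_half_plane {k : ℕ} (hk : 1 ≤ k) {ψ G : ℝ → ℝ≥0∞} (hψ : Measurable ψ)
    (hG : Measurable G) :
    ∫⁻ s : ℝ, ∫⁻ ρ in Ioi (0 : ℝ), ENNReal.ofReal (ρ ^ (k - 1)) *
      (ψ (s / √(s ^ 2 + ρ ^ 2)) * G (√(s ^ 2 + ρ ^ 2))) =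
    (∫⁻ r in Ioi (0 : ℝ), ENNReal.ofReal (r ^ k) * G r) *
      ∫⁻ θ in Ioo 0 Real.pi, ψ (Real.cos θ) * ENNReal.ofReal (Real.sin θ ^ (k - 1)) := by
  set f : ℝ × ℝ → ℝ≥0∞ := fun q => (Ioi (0 : ℝ)).indicator (fun ρ => ENNReal.ofReal (ρ ^ (k - 1)) *
      (ψ (q.1 / √(q.1 ^ 2 + ρ ^ 2)) * G (√(q.1 ^ 2 + ρ ^ 2)))) q.2 with hf
  have hfm : Measurable f := by
    have : f = (univ ×ˢ Ioi (0 : ℝ)).indicator (fun q : ℝ × ℝ => ENNReal.ofReal (q.2 ^ (k - 1)) *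
      (ψ (q.1 / √(q.1 ^ 2 + q.2 ^ 2)) * G (√(q.1 ^ 2 + q.2 ^ 2)))) := by
      ext q; simp [hf, indicator]
    rw [this]
    refine Measurable.indicator ?_ (MeasurableSet.univ.prod measurableSet_Ioi)
    fun_prop
  have h1 : ∫⁻ s : ℝ, ∫⁻ ρ in Ioi (0 : ℝ), ENNReal.ofReal (ρ ^ (k - 1)) *
      (ψ (s / √(s ^ 2 + ρ ^ 2)) * G (√(s ^ 2 + ρ ^ 2))) = ∫⁻ q, f q := by
    rw [Measure.volume_eq_prod, lintegral_prod _ hfm.aemeasurable]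
    refine lintegral_congr fun s => ?_
    rw [← lintegral_indicator measurableSet_Ioi]
  rw [h1, ← lintegral_comp_polarCoord_symm]
  have h2 : ∀ q ∈ polarCoord.target, ENNReal.ofReal q.1 • f (polarCoord.symm q) =
      (ENNReal.ofReal (q.1 ^ k) * G q.1) * (Ioi (0 : ℝ)).indicator
        (fun θ => ψ (Real.cos θ) * ENNReal.ofReal (Real.sin θ ^ (k - 1))) q.2 := by
    rintro ⟨r, θ⟩ ⟨hr, hθ⟩
    simp only [mem_Ioi, mem_Ioo] at hr hθ
    simp only [polarCoord_symm_apply, hf, indicator, mem_Ioi, smul_eq_mul]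
    by_cases h0 : 0 < θ
    · have hs : 0 < Real.sin θ := Real.sin_pos_of_pos_of_lt_pi h0 hθ.2
      have hn : √((r * Real.cos θ) ^ 2 + (r * Real.sin θ) ^ 2) = r := by
        rw [show (r * Real.cos θ) ^ 2 + (r * Real.sin θ) ^ 2 = r ^ 2 by
          linear_combination r ^ 2 * Real.sin_sq_add_cos_sq θ, Real.sqrt_sq hr.le]
      rw [if_pos (by positivity), if_pos h0, hn, mul_div_cancel_left₀ _ hr.ne', mul_pow,
        ENNReal.ofReal_mul (by positivity), show r ^ k = r * r ^ (k - 1) by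
          rw [← pow_succ', Nat.sub_add_cancel hk], ENNReal.ofReal_mul hr.le]
      ring
    · have hs : Real.sin θ ≤ 0 := Real.sin_nonpos_of_nonpos_of_neg_pi_le (not_lt.1 h0) hθ.1.le
      rw [if_neg (not_lt.2 (mul_nonpos_of_nonneg_of_nonpos hr.le hs)), if_neg h0, mul_zero,
        mul_zero]
  rw [setLIntegral_congr_fun polarCoord.open_target.measurableSet h2]
  change ∫⁻ q in Ioi (0 : ℝ) ×ˢ Ioo (-Real.pi) Real.pi, _ = _
  rw [Measure.volume_eq_prod, ← Measure.prod_restrict, lintegral_prod_mul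
    (f := fun r => ENNReal.ofReal (r ^ k) * G r) (g := (Ioi (0 : ℝ)).indicator
      (fun θ => ψ (Real.cos θ) * ENNReal.ofReal (Real.sin θ ^ (k - 1)))) (by fun_prop)
    (Measurable.indicator (by fun_prop) measurableSet_Ioi).aemeasurable]
  congr 1
  rw [lintegral_indicator measurableSet_Ioi, Measure.restrict_restrict measurableSet_Ioi]
  congr 2
  ext θ
  simp only [mem_inter_iff, mem_Ioi, mem_Ioo]
  constructor
  · rintro ⟨a, b⟩; exact ⟨a, b.2⟩
  · rintro ⟨a, b⟩; exact ⟨a, by linarith [Real.pi_pos], b⟩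

/-- Integration over the sphere of a function of the cosine of the angle with a fixed direction. -/
theorem lintegral_surf_inner {p : ℕ} (hp : 2 ≤ p) (v : Sph p) {ψ : ℝ → ℝ≥0∞} (hψ : Measurable ψ) :
    ∫⁻ w, ψ (inner ℝ (v : E p) (w : E p)) ∂(surf p) = ENNReal.ofReal (sphereArea (p - 1)) *
      ∫⁻ θ in Ioo 0 Real.pi, ψ (Real.cos θ) * ENNReal.ofReal (Real.sin θ ^ (p - 2)) := by
  obtain ⟨k, rfl⟩ : ∃ k, p = k + 1 := ⟨p - 1, by omega⟩
  have hk : 1 ≤ k := by omega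
  -- The radial cut-off makes the radial factor `c = 1 / (k + 1)` finite and nonzero. One integral
  -- over the whole space, computed in spherical coordinates and by slicing along `v`, carries `c`
  -- on both sides, where it cancels.
  set G : ℝ → ℝ≥0∞ := (Ioo (0 : ℝ) 1).indicator 1 with hG
  have hGm : Measurable G := measurable_one.indicator measurableSet_Ioo
  set c : ℝ≥0∞ := ∫⁻ r in Ioi (0 : ℝ), ENNReal.ofReal (r ^ k) * G r with hc
  have hceq : c = ENNReal.ofReal (1 / (k + 1)) := by
    have : ∀ r : ℝ, ENNReal.ofReal (r ^ k) * G r =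
        (Ioo (0 : ℝ) 1).indicator (fun r => ENNReal.ofReal (r ^ k)) r := fun r => by
      simp [hG, indicator]
    simp_rw [hc, this]
    rw [lintegral_indicator measurableSet_Ioo, Measure.restrict_restrict measurableSet_Ioo,
      inter_eq_left.2 Ioo_subset_Ioi_self, Measure.restrict_congr_set Ioo_ae_eq_Ioc,
      ← ofReal_integral_eq_lintegral_ofReal
        (intervalIntegral.intervalIntegrable_pow k).1, ← intervalIntegral.integral_of_le
        zero_le_one]
    · simp
    · filter_upwards [ae_restrict_mem measurableSet_Ioc] with y hy
      exact pow_nonneg hy.1.le _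
  have hc0 : c ≠ 0 := by rw [hceq]; simp; positivity
  have hct : c ≠ ⊤ := by rw [hceq]; exact ENNReal.ofReal_ne_top
  have hv : ‖(v : E (k + 1))‖ = 1 := by simp
  -- the integral of `ψ (cos angle) G (norm)` over the space, in polar coordinates
  have h1 : ∫⁻ x : E (k + 1), ψ (inner ℝ (v : E (k + 1)) x / ‖x‖) * G ‖x‖ =
      (∫⁻ w, ψ (inner ℝ (v : E (k + 1)) (w : E (k + 1))) ∂(surf (k + 1))) * c := by
    rw [lintegral_eq_lintegral_surf (by omega) (by fun_prop), ← lintegral_mul_const _ (by fun_prop)]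
    refine lintegral_congr fun w => ?_
    rw [hc, ← lintegral_const_mul _ (by fun_prop)]
    refine setLIntegral_congr_fun measurableSet_Ioi fun r hr => ?_
    have hw : ‖(w : E (k + 1))‖ = 1 := by simp
    have hr : 0 < r := hr
    simp only [norm_smul, hw, Real.norm_eq_abs, abs_of_pos hr, mul_one, inner_smul_right,
      Nat.add_sub_cancel]
    rw [mul_div_cancel_left₀ _ hr.ne']
    ring
  -- rotate `v` to the first basis vector
  set e : E (k + 1) := EuclideanSpace.single 0 1 with he
  set ρ := (ℝ ∙ (e - (v : E (k + 1))))ᗮ.reflection with hρ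
  have hρe : ρ e = v := Submodule.reflection_sub (by rw [hv]; simp [he])
  have h2 : ∫⁻ x : E (k + 1), ψ (inner ℝ (v : E (k + 1)) x / ‖x‖) * G ‖x‖ =
      ∫⁻ x : E (k + 1), ψ (x 0 / ‖x‖) * G ‖x‖ := by
    rw [← ρ.measurePreserving.lintegral_comp_emb ρ.toHomeomorph.measurableEmbedding]
    refine lintegral_congr fun x => ?_
    rw [← hρe, LinearIsometryEquiv.inner_map_map, LinearIsometryEquiv.norm_map]
    simp [he, EuclideanSpace.inner_single_left]
  have h3 : ∫⁻ x : E (k + 1), ψ (x 0 / ‖x‖) * G ‖x‖ =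
      ENNReal.ofReal (sphereArea k) * (c * ∫⁻ θ in Ioo 0 Real.pi,
        ψ (Real.cos θ) * ENNReal.ofReal (Real.sin θ ^ (k - 1))) := by
    rw [lintegral_first_coord (φ := fun s t => ψ (s / t) * G t)
      (by unfold Function.uncurry; fun_prop), ← lintegral_half_plane hk hψ hGm,
      ← lintegral_const_mul']
    · refine lintegral_congr fun s => ?_
      exact lintegral_radial hk (φ := fun ρ => ψ (s / √(s ^ 2 + ρ ^ 2)) * G (√(s ^ 2 + ρ ^ 2)))
        (by fun_prop)
    · exact ENNReal.ofReal_ne_top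
  have h4 := h1.symm.trans (h2.trans h3)
  rw [Nat.add_sub_cancel, show k + 1 - 2 = k - 1 by omega]
  refine (ENNReal.mul_left_inj hc0 hct).1 (h4.trans ?_)
  ring

end SphereIntegration

/-! ### Normalization and size of the Langevin kernel. -/

section LangevinKernel

open scoped ENNReal

/-- The exponent in the Bessel integral is `(p - 3) / 2`. It is negative only for `p = 2`, where the
integrand is the derivative of `arcsin`; otherwise the integrand is continuous. -/
lemma intervalIntegrable_one_sub_sq_rpow {a : ℝ} (ha : a = -(1 / 2) ∨ 0 ≤ a) :
    IntervalIntegrable (fun t : ℝ => (1 - t ^ 2) ^ a) volume (-1) 1 := by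
  rcases ha with rfl | ha
  · have h : IntervalIntegrable (fun t : ℝ => 1 / √(1 - t ^ 2)) volume (-1) 1 := by
      refine intervalIntegral.intervalIntegrable_deriv_of_nonneg (g := Real.arcsin)
        Real.continuous_arcsin.continuousOn (fun x hx => ?_) (fun x hx => by positivity)
      rw [min_eq_left (by norm_num), max_eq_right (by norm_num)] at hx
      exact Real.hasDerivAt_arcsin hx.1.ne' hx.2.ne
    refine h.congr_uIoo fun t ht => ?_
    rw [uIoo_of_le (by norm_num)] at ht
    have : 0 ≤ 1 - t ^ 2 := by nlinarith [ht.1, ht.2]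
    simp only
    rw [Real.rpow_neg this, Real.sqrt_eq_rpow, one_div]
  · refine Continuous.intervalIntegrable ?_ _ _
    exact (by fun_prop : Continuous fun t : ℝ => 1 - t ^ 2).rpow_const fun x => Or.inr ha

lemma besselI_pos {p : ℕ} (hp : 2 ≤ p) {κ : ℝ} (hκ : 0 < κ) :
    0 < besselI ((p : ℝ) / 2 - 1) κ := by
  have hp2 : (2 : ℝ) ≤ p := by exact_mod_cast hp
  refine mul_pos (div_pos (by positivity) (mul_pos (Real.Gamma_pos_of_pos (by linarith))
    (Real.Gamma_pos_of_pos (by norm_num)))) ?_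
  refine intervalIntegral.intervalIntegral_pos_of_pos_on ?_ (fun t ht => ?_) (by norm_num)
  · refine (intervalIntegrable_one_sub_sq_rpow ?_).continuousOn_mul (by fun_prop)
    rcases hp.eq_or_lt with rfl | h
    · left; norm_num
    · right
      have : (3 : ℝ) ≤ p := by exact_mod_cast h
      linarith
  · have : 0 < 1 - t ^ 2 := by nlinarith [ht.1, ht.2]
    positivity

/-- The normalizing integral of the Langevin distribution, up to the factor `ω_{p-2}`. -/
def langevinMass (p : ℕ) (κ : ℝ) : ℝ :=
  ∫ θ in (0 : ℝ)..Real.pi, Real.exp (κ * Real.cos θ) * Real.sin θ ^ (p - 2)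

/-- The normalized Langevin kernel `L(κ t) / c₁(κ)`. -/
def langevinDensity (p : ℕ) (κ t : ℝ) : ℝ :=
  Real.exp (κ * t) / (sphereArea (p - 1) * langevinMass p κ)

lemma langevinMass_pos (p : ℕ) (κ : ℝ) : 0 < langevinMass p κ := by
  refine intervalIntegral.intervalIntegral_pos_of_pos_on
    (Continuous.intervalIntegrable (by fun_prop) _ _) (fun θ hθ => ?_) Real.pi_pos
  have := Real.sin_pos_of_pos_of_lt_pi hθ.1 hθ.2
  positivity

/-- The Bessel prefactor of `L` does not depend on `t` and cancels against the one inside `c₁`. Its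
positivity is what makes the cancellation legitimate. -/
lemma langevin_div_c1 {p : ℕ} (hp : 2 ≤ p) {κ : ℝ} (hκ : 0 < κ) (t : ℝ) :
    langevin p κ t / c1 p κ = langevinDensity p κ t := by
  have hB := besselI_pos hp hκ
  have hω := sphereArea_pos (p := p - 1) (by omega)
  have hJ := langevinMass_pos p κ
  set A : ℝ := κ ^ ((p : ℝ) / 2 - 1) *
    ((2 * Real.pi) ^ ((p : ℝ) / 2) * besselI ((p : ℝ) / 2 - 1) κ)⁻¹ with hA
  have hApos : 0 < A := by positivity
  have hc1 : c1 p κ = sphereArea (p - 1) * (A * langevinMass p κ) := by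
    rw [c1, langevinMass, ← intervalIntegral.integral_const_mul A]
    simp only [langevin, ← hA, mul_assoc]
  rw [hc1, langevinDensity, langevin, ← hA]
  field_simp

lemma langevinDensity_pos {p : ℕ} (hp : 2 ≤ p) (κ t : ℝ) : 0 < langevinDensity p κ t :=
  div_pos (Real.exp_pos _) (mul_pos (sphereArea_pos (by omega)) (langevinMass_pos p κ))

lemma continuous_langevinDensity (p : ℕ) (κ : ℝ) : Continuous (langevinDensity p κ) := by
  unfold langevinDensity; fun_prop

/-- Slicing the sphere along `v` turns the integral into `langevinMass`, by which the density is
normalized, whatever the direction `v`. -/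
lemma lintegral_langevinDensity {p : ℕ} (hp : 2 ≤ p) (κ : ℝ) (v : Sph p) :
    ∫⁻ w, ENNReal.ofReal (langevinDensity p κ (inner ℝ (v : E p) (w : E p))) ∂(surf p) = 1 := by
  have hω := sphereArea_pos (p := p - 1) (by omega)
  have hJ := langevinMass_pos p κ
  rw [lintegral_surf_inner hp v (ψ := fun t => ENNReal.ofReal (langevinDensity p κ t))
    (continuous_langevinDensity p κ).measurable.ennreal_ofReal]
  have h1 : ∀ θ, ENNReal.ofReal (langevinDensity p κ (Real.cos θ)) *
      ENNReal.ofReal (Real.sin θ ^ (p - 2)) = ENNReal.ofReal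
        ((sphereArea (p - 1) * langevinMass p κ)⁻¹ *
          (Real.exp (κ * Real.cos θ) * Real.sin θ ^ (p - 2))) := fun θ => by
    rw [← ENNReal.ofReal_mul (langevinDensity_pos hp _ _).le, langevinDensity]
    congr 1; ring
  simp_rw [h1]
  have hint : IntervalIntegrable (fun θ => (sphereArea (p - 1) * langevinMass p κ)⁻¹ *
          (Real.exp (κ * Real.cos θ) * Real.sin θ ^ (p - 2))) volume 0 Real.pi :=
    Continuous.intervalIntegrable (by fun_prop) _ _
  rw [Measure.restrict_congr_set Ioo_ae_eq_Ioc, ← ofReal_integral_eq_lintegral_ofReal hint.1,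
    ← intervalIntegral.integral_of_le Real.pi_pos.le, intervalIntegral.integral_const_mul,
    ← langevinMass, ← ENNReal.ofReal_mul hω.le, ← ENNReal.ofReal_one]
  · congr 1; field_simp
  · filter_upwards [ae_restrict_mem measurableSet_Ioc] with θ hθ
    have := Real.sin_nonneg_of_nonneg_of_le_pi hθ.1.le hθ.2
    simp only [Pi.zero_apply]
    positivity

/-- Lower bound for the mass of the Langevin kernel with a large concentration parameter. -/
lemma le_langevinMass {p : ℕ} (hp : 2 ≤ p) {κ : ℝ} (hκ : 1 ≤ κ) :
    Real.exp (κ - 1 / 2) * ((Real.pi ^ (p - 2))⁻¹ / 2 * κ ^ (-(((p : ℝ) - 1) / 2))) ≤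
      langevinMass p κ := by
  -- The kernel lives at angular scale `s = κ ^ (-1/2)`. On `[s / 2, s]` one has `κ cos θ ≥ κ - κ s²
  -- / 2 = κ - 1/2` and `sin θ ≥ 2 θ / π ≥ s / π`, on a length `s / 2`; the powers of `s` combine to
  -- `κ ^ (-(p - 1) / 2)`.
  set s : ℝ := κ ^ (-(1 / 2) : ℝ) with hs
  have hs0 : 0 < s := by positivity
  have hs1 : s ≤ 1 := Real.rpow_le_one_of_one_le_of_nonpos hκ (by norm_num)
  have hs2 : κ * s ^ 2 = 1 := by
    rw [hs, ← Real.rpow_natCast, ← Real.rpow_mul (by linarith)]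
    norm_num
    rw [Real.rpow_neg_one, mul_inv_cancel₀ (by linarith)]
  have hsp : κ ^ (-(((p : ℝ) - 1) / 2)) = s ^ (p - 2) * s := by
    rw [← pow_succ, hs, ← Real.rpow_natCast, ← Real.rpow_mul (by linarith),
      show p - 2 + 1 = p - 1 by omega, Nat.cast_sub (by omega)]
    congr 1; push_cast; ring
  have hpi := Real.pi_gt_three
  have hcont : Continuous fun θ => Real.exp (κ * Real.cos θ) * Real.sin θ ^ (p - 2) := by fun_prop
  have hsub : ∫ θ in (s / 2)..s, Real.exp (κ * Real.cos θ) * Real.sin θ ^ (p - 2) ≤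
      langevinMass p κ := by
    refine intervalIntegral.integral_mono_interval (by positivity) (by linarith) (by linarith) ?_
      (hcont.intervalIntegrable _ _)
    filter_upwards [ae_restrict_mem measurableSet_Ioc] with θ hθ
    have := Real.sin_nonneg_of_nonneg_of_le_pi hθ.1.le hθ.2
    simp only [Pi.zero_apply]
    positivity
  refine le_trans ?_ hsub
  have hconst : Real.exp (κ - 1 / 2) * ((Real.pi ^ (p - 2))⁻¹ / 2 * κ ^ (-(((p : ℝ) - 1) / 2))) =
      ∫ θ in (s / 2)..s, Real.exp (κ - 1 / 2) * (s / Real.pi) ^ (p - 2) := by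
    rw [intervalIntegral.integral_const, hsp, smul_eq_mul, div_pow]
    field_simp
    ring
  rw [hconst]
  refine intervalIntegral.integral_mono_on (by linarith) (by simp)
    (hcont.intervalIntegrable _ _) fun θ hθ => ?_
  have hθ0 : 0 < θ := by linarith [hθ.1]
  refine mul_le_mul (Real.exp_le_exp.2 ?_) (pow_le_pow_left₀ (by positivity) ?_ _) (by positivity)
    (by positivity)
  · have h1 := Real.one_sub_sq_div_two_le_cos (x := θ)
    have h2 : θ ^ 2 ≤ s ^ 2 := by gcongr; exact hθ.2
    nlinarith
  · have h1 := Real.mul_le_sin hθ0.le (by linarith [hθ.2])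
    refine le_trans ?_ h1
    rw [div_eq_mul_inv, div_eq_mul_inv]
    have : 0 < Real.pi⁻¹ := by positivity
    nlinarith [hθ.1]

/-- Inverts the lower bound on the mass. At `t = 1` it yields the growth rate in the second moment
of the statistic's kernel; away from `t = 1` its exponential factor yields concentration. -/
lemma exists_langevinDensity_le {p : ℕ} (hp : 2 ≤ p) :
    ∃ C : ℝ, 0 < C ∧ ∀ κ : ℝ, 1 ≤ κ → ∀ t,
      langevinDensity p κ t ≤ C * κ ^ (((p : ℝ) - 1) / 2) * Real.exp (κ * (t - 1)) := by
  have hω := sphereArea_pos (p := p - 1) (by omega)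
  refine ⟨(sphereArea (p - 1))⁻¹ * Real.exp (1 / 2) * (Real.pi ^ (p - 2) * 2), by positivity,
    fun κ hκ t => ?_⟩
  have hJ := langevinMass_pos p κ
  have hle := le_langevinMass hp hκ
  have hκ0 : 0 < κ := by linarith
  rw [langevinDensity, div_le_iff₀ (by positivity)]
  have e1 : Real.exp (κ * (t - 1)) = Real.exp (κ * t) * (Real.exp κ)⁻¹ := by
    rw [← Real.exp_neg, ← Real.exp_add]; congr 1; ring
  have e2 : Real.exp (κ - 1 / 2) = Real.exp κ * (Real.exp (1 / 2))⁻¹ := by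
    rw [← Real.exp_neg, ← Real.exp_add]; congr 1
  rw [Real.rpow_neg hκ0.le, e2] at hle
  rw [e1]
  have hK : 0 < κ ^ (((p : ℝ) - 1) / 2) := by positivity
  calc Real.exp (κ * t) = (sphereArea (p - 1))⁻¹ * Real.exp (1 / 2) * (Real.pi ^ (p - 2) * 2) *
        κ ^ (((p : ℝ) - 1) / 2) * (Real.exp (κ * t) * (Real.exp κ)⁻¹) * (sphereArea (p - 1) *
        (Real.exp κ * (Real.exp (1 / 2))⁻¹ *
          ((Real.pi ^ (p - 2))⁻¹ / 2 * (κ ^ (((p : ℝ) - 1) / 2))⁻¹))) := by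
        field_simp
    _ ≤ _ := by gcongr

lemma langevinDensity_le_one {p : ℕ} (hp : 2 ≤ p) {κ t : ℝ} (hκ : 0 ≤ κ) (ht : t ≤ 1) :
    langevinDensity p κ t ≤ langevinDensity p κ 1 := by
  have := langevinMass_pos p κ
  have := sphereArea_pos (p := p - 1) (by omega)
  unfold langevinDensity
  gcongr

end LangevinKernel

/-! ### Boundedness of integrable functions with a uniformly continuous second derivative. -/

section Boundedness

lemma exists_mem_Icc_le_of_integrable {φ : ℝ → ℝ} (h0 : ∀ u > 0, 0 ≤ φ u)
    (hi : IntegrableOn φ (Ioi 0)) {c η : ℝ} (hc : 0 < c) (hη : 0 < η) :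
    ∃ x ∈ Icc c (c + η), φ x ≤ ((∫ u in Ioi 0, φ u) + 1) / η := by
  by_contra! hcon
  have hsub : Icc c (c + η) ⊆ Ioi 0 := fun x hx => hc.trans_le hx.1
  have h1 : ((∫ u in Ioi 0, φ u) + 1) / η * volume.real (Icc c (c + η)) ≤
      ∫ u in Icc c (c + η), φ u :=
    setIntegral_ge_of_const_le_real measurableSet_Icc (by simp) (fun x hx => (hcon x hx).le)
      (hi.mono_set hsub)
  have h2 : ∫ u in Icc c (c + η), φ u ≤ ∫ u in Ioi 0, φ u :=
    setIntegral_mono_set hi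
      ((ae_restrict_mem measurableSet_Ioi).mono fun x hx => h0 x hx) hsub.eventuallyLE
  rw [Real.volume_real_Icc_of_le (by linarith), add_sub_cancel_left, div_mul_cancel₀ _ hη.ne'] at h1
  linarith

/-- A nonnegative integrable function on the half-line with a uniformly continuous second
derivative is bounded. -/
theorem bounded_of_uniformContinuousOn_deriv_deriv {φ : ℝ → ℝ} (h0 : ∀ u > 0, 0 ≤ φ u)
    (hi : IntegrableOn φ (Ioi 0)) (hd : DifferentiableOn ℝ φ (Ioi 0))
    (hd2 : DifferentiableOn ℝ (deriv φ) (Ioi 0))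
    (huc : UniformContinuousOn (deriv (deriv φ)) (Ioi 0)) :
    ∃ C, ∀ u > 0, φ u ≤ C := by
  obtain ⟨δ', hδ', hδ⟩ := Metric.uniformContinuousOn_iff.1 huc 1 one_pos
  -- The window `[u, u + 7η]` has length `δ' / 2`, so `φ''` varies by less than 1 on it. It holds
  -- four points with `φ ≤ M`, in alternate cells of width `η` and thus at least `η` apart. Mean
  -- values give two points with `|φ'| ≤ M / η`, then one with `|φ''| ≤ 2 M / η²`. The resulting
  -- bounds propagate over the window to `φ''`, `φ'` and `φ`, with constants independent of `u`.
  set η : ℝ := δ' / 14 with hη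
  have hη0 : 0 < η := by positivity
  set M : ℝ := ((∫ u in Ioi 0, φ u) + 1) / η with hM
  have hM0 : 0 ≤ M := by
    have : 0 ≤ ∫ u in Ioi 0, φ u := setIntegral_nonneg measurableSet_Ioi h0
    positivity
  set B : ℝ := (M / η + M / η) / η + 1 with hB
  set D : ℝ := M / η + B * (7 * η) with hD
  refine ⟨M + D * (7 * η), fun u hu => ?_⟩
  have hda : ∀ x > 0, DifferentiableAt ℝ φ x := fun x hx =>
    (hd x hx).differentiableAt (Ioi_mem_nhds hx)
  have hda2 : ∀ x > 0, DifferentiableAt ℝ (deriv φ) x := fun x hx =>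
    (hd2 x hx).differentiableAt (Ioi_mem_nhds hx)
  obtain ⟨x₀, hx₀, hφ₀⟩ := exists_mem_Icc_le_of_integrable h0 hi hu hη0
  obtain ⟨x₁, hx₁, hφ₁⟩ := exists_mem_Icc_le_of_integrable h0 hi
    (by positivity : 0 < u + 2 * η) hη0
  obtain ⟨x₂, hx₂, hφ₂⟩ := exists_mem_Icc_le_of_integrable h0 hi
    (by positivity : 0 < u + 4 * η) hη0
  obtain ⟨x₃, hx₃, hφ₃⟩ := exists_mem_Icc_le_of_integrable h0 hi
    (by positivity : 0 < u + 6 * η) hη0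
  simp only [mem_Icc] at hx₀ hx₁ hx₂ hx₃
  have slope : ∀ a b : ℝ, u ≤ a → a + η ≤ b → φ a ≤ M → φ b ≤ M →
      ∃ ξ ∈ Ioo a b, |deriv φ ξ| ≤ M / η := by
    intro a b ha hab hφa hφb
    obtain ⟨ξ, hξ, he⟩ := exists_deriv_eq_slope φ (by linarith : a < b)
      (fun x hx => (hda x (by linarith [hx.1])).continuousAt.continuousWithinAt)
      (fun x hx => (hda x (by linarith [hx.1])).differentiableWithinAt)
    refine ⟨ξ, hξ, ?_⟩
    rw [he, abs_div, abs_of_pos (by linarith : 0 < b - a)]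
    have := h0 a (by linarith)
    have := h0 b (by linarith)
    gcongr
    · exact abs_le.2 ⟨by linarith, by linarith⟩
    · linarith
  obtain ⟨ξ₁, hξ₁, hb₁⟩ := slope x₀ x₁ (by linarith) (by linarith) hφ₀ hφ₁
  obtain ⟨ξ₂, hξ₂, hb₂⟩ := slope x₂ x₃ (by linarith) (by linarith) hφ₂ hφ₃
  simp only [mem_Ioo] at hξ₁ hξ₂
  obtain ⟨ζ, hζ, he⟩ := exists_deriv_eq_slope (deriv φ) (by linarith : ξ₁ < ξ₂)
      (fun x hx => (hda2 x (by linarith [hx.1])).continuousAt.continuousWithinAt)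
      (fun x hx => (hda2 x (by linarith [hx.1])).differentiableWithinAt)
  simp only [mem_Ioo] at hζ
  have hζb : |deriv (deriv φ) ζ| ≤ (M / η + M / η) / η := by
    rw [he, abs_div, abs_of_pos (by linarith : 0 < ξ₂ - ξ₁)]
    gcongr
    · exact (abs_sub _ _).trans (add_le_add hb₂ hb₁)
    · linarith
  have h7 : ∀ y ∈ Icc u (u + 7 * η), ‖deriv (deriv φ) y‖ ≤ B := by
    intro y hy
    simp only [mem_Icc] at hy
    have := hδ y (by simp only [mem_Ioi]; linarith) ζ (by simp only [mem_Ioi]; linarith)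
      (by rw [Real.dist_eq, abs_lt]; constructor <;> linarith)
    rw [Real.dist_eq] at this
    rw [Real.norm_eq_abs]
    calc |deriv (deriv φ) y| = |(deriv (deriv φ) y - deriv (deriv φ) ζ) + deriv (deriv φ) ζ| := by
          ring_nf
      _ ≤ _ := (abs_add_le _ _).trans (by rw [hB]; linarith)
  have hξI : ξ₁ ∈ Icc u (u + 7 * η) := ⟨by linarith, by linarith⟩
  have h8 : ∀ y ∈ Icc u (u + 7 * η), ‖deriv φ y‖ ≤ D := by
    intro y hy
    have := (convex_Icc u (u + 7 * η)).norm_image_sub_le_of_norm_deriv_le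
      (fun x hx => hda2 x (by linarith [hx.1])) h7 hξI hy
    simp only [mem_Icc] at hy
    have h9 : ‖y - ξ₁‖ ≤ 7 * η := by
      rw [Real.norm_eq_abs, abs_le]; constructor <;> linarith
    have hB0 : 0 ≤ B := by positivity
    calc ‖deriv φ y‖ = ‖(deriv φ y - deriv φ ξ₁) + deriv φ ξ₁‖ := by ring_nf
      _ ≤ B * (7 * η) + M / η := (norm_add_le _ _).trans
          (add_le_add (this.trans (by gcongr)) hb₁)
      _ = D := by rw [hD]; ring
  have hxI : x₀ ∈ Icc u (u + 7 * η) := ⟨by linarith, by linarith⟩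
  have huI : u ∈ Icc u (u + 7 * η) := ⟨by linarith, by linarith⟩
  have := (convex_Icc u (u + 7 * η)).norm_image_sub_le_of_norm_deriv_le
      (fun x hx => hda x (by linarith [hx.1])) h8 hxI huI
  have h9 : ‖u - x₀‖ ≤ 7 * η := by
    rw [Real.norm_eq_abs, abs_le]; constructor <;> linarith
  have hD0 : 0 ≤ D := by positivity
  have h10 := (Real.le_norm_self _).trans (this.trans (mul_le_mul_of_nonneg_left h9 hD0))
  linarith

end Boundedness

/-! ### Integrability of the cube of the density. -/

section Cube

variable {A S : Type*} [MeasurableSpace A] [MeasurableSpace S] {l : Measure A} {s : Measure S}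
  [SFinite l] [IsFiniteMeasure s]

/-- If `F ≥ 0` is integrable and bounded off a small set of directions, and `F (F - r)²` is
integrable where `r` is the directional mean of `F`, then `F³` is integrable. -/
theorem integrable_cube_of_mean {F : A × S → ℝ} (hF : Measurable F) (h0 : ∀ z, 0 ≤ F z)
    (hi : Integrable F (l.prod s)) {r : A → ℝ} (hr : Measurable r)
    (hω : 0 < s.real univ) (hrm : ∀ᵐ u ∂l, s.real univ * r u = ∫ v, F (u, v) ∂s)
    (hQ : Integrable (fun z => F z * (F z - r z.1) ^ 2) (l.prod s))
    {G : Set S} (hG : MeasurableSet G) (hGs : s.real Gᶜ ≤ s.real univ / 8) {C : ℝ} (hC : 0 ≤ C)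
    (hb : ∀ u, ∀ v ∈ G, F (u, v) ≤ C) :
    Integrable (fun u => r u ^ 3) l ∧ Integrable (fun z => F z ^ 3) (l.prod s) := by
  set ω := s.real univ with hωdef
  have hr0 : ∀ᵐ u ∂l, 0 ≤ r u := by
    filter_upwards [hrm] with u hu
    have : 0 ≤ ∫ v, F (u, v) ∂s := integral_nonneg fun v => h0 _
    rw [← hu] at this
    exact nonneg_of_mul_nonneg_right this hω
  have hri : Integrable r l := by
    refine (hi.integral_prod_left.const_mul ω⁻¹).congr ?_
    filter_upwards [hrm] with u hu
    rw [← hu, inv_mul_cancel_left₀ hω.ne']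
  have hr3 : Integrable (fun u => r u ^ 3) l := by
    refine Integrable.mono' ((hri.const_mul ((4 * C) ^ 2)).add
      (hQ.integral_prod_left.const_mul (2 / ω))) (hr.pow_const 3).aestronglyMeasurable ?_
    filter_upwards [hrm, hr0, hi.prod_right_ae, hQ.prod_right_ae] with u hu hu0 hiu hQu
    rw [Real.norm_eq_abs, abs_of_nonneg (by positivity)]
    simp only [Pi.add_apply]
    have hQ0 : 0 ≤ ∫ v, F (u, v) * (F (u, v) - r u) ^ 2 ∂s :=
      integral_nonneg fun v => mul_nonneg (h0 _) (sq_nonneg _)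
    -- If `r ≤ 4C`, then `r³ ≤ (4C)² r`. Otherwise write `ω r³ = ∫ r² F` and split the directions.
    -- On `G`, `F ≤ C < r / 4` gives at most `ω r³ / 4`. Off `G` with `F ≤ 2r`, the measure bound `ω
    -- / 8` gives at most `ω r³ / 4`. Off `G` with `F > 2r`, `r² ≤ (F - r)²`. Hence `ω r³ / 2 ≤ ∫ F
    -- (F - r)²`.
    rcases le_or_gt (r u) (4 * C) with hle | hgt
    · have : r u ^ 3 ≤ (4 * C) ^ 2 * r u := by
        rw [pow_succ]; gcongr
      have : 0 ≤ 2 / ω * ∫ v, F (u, v) * (F (u, v) - r u) ^ 2 ∂s := by positivity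
      linarith
    · have hle : ∫ v, r u ^ 2 * F (u, v) ∂s ≤ ∫ v, (r u ^ 2 * C +
          (Gᶜ.indicator (fun _ => 2 * r u ^ 3) v) + F (u, v) * (F (u, v) - r u) ^ 2) ∂s := by
        have hind : Integrable (Gᶜ.indicator (fun _ => 2 * r u ^ 3)) s :=
          (integrable_const _).indicator hG.compl
        refine integral_mono (hiu.const_mul _) (((integrable_const _).add hind).add hQu) fun v => ?_
        have hFv := h0 (u, v)
        by_cases hv : v ∈ G
        · have := hb u v hv
          have h1 : 0 ≤ F (u, v) * (F (u, v) - r u) ^ 2 := mul_nonneg hFv (sq_nonneg _)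
          have h2 : r u ^ 2 * F (u, v) ≤ r u ^ 2 * C := by gcongr
          simp only [indicator, mem_compl_iff, hv, not_true, if_false]
          linarith
        · simp only [indicator, mem_compl_iff, hv, not_false_iff, if_true]
          have h3 : 0 ≤ r u ^ 2 * C := by positivity
          rcases le_or_gt (F (u, v)) (2 * r u) with h | h
          · have h1 : 0 ≤ F (u, v) * (F (u, v) - r u) ^ 2 := mul_nonneg hFv (sq_nonneg _)
            have : r u ^ 2 * F (u, v) ≤ 2 * r u ^ 3 := by nlinarith [sq_nonneg (r u)]
            linarith
          · have h1 : r u ^ 2 ≤ (F (u, v) - r u) ^ 2 := by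
              apply pow_le_pow_left₀ hu0; linarith
            have h2 := mul_le_mul_of_nonneg_left h1 hFv
            have : 0 ≤ 2 * r u ^ 3 := by positivity
            linarith
      have hind : Integrable (Gᶜ.indicator (fun _ => 2 * r u ^ 3)) s :=
          (integrable_const _).indicator hG.compl
      have hci : Integrable (fun v => r u ^ 2 * C + Gᶜ.indicator (fun _ => 2 * r u ^ 3) v) s :=
        (integrable_const _).add hind
      rw [integral_const_mul, ← hu, integral_add hci hQu, integral_add (integrable_const _) hind,
        integral_indicator hG.compl, setIntegral_const, integral_const] at hle
      simp only [smul_eq_mul, ← hωdef] at hle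
      have hr3p : 0 ≤ r u ^ 3 := by positivity
      have e1 : s.real Gᶜ * (2 * r u ^ 3) ≤ ω / 8 * (2 * r u ^ 3) := by gcongr
      have e2 : ω * (r u ^ 2 * C) ≤ ω * (r u ^ 2 * (r u / 4)) := by
        gcongr; linarith
      have e3 : ω / 2 * r u ^ 3 ≤ ∫ v, F (u, v) * (F (u, v) - r u) ^ 2 ∂s := by nlinarith
      have e4 : r u ^ 3 ≤ 2 / ω * ∫ v, F (u, v) * (F (u, v) - r u) ^ 2 ∂s := by
        rw [div_mul_eq_mul_div, le_div_iff₀ hω]; linarith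
      have : 0 ≤ (4 * C) ^ 2 * r u := by positivity
      linarith
  refine ⟨hr3, ?_⟩
  have hr3' : Integrable (fun z : A × S => r z.1 ^ 3) (l.prod s) :=
    hr3.comp_fst s
  refine Integrable.mono' ((hQ.const_mul 4).add (hr3'.const_mul 8))
    (hF.pow_const 3).aestronglyMeasurable ?_
  have hr0' : ∀ᵐ z ∂(l.prod s), 0 ≤ r z.1 := Measure.quasiMeasurePreserving_fst.ae hr0
  filter_upwards [hr0'] with z hz
  have hFz := h0 z
  rw [Real.norm_eq_abs, abs_of_nonneg (by positivity)]
  simp only [Pi.add_apply]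
  -- Either `F³ ≤ 8 r³`, or `F / 2 ≤ F - r` and therefore `F³ ≤ 4 F (F - r)²`.
  rcases le_or_gt (F z) (2 * r z.1) with h | h
  · have h1 : 0 ≤ F z * (F z - r z.1) ^ 2 := mul_nonneg hFz (sq_nonneg _)
    have h2 : F z ^ 3 ≤ (2 * r z.1) ^ 3 := by gcongr
    nlinarith
  · have h1 : (F z / 2) ^ 2 ≤ (F z - r z.1) ^ 2 := by
      apply pow_le_pow_left₀ (by positivity); linarith
    have h2 := mul_le_mul_of_nonneg_left h1 hFz
    have : 0 ≤ r z.1 ^ 3 := by positivity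
    nlinarith

/-- A function which is bounded in the first variable for almost every value of the second one is
uniformly bounded off a set of small measure. -/
lemma exists_uniform_bound {ι : Type*} [Countable ι] {φ : ι → S → ℝ} (hφ : ∀ i, Measurable (φ i))
    (hb : ∀ᵐ v ∂s, ∃ C, ∀ i, φ i v ≤ C) {ε : ℝ} (hε : 0 < ε) :
    ∃ G, MeasurableSet G ∧ s.real Gᶜ ≤ ε ∧ ∃ C, 0 ≤ C ∧ ∀ i, ∀ v ∈ G, φ i v ≤ C := by
  -- These sets increase to a set of full measure, so the complements have measure tending to zero.
  -- Countability of the index set makes them measurable.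
  set G : ℕ → Set S := fun N => {v | ∀ i, φ i v ≤ N} with hG
  have hGm : ∀ N, MeasurableSet (G N) := fun N => by
    have : G N = ⋂ i, {v | φ i v ≤ N} := by ext; simp [hG]
    rw [this]
    exact MeasurableSet.iInter fun i => measurableSet_le (hφ i) measurable_const
  have hanti : Antitone fun N => (G N)ᶜ := fun N M h => compl_subset_compl.2
    fun v hv i => (hv i).trans (by exact_mod_cast h)
  have hzero : s (⋂ N, (G N)ᶜ) = 0 := by
    refine measure_mono_null ?_ hb
    intro v hv ⟨C, hC⟩
    obtain ⟨N, hN⟩ := exists_nat_ge C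
    exact mem_iInter.1 hv N fun i => (hC i).trans hN
  have hlim := tendsto_measure_iInter_atTop (μ := s) (fun N => (hGm N).compl.nullMeasurableSet)
    hanti ⟨0, measure_ne_top _ _⟩
  rw [hzero] at hlim
  obtain ⟨N, hN⟩ := (hlim.eventually_le_const (ENNReal.ofReal_pos.2 hε)).exists
  exact ⟨G N, hGm N, ENNReal.toReal_le_of_le_ofReal hε.le hN, N, by positivity, fun i v hv => hv i⟩

end Cube

/-! ### Symmetric Markov kernels as approximate identities in `L³`. -/

section MarkovKernel

set_option linter.unusedSectionVars false

open scoped ENNReal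

/-- A symmetric Markov density with respect to `μ`. -/
structure IsSymmMarkov {X : Type*} [MeasurableSpace X] (μ : Measure X) (k : X × X → ℝ≥0∞) :
    Prop where
  measurable : Measurable k
  symm : ∀ x y, k (x, y) = k (y, x)
  lintegral_eq_one : ∀ x, ∫⁻ y, k (x, y) ∂μ = 1

variable {X : Type*} [MeasurableSpace X] {μ : Measure X} [SFinite μ] {k : X × X → ℝ≥0∞}

lemma IsSymmMarkov.measurable_right (hk : IsSymmMarkov μ k) (x : X) :
    Measurable fun y => k (x, y) := hk.measurable.comp measurable_prodMk_left

lemma IsSymmMarkov.prod {A S : Type*} [MeasurableSpace A] [MeasurableSpace S] {l : Measure A}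
    {s : Measure S} [SFinite l] [SFinite s] {a : A × A → ℝ≥0∞} {b : S × S → ℝ≥0∞}
    (ha : IsSymmMarkov l a) (hb : IsSymmMarkov s b) :
    IsSymmMarkov (l.prod s)
      (fun q : (A × S) × (A × S) => a (q.1.1, q.2.1) * b (q.1.2, q.2.2)) where
  measurable := by
    have := ha.measurable
    have := hb.measurable
    fun_prop
  symm x y := by rw [ha.symm, hb.symm]
  lintegral_eq_one x := by
    rw [lintegral_prod_mul (f := fun u => a (x.1, u)) (g := fun v => b (x.2, v))
      (ha.measurable.comp measurable_prodMk_left).aemeasurable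
      (hb.measurable.comp measurable_prodMk_left).aemeasurable, ha.lintegral_eq_one,
      hb.lintegral_eq_one, one_mul]

lemma IsSymmMarkov.lintegral_fst (hk : IsSymmMarkov μ k) {g : X → ℝ≥0∞} (hg : Measurable g) :
    ∫⁻ q, k q * g q.1 ∂(μ.prod μ) = ∫⁻ x, g x ∂μ := by
  have := hk.measurable
  rw [lintegral_prod _ (by fun_prop)]
  refine lintegral_congr fun x => ?_
  change ∫⁻ y, k (x, y) * g x ∂μ = g x
  rw [lintegral_mul_const _ (hk.measurable_right x), hk.lintegral_eq_one, one_mul]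

lemma IsSymmMarkov.lintegral_snd (hk : IsSymmMarkov μ k) {g : X → ℝ≥0∞} (hg : Measurable g) :
    ∫⁻ q, k q * g q.2 ∂(μ.prod μ) = ∫⁻ x, g x ∂μ := by
  have := hk.measurable
  rw [lintegral_prod_symm _ (by fun_prop)]
  refine lintegral_congr fun x => ?_
  simp_rw [hk.symm _ x]
  rw [lintegral_mul_const _ (hk.measurable_right x), hk.lintegral_eq_one, one_mul]

/-- With its counterpart for the second coordinate, this says that `k · (μ ⊗ μ)` couples `μ` with
itself, so norms of functions of a single coordinate can be computed under `μ`. -/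
lemma IsSymmMarkov.measurePreserving_fst (hk : IsSymmMarkov μ k) :
    MeasurePreserving Prod.fst ((μ.prod μ).withDensity k) μ := by
  refine ⟨measurable_fst, Measure.ext_of_lintegral _ fun g hg => ?_⟩
  rw [lintegral_map hg measurable_fst, lintegral_withDensity_eq_lintegral_mul _ hk.measurable
    (by fun_prop), ← hk.lintegral_fst hg]
  rfl

lemma IsSymmMarkov.measurePreserving_snd (hk : IsSymmMarkov μ k) :
    MeasurePreserving Prod.snd ((μ.prod μ).withDensity k) μ := by
  refine ⟨measurable_snd, Measure.ext_of_lintegral _ fun g hg => ?_⟩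
  rw [lintegral_map hg measurable_snd, lintegral_withDensity_eq_lintegral_mul _ hk.measurable
    (by fun_prop), ← hk.lintegral_snd hg]
  rfl

lemma IsSymmMarkov.isProbabilityMeasure (hk : IsSymmMarkov μ k) (x : X) :
    IsProbabilityMeasure (μ.withDensity fun y => k (x, y)) :=
  ⟨by rw [withDensity_apply _ MeasurableSet.univ, setLIntegral_univ, hk.lintegral_eq_one]⟩

/-- Jensen's inequality. No integrability is required: when `φ - c` is not square integrable, the
right side is infinite. -/
lemma enorm_integral_sub_sq_le {m : Measure X} [IsProbabilityMeasure m] {φ : X → ℝ}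
    (hφ : Measurable φ) (c : ℝ) :
    ‖∫ y, φ y ∂m - c‖ₑ ^ 2 ≤ ∫⁻ y, ‖φ y - c‖ₑ ^ 2 ∂m := by
  have hφc : Measurable fun y => φ y - c := by fun_prop
  have h2 : eLpNorm (fun y => φ y - c) 2 m ^ 2 = ∫⁻ y, ‖φ y - c‖ₑ ^ 2 ∂m := by
    rw [← ENNReal.rpow_natCast]
    exact eLpNorm_nnreal_pow_eq_lintegral (p := 2) (by norm_num) |>.trans (by simp)
  rw [← h2]
  by_cases htop : eLpNorm (fun y => φ y - c) 2 m = ⊤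
  · rw [htop]; simp
  have hL : MemLp (fun y => φ y - c) 2 m := ⟨hφc.aestronglyMeasurable, lt_top_iff_ne_top.2 htop⟩
  have hi : Integrable (fun y => φ y - c) m := hL.integrable (by norm_num)
  have hφi : Integrable φ m := by
    refine (hi.add (integrable_const c)).congr (Eventually.of_forall fun y => by simp)
  have e : ∫ y, φ y ∂m - c = ∫ y, (φ y - c) ∂m := by
    rw [integral_sub hφi (integrable_const _)]; simp
  rw [e]
  gcongr
  refine (enorm_integral_le_lintegral_enorm _).trans ?_
  rw [← eLpNorm_one_eq_lintegral_enorm]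
  exact eLpNorm_le_eLpNorm_of_exponent_le (by norm_num) hφc.aestronglyMeasurable

/-- Weighted `L²` error of averaging by a Markov kernel, controlled by `L³` norms. -/
lemma IsSymmMarkov.lintegral_mul_average_sub_sq_le (hk : IsSymmMarkov μ k) {F φ : X → ℝ}
    (hF : Measurable F) (hφ : Measurable φ) :
    ∫⁻ x, ‖F x‖ₑ * ‖∫ y, φ y ∂(μ.withDensity fun y => k (x, y)) - φ x‖ₑ ^ 2 ∂μ ≤
      eLpNorm F 3 μ *
        eLpNorm (fun q : X × X => φ q.2 - φ q.1) 3 ((μ.prod μ).withDensity k) ^ 2 := by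
  have hkm := hk.measurable
  have hΔ : Measurable fun q : X × X => φ q.2 - φ q.1 := by fun_prop
  calc _ ≤ ∫⁻ x, ‖F x‖ₑ * ∫⁻ y, k (x, y) * ‖φ y - φ x‖ₑ ^ 2 ∂μ ∂μ := by
        refine lintegral_mono fun x => ?_
        have := hk.isProbabilityMeasure x
        gcongr
        refine (enorm_integral_sub_sq_le hφ _).trans (le_of_eq ?_)
        rw [lintegral_withDensity_eq_lintegral_mul _ (hk.measurable_right x)
          (by fun_prop)]
        rfl
    _ = ∫⁻ q, ‖F q.1‖ₑ * ‖φ q.2 - φ q.1‖ₑ ^ 2 ∂((μ.prod μ).withDensity k) := by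
        rw [lintegral_withDensity_eq_lintegral_mul _ hkm (by fun_prop), lintegral_prod]
        · refine lintegral_congr fun x => ?_
          rw [← lintegral_const_mul _ (by fun_prop)]
          refine lintegral_congr fun y => ?_
          simp only [Pi.mul_apply]; ring
        · exact (hkm.mul (by fun_prop)).aemeasurable
    _ ≤ _ := by
        -- Hölder with exponents 3 and 3/2 on the coupling. The factor `F` depends only on the first
        -- coordinate, whose marginal is `μ`, and the `L^{3/2}` norm of a square is the square of
        -- the `L³` norm.
        have hconj : (3 : ℝ).HolderConjugate (3 / 2) := by
          rw [Real.holderConjugate_iff]; norm_num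
        refine (ENNReal.lintegral_mul_le_Lp_mul_Lq _ hconj (f := fun q : X × X => ‖F q.1‖ₑ)
          (g := fun q : X × X => ‖φ q.2 - φ q.1‖ₑ ^ 2) (by fun_prop) (by fun_prop)).trans ?_
        have e1 : eLpNorm F 3 μ = (∫⁻ q : X × X, ‖F q.1‖ₑ ^ (3 : ℝ)
            ∂((μ.prod μ).withDensity k)) ^ (1 / 3 : ℝ) := by
          rw [← eLpNorm_comp_measurePreserving hF.aestronglyMeasurable hk.measurePreserving_fst,
            eLpNorm_eq_lintegral_rpow_enorm_toReal (by norm_num) (by norm_num)]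
          simp
        have e2 : eLpNorm (fun q : X × X => φ q.2 - φ q.1) 3 ((μ.prod μ).withDensity k) ^ 2 =
            (∫⁻ q : X × X, (‖φ q.2 - φ q.1‖ₑ ^ 2) ^ (3 / 2 : ℝ)
              ∂((μ.prod μ).withDensity k)) ^ (1 / (3 / 2) : ℝ) := by
          rw [eLpNorm_eq_lintegral_rpow_enorm_toReal (by norm_num) (by norm_num),
            ← ENNReal.rpow_natCast, ← ENNReal.rpow_mul]
          simp_rw [← ENNReal.rpow_natCast, ← ENNReal.rpow_mul]
          norm_num
        rw [e1, e2]

/-- Both marginals of the coupling are `μ`, so replacing `φ` by `ψ` costs `‖φ - ψ‖₃` once per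
coordinate. This reduces convergence to a dense class. -/
lemma IsSymmMarkov.eLpNorm_increment_le (hk : IsSymmMarkov μ k) {φ ψ : X → ℝ}
    (hφ : Measurable φ) (hψ : Measurable ψ) :
    eLpNorm (fun q : X × X => φ q.2 - φ q.1) 3 ((μ.prod μ).withDensity k) ≤
      2 * eLpNorm (φ - ψ) 3 μ +
        eLpNorm (fun q : X × X => ψ q.2 - ψ q.1) 3 ((μ.prod μ).withDensity k) := by
  have hs : AEStronglyMeasurable (φ - ψ) μ := (hφ.sub hψ).aestronglyMeasurable
  have e1 := eLpNorm_comp_measurePreserving (p := 3) hs hk.measurePreserving_fst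
  have e2 := eLpNorm_comp_measurePreserving (p := 3) hs hk.measurePreserving_snd
  have hm1 : Measurable ((φ - ψ) ∘ (Prod.fst : X × X → X)) := (hφ.sub hψ).comp measurable_fst
  have hm2 : Measurable ((φ - ψ) ∘ (Prod.snd : X × X → X)) := (hφ.sub hψ).comp measurable_snd
  have hm3 : Measurable fun q : X × X => ψ q.2 - ψ q.1 := by fun_prop
  have e : (fun q : X × X => φ q.2 - φ q.1) = (((φ - ψ) ∘ (Prod.snd : X × X → X)) -
      ((φ - ψ) ∘ (Prod.fst : X × X → X))) + fun q : X × X => ψ q.2 - ψ q.1 := by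
    ext q; simp; ring
  rw [e]
  refine (eLpNorm_add_le (hm2.sub hm1).aestronglyMeasurable hm3.aestronglyMeasurable
    (by norm_num)).trans ?_
  gcongr
  refine (eLpNorm_sub_le hm2.aestronglyMeasurable hm1.aestronglyMeasurable (by norm_num)).trans ?_
  rw [e1, e2, two_mul]

/-- By Tonelli and symmetry, averaging preserves the integral of `|φ|`, so almost every average is
finite. Differences of averages can then be split as Bochner integrals. -/
lemma IsSymmMarkov.ae_integrable (hk : IsSymmMarkov μ k) {φ : X → ℝ} (hφ : Measurable φ)
    (hi : Integrable φ μ) :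
    ∀ᵐ x ∂μ, Integrable (fun y => (k (x, y)).toReal * φ y) μ := by
  have hkm := hk.measurable
  have hfin : ∫⁻ x, ∫⁻ y, k (x, y) * ‖φ y‖ₑ ∂μ ∂μ ≠ ⊤ := by
    rw [← lintegral_prod (f := fun q : X × X => k q * ‖φ q.2‖ₑ) (by fun_prop),
      hk.lintegral_snd (g := fun y => ‖φ y‖ₑ) (by fun_prop)]
    exact hi.2.ne
  have hm : Measurable fun q : X × X => k q * ‖φ q.2‖ₑ := by fun_prop
  filter_upwards [ae_lt_top hm.lintegral_prod_right' hfin] with x hx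
  have hkx : Measurable fun y => k (x, y) := hkm.comp measurable_prodMk_left
  refine ⟨by fun_prop, lt_of_le_of_lt (lintegral_mono fun y => ?_) hx⟩
  rw [enorm_mul]
  gcongr
  rw [← ofReal_norm, Real.norm_of_nonneg ENNReal.toReal_nonneg]
  exact ENNReal.ofReal_toReal_le

/-- From `2ab ≤ a² + b²` and the two marginals. It bounds the kernel's second moment by the `L²`
norm of the density, with no supremum bound. -/
lemma IsSymmMarkov.lintegral_mul_mul_le (hk : IsSymmMarkov μ k) {g : X → ℝ≥0∞}
    (hg : Measurable g) :
    ∫⁻ q, k q * (g q.1 * g q.2) ∂(μ.prod μ) ≤ ∫⁻ x, g x ^ 2 ∂μ := by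
  have hkm := hk.measurable
  have h2 : ∀ a b : ℝ≥0∞, 2 * (a * b) ≤ a ^ 2 + b ^ 2 := fun a b => by
    rcases eq_or_ne a ⊤ with rfl | ha
    · simp
    rcases eq_or_ne b ⊤ with rfl | hb
    · simp
    lift a to NNReal using ha
    lift b to NNReal using hb
    norm_cast
    rw [← mul_assoc]
    exact two_mul_le_add_sq a b
  have h3 : 2 * ∫⁻ q, k q * (g q.1 * g q.2) ∂(μ.prod μ) ≤ 2 * ∫⁻ x, g x ^ 2 ∂μ := by
    rw [← lintegral_const_mul _ (by fun_prop)]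
    calc _ ≤ ∫⁻ q, (k q * g q.1 ^ 2 + k q * g q.2 ^ 2) ∂(μ.prod μ) := by
          refine lintegral_mono fun q => ?_
          rw [← mul_add]
          calc 2 * (k q * (g q.1 * g q.2)) = k q * (2 * (g q.1 * g q.2)) := by ring
            _ ≤ _ := by gcongr; exact h2 _ _
      _ = _ := by
          rw [lintegral_add_left (by fun_prop),
            hk.lintegral_fst (g := fun x => g x ^ 2) (by fun_prop),
            hk.lintegral_snd (g := fun x => g x ^ 2) (by fun_prop), two_mul]
  exact (ENNReal.mul_le_mul_iff_right (by norm_num) (by norm_num)).1 h3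

/-- A sequence of symmetric Markov kernels which concentrates uniformly on the diagonal is an
approximate identity in `L³`. -/
theorem tendsto_eLpNorm_increment {X : Type*} [PseudoMetricSpace X] [SecondCountableTopology X]
    [LocallyCompactSpace X] [R1Space X]
    [MeasurableSpace X] [BorelSpace X] {μ : Measure X} [SFinite μ] [μ.Regular]
    {k : ℕ → X × X → ℝ≥0∞} (hk : ∀ n, IsSymmMarkov μ (k n))
    (hconc : ∀ δ > 0, ∃ b : ℕ → ℝ≥0∞, Tendsto b atTop (𝓝 0) ∧
      ∀ᶠ n in atTop, ∀ x, ∫⁻ y in {y | δ ≤ dist x y}, k n (x, y) ∂μ ≤ b n)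
    {φ : X → ℝ} (hφm : Measurable φ) (hφ : MemLp φ 3 μ) :
    Tendsto (fun n => eLpNorm (fun q : X × X => φ q.2 - φ q.1) 3 ((μ.prod μ).withDensity (k n)))
      atTop (𝓝 0) := by
  have key : ∀ ψ : X → ℝ, Continuous ψ → HasCompactSupport ψ →
      Tendsto (fun n => eLpNorm (fun q : X × X => ψ q.2 - ψ q.1) 3
        ((μ.prod μ).withDensity (k n))) atTop (𝓝 0) := by
    intro ψ hψ hψc
    obtain ⟨M, hM⟩ := hψc.exists_bound_of_continuous hψ
    set T := tsupport ψ with hT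
    have hTm : MeasurableSet T := (isClosed_tsupport ψ).measurableSet
    have hTμ : μ T < ⊤ := hψc.measure_lt_top
    have hsum : ∀ ε : ℝ, 0 < ε → ∀ᶠ n in atTop,
        ∫⁻ q : X × X, ‖ψ q.2 - ψ q.1‖ₑ ^ (3 : ℝ) ∂((μ.prod μ).withDensity (k n)) ≤
          4 * μ T * ENNReal.ofReal ε := by
      intro ε hε
      -- The minimum with 1 ensures that the cube of a small increment is at most the increment
      -- itself, hence at most `ε`.
      obtain ⟨δ, hδ, hδψ⟩ := Metric.uniformContinuous_iff.1
        (hψc.uniformContinuous_of_continuous hψ) (min ε 1) (by positivity)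
      obtain ⟨b, hb, hbk⟩ := hconc δ hδ
      set c : ℝ≥0∞ := ENNReal.ofReal (M + M) ^ (3 : ℝ) with hc
      have hct : c ≠ ⊤ := ENNReal.rpow_ne_top_of_nonneg (by norm_num) ENNReal.ofReal_ne_top
      have hcb : Tendsto (fun n => c * b n) atTop (𝓝 0) := by
        simpa using ENNReal.Tendsto.const_mul hb (Or.inr hct)
      set D : Set (X × X) := {q | δ ≤ dist q.1 q.2} with hD
      have hDm : MeasurableSet D := measurableSet_le measurable_const (by fun_prop)
      set w : X × X → ℝ≥0∞ := fun q => ENNReal.ofReal ε + D.indicator (fun _ => c) q with hw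
      have hwm : Measurable w := (measurable_const.indicator hDm).const_add _
      have hwsymm : ∀ x y, w (x, y) = w (y, x) := fun x y => by
        simp only [hw, hD, indicator, mem_ofPred_eq, dist_comm]
      have hpt : ∀ q : X × X, ‖ψ q.2 - ψ q.1‖ₑ ^ (3 : ℝ) ≤ w q := by
        intro q
        by_cases hq : q ∈ D
        · refine le_trans ?_ le_add_self
          rw [indicator_of_mem hq, hc, ← ofReal_norm]
          gcongr
          exact (norm_sub_le _ _).trans (add_le_add (hM _) (hM _))
        · refine le_trans ?_ le_self_add
          simp only [hD, mem_ofPred_eq, not_le] at hq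
          have h1 := hδψ hq
          rw [dist_comm, Real.dist_eq] at h1
          have h2 : |ψ q.2 - ψ q.1| ≤ 1 := h1.le.trans (min_le_right _ _)
          rw [← ofReal_norm, ENNReal.ofReal_rpow_of_nonneg (norm_nonneg _) (by norm_num)]
          refine ENNReal.ofReal_le_ofReal ?_
          rw [Real.norm_eq_abs]
          calc |ψ q.2 - ψ q.1| ^ (3 : ℝ) ≤ |ψ q.2 - ψ q.1| ^ (1 : ℝ) :=
                Real.rpow_le_rpow_of_exponent_ge_of_imp (abs_nonneg _) h2 (by norm_num)
                  (by norm_num)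
            _ ≤ ε := by rw [Real.rpow_one]; exact h1.le.trans (min_le_left _ _)
      -- The increment vanishes unless one endpoint lies in the compact support. This localizes to a
      -- set of finite measure, `μ` itself being possibly infinite.
      have hpt2 : ∀ q : X × X, ‖ψ q.2 - ψ q.1‖ₑ ^ (3 : ℝ) ≤
          T.indicator 1 q.1 * w q + T.indicator 1 q.2 * w q := by
        intro q
        by_cases h1 : q.1 ∈ T
        · rw [indicator_of_mem h1, Pi.one_apply, one_mul]
          exact (hpt q).trans le_self_add
        by_cases h2 : q.2 ∈ T
        · rw [indicator_of_mem h2, Pi.one_apply, one_mul]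
          exact (hpt q).trans le_add_self
        · rw [image_eq_zero_of_notMem_tsupport h1, image_eq_zero_of_notMem_tsupport h2]
          simp
      filter_upwards [hbk, hcb.eventually_le_const (ENNReal.ofReal_pos.2 hε)] with n hn hcn
      have hkn := (hk n).measurable
      have hTi : Measurable (T.indicator (1 : X → ℝ≥0∞)) := measurable_one.indicator hTm
      have hwb : ∀ x, ∫⁻ y, k n (x, y) * w (x, y) ∂μ ≤ 2 * ENNReal.ofReal ε := by
        intro x
        have hDx : MeasurableSet {y | δ ≤ dist x y} := measurableSet_le measurable_const
          (by fun_prop)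
        have e : ∀ y, k n (x, y) * w (x, y) = k n (x, y) * ENNReal.ofReal ε +
            {y | δ ≤ dist x y}.indicator (fun y => c * k n (x, y)) y := fun y => by
          simp only [hw, hD, indicator, mem_ofPred_eq]
          split_ifs <;> ring
        simp_rw [e]
        rw [lintegral_add_left (((hk n).measurable_right x).mul_const _),
          lintegral_mul_const _ ((hk n).measurable_right x), (hk n).lintegral_eq_one, one_mul,
          lintegral_indicator hDx, lintegral_const_mul _ ((hk n).measurable_right x), two_mul]
        gcongr
        exact (mul_le_mul_right (hn x) _).trans hcn
      have hone : ∫⁻ q : X × X, k n q * (T.indicator 1 q.1 * w q) ∂(μ.prod μ) ≤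
          μ T * (2 * ENNReal.ofReal ε) := by
        rw [lintegral_prod _ (by fun_prop)]
        calc _ = ∫⁻ x, T.indicator 1 x * ∫⁻ y, k n (x, y) * w (x, y) ∂μ ∂μ := by
              refine lintegral_congr fun x => ?_
              have hkw : Measurable fun y => k n (x, y) * w (x, y) :=
                ((hk n).measurable_right x).mul (hwm.comp measurable_prodMk_left)
              rw [← lintegral_const_mul _ hkw]
              refine lintegral_congr fun y => ?_
              ring
          _ ≤ ∫⁻ x, T.indicator 1 x * (2 * ENNReal.ofReal ε) ∂μ := by
              gcongr with x
              exact hwb x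
          _ = _ := by
              rw [lintegral_mul_const _ hTi, lintegral_indicator_one hTm]
      have htwo : ∫⁻ q : X × X, k n q * (T.indicator 1 q.2 * w q) ∂(μ.prod μ) ≤
          μ T * (2 * ENNReal.ofReal ε) := by
        refine le_trans (le_of_eq ?_) hone
        rw [← lintegral_prod_swap]
        refine lintegral_congr fun q => ?_
        simp only [Prod.swap]
        rw [(hk n).symm, hwsymm]
      rw [lintegral_withDensity_eq_lintegral_mul _ hkn (by fun_prop)]
      calc _ ≤ ∫⁻ q : X × X, (k n q * (T.indicator 1 q.1 * w q) +
            k n q * (T.indicator 1 q.2 * w q)) ∂(μ.prod μ) := by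
            refine lintegral_mono fun q => ?_
            rw [Pi.mul_apply, ← mul_add]
            gcongr
            exact hpt2 q
        _ ≤ μ T * (2 * ENNReal.ofReal ε) + μ T * (2 * ENNReal.ofReal ε) := by
            rw [lintegral_add_left (by fun_prop)]
            exact add_le_add hone htwo
        _ = _ := by ring
    have hlim : Tendsto (fun n => ∫⁻ q : X × X, ‖ψ q.2 - ψ q.1‖ₑ ^ (3 : ℝ)
        ∂((μ.prod μ).withDensity (k n))) atTop (𝓝 0) := by
      rw [ENNReal.tendsto_nhds_zero]
      intro η hη
      have h4 : Tendsto (fun ε : ℝ => 4 * μ T * ENNReal.ofReal ε) (𝓝[>] 0) (𝓝 0) := by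
        have : Tendsto (fun ε : ℝ => ENNReal.ofReal ε) (𝓝[>] 0) (𝓝 0) := by
          have := (ENNReal.continuous_ofReal.tendsto 0).mono_left (nhdsWithin_le_nhds (s := Ioi 0))
          simpa using this
        simpa using ENNReal.Tendsto.const_mul this
          (Or.inr (ENNReal.mul_ne_top (by norm_num) hTμ.ne))
      obtain ⟨ε, hεη, hε⟩ := ((h4.eventually_le_const hη).and self_mem_nhdsWithin).exists
      exact (hsum ε hε).mono fun n hn => hn.trans hεη
    have h3 := (ENNReal.continuous_rpow_const (y := 1 / 3)).tendsto 0 |>.comp hlim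
    rw [ENNReal.zero_rpow_of_pos (by norm_num)] at h3
    refine h3.congr fun n => ?_
    rw [eLpNorm_eq_lintegral_rpow_enorm_toReal (by norm_num) (by norm_num)]
    simp
  rw [ENNReal.tendsto_nhds_zero]
  intro ε hε
  rcases eq_or_ne ε ⊤ with rfl | hεt
  · simp
  -- Continuous compactly supported functions are dense in `L³`; an error of `ε / 4` enters twice
  -- and leaves `ε / 2` for the increment of `ψ`.
  have hε4 : ε / 4 ≠ 0 := (ENNReal.div_pos hε.ne' (by norm_num)).ne'
  obtain ⟨ψ, hψc, hψε, hψ, -⟩ := hφ.exists_hasCompactSupport_eLpNorm_sub_le (by norm_num) hε4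
  have h2 := (key ψ hψ hψc).eventually_le_const
    (ENNReal.div_pos hε.ne' (by norm_num : (2 : ℝ≥0∞) ≠ ⊤))
  filter_upwards [h2] with n hn
  refine ((hk n).eLpNorm_increment_le hφm hψ.measurable).trans ?_
  calc _ ≤ 2 * (ε / 4) + ε / 2 := by gcongr
    _ = ε := by
      lift ε to NNReal using hεt
      have : (2 : ℝ≥0∞) * ((ε : ℝ≥0∞) / 4) + ε / 2 = ((2 * (ε / 4) + ε / 2 : NNReal) : ℝ≥0∞) := by
        push_cast
        rfl
      rw [this]
      congr 1
      ring

end MarkovKernel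

/-! ### The product smoothing kernel and the kernel of the U-statistic. -/

section SmoothingKernels

open scoped ENNReal

lemma lintegral_comp_inv_mul {h : ℝ} (hh : 0 < h) {g : ℝ → ℝ≥0∞} (hg : Measurable g) :
    ∫⁻ y, g (h⁻¹ * y) = ENNReal.ofReal h * ∫⁻ y, g y := by
  have := Real.map_volume_mul_left (inv_pos.2 hh).ne'
  rw [inv_inv, abs_of_pos hh] at this
  rw [← lintegral_map hg (measurable_const_mul _), this, lintegral_smul_measure, smul_eq_mul]

/-- The density `K_h(u - u') = h⁻¹ K((u - u') / h)`. -/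
def scaledKernel (φ : ℝ → ℝ) (h : ℝ) (q : ℝ × ℝ) : ℝ := h⁻¹ * φ ((q.1 - q.2) / h)

lemma isSymmMarkov_scaledKernel {φ : ℝ → ℝ} (hφ : Measurable φ)
    (hs : ∀ x, φ (-x) = φ x) (h1 : ∫⁻ x, ENNReal.ofReal (φ x) = 1) {h : ℝ} (hh : 0 < h) :
    IsSymmMarkov volume (fun q => ENNReal.ofReal (scaledKernel φ h q)) where
  measurable := by unfold scaledKernel; fun_prop
  symm x y := by
    simp only [scaledKernel]
    rw [← hs, ← neg_div, neg_sub]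
  lintegral_eq_one x := by
    simp only [scaledKernel]
    rw [lintegral_sub_left_eq_self (fun y => ENNReal.ofReal (h⁻¹ * φ (y / h))) x]
    have : ∀ y, ENNReal.ofReal (h⁻¹ * φ (y / h)) =
        ENNReal.ofReal h⁻¹ * ENNReal.ofReal (φ (h⁻¹ * y)) := fun y => by
      rw [ENNReal.ofReal_mul (by positivity), div_eq_inv_mul]
    simp_rw [this]
    rw [lintegral_const_mul _ (by fun_prop),
      lintegral_comp_inv_mul hh (g := fun y => ENNReal.ofReal (φ y)) (by fun_prop), h1, mul_one,
      ← ENNReal.ofReal_mul (by positivity), inv_mul_cancel₀ hh.ne', ENNReal.ofReal_one]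

lemma isSymmMarkov_langevin {p : ℕ} (hp : 2 ≤ p) (κ : ℝ) :
    IsSymmMarkov (surf p) (fun q : Sph p × Sph p =>
      ENNReal.ofReal (langevinDensity p κ (inner ℝ (q.1 : E p) (q.2 : E p)))) where
  measurable := by
    have := continuous_langevinDensity p κ
    have h2 : Continuous fun q : Sph p × Sph p => inner ℝ (q.1 : E p) (q.2 : E p) := by fun_prop
    exact (this.comp h2).measurable.ennreal_ofReal
  symm x y := by rw [real_inner_comm]
  lintegral_eq_one := lintegral_langevinDensity hp κ

lemma isSymmMarkov_const {p : ℕ} (hp : 1 ≤ p) :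
    IsSymmMarkov (surf p) (fun _ : Sph p × Sph p => ENNReal.ofReal (sphereArea p)⁻¹) where
  measurable := measurable_const
  symm _ _ := rfl
  lintegral_eq_one _ := by
    rw [lintegral_const, surf_univ hp, ← ENNReal.ofReal_mul (inv_pos.2 (sphereArea_pos hp)).le,
      inv_mul_cancel₀ (sphereArea_pos hp).ne', ENNReal.ofReal_one]

/-- The reference measure on `ℝ × Sph p`. -/
abbrev refMeasure (p : ℕ) : Measure (ℝ × Sph p) := (volume : Measure ℝ).prod (surf p)

/-- The smoothing kernel `K_h(u - u') L(κ vᵀv') / c₁(κ)`. -/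
def smoothing (p : ℕ) (K : ℝ → ℝ) (h κ : ℝ) (q : (ℝ × Sph p) × (ℝ × Sph p)) : ℝ≥0∞ :=
  ENNReal.ofReal (scaledKernel K h (q.1.1, q.2.1)) *
    ENNReal.ofReal (langevinDensity p κ (inner ℝ (q.1.2 : E p) (q.2.2 : E p)))

lemma isSymmMarkov_smoothing {p : ℕ} (hp : 2 ≤ p) {K : ℝ → ℝ} (hK : RadialKernel K) {h κ : ℝ}
    (hh : 0 < h) : IsSymmMarkov (refMeasure p) (smoothing p K h κ) :=
  (isSymmMarkov_scaledKernel hK.measurable hK.symm hK.integral_eq_one hh).prod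
    (isSymmMarkov_langevin hp κ)

/-- In the product metric, points `δ` apart differ by `δ` in radius or in direction. In the first
case `K` vanishes once `h < δ`. In the second, `⟨v, w⟩ = 1 - ‖v - w‖² / 2 ≤ 1 - δ² / 2`, and the
Langevin density is at most `C κ ^ ((p-1)/2) exp (-κ δ² / 2)`. -/
lemma smoothing_concentrates {p : ℕ} (hp : 2 ≤ p) {K : ℝ → ℝ} (hK : RadialKernel K)
    {h κ : ℕ → ℝ} (hh : ∀ n, 0 < h n) (hκlim : Tendsto κ atTop atTop)
    (hhlim : Tendsto h atTop (𝓝 0)) {δ : ℝ} (hδ : 0 < δ) :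
    ∃ b : ℕ → ℝ≥0∞, Tendsto b atTop (𝓝 0) ∧ ∀ᶠ n in atTop, ∀ x,
      ∫⁻ y in {y | δ ≤ dist x y}, smoothing p K (h n) (κ n) (x, y) ∂(refMeasure p) ≤ b n := by
  obtain ⟨C, hC, hCb⟩ := exists_langevinDensity_le hp
  refine ⟨fun n => ENNReal.ofReal (C * (κ n ^ (((p : ℝ) - 1) / 2) *
    Real.exp (-(δ ^ 2 / 2) * κ n))) * surf p univ, ?_, ?_⟩
  · have h1 := (tendsto_rpow_mul_exp_neg_mul_atTop_nhds_zero (((p : ℝ) - 1) / 2) (δ ^ 2 / 2)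
      (by positivity)).comp hκlim
    have h2 := ENNReal.tendsto_ofReal (h1.const_mul C)
    rw [mul_zero, ENNReal.ofReal_zero] at h2
    simpa using ENNReal.Tendsto.mul_const h2 (Or.inr (measure_ne_top (surf p) univ))
  · filter_upwards [hhlim.eventually_lt_const hδ, hκlim.eventually_ge_atTop 1] with n hn hκn x
    have hκ0 : 0 < κ n := by linarith
    have ha := isSymmMarkov_scaledKernel hK.measurable hK.symm hK.integral_eq_one (hh n)
    set B : ℝ≥0∞ := ENNReal.ofReal (C * (κ n ^ (((p : ℝ) - 1) / 2) *
      Real.exp (-(δ ^ 2 / 2) * κ n))) with hB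
    have hpt : ∀ y ∈ {y : ℝ × Sph p | δ ≤ dist x y}, smoothing p K (h n) (κ n) (x, y) ≤
        ENNReal.ofReal (scaledKernel K (h n) (x.1, y.1)) * B := by
      intro y hy
      simp only [smoothing]
      by_cases hu : δ ≤ dist x.1 y.1
      · have : K ((x.1 - y.1) / h n) = 0 := by
          by_contra hne
          have hs := hK.support_subset (Function.mem_support.2 hne)
          rw [mem_Ioo, ← abs_lt, abs_div, abs_of_pos (hh n), div_lt_one (hh n)] at hs
          rw [Real.dist_eq] at hu
          linarith
        simp [scaledKernel, this]
      · have hv : δ ≤ dist x.2 y.2 := by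
          rw [mem_ofPred_eq, Prod.dist_eq, le_max_iff] at hy
          exact hy.resolve_left hu
        gcongr
        refine ENNReal.ofReal_le_ofReal ((hCb _ hκn _).trans ?_)
        rw [mul_assoc]
        refine mul_le_mul_of_nonneg_left (mul_le_mul_of_nonneg_left (Real.exp_le_exp.2 ?_)
          (by positivity)) hC.le
        have hd : dist x.2 y.2 ^ 2 = 2 - 2 * inner ℝ (x.2 : E p) (y.2 : E p) := by
          rw [Subtype.dist_eq, dist_eq_norm, norm_sub_sq_real]
          simp; ring
        have : δ ^ 2 ≤ dist x.2 y.2 ^ 2 := by gcongr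
        nlinarith
    have hm : MeasurableSet {y : ℝ × Sph p | δ ≤ dist x y} :=
      measurableSet_le measurable_const (by fun_prop)
    calc _ ≤ ∫⁻ y in {y : ℝ × Sph p | δ ≤ dist x y},
          ENNReal.ofReal (scaledKernel K (h n) (x.1, y.1)) * B ∂(refMeasure p) :=
          setLIntegral_mono' hm hpt
      _ ≤ ∫⁻ y, ENNReal.ofReal (scaledKernel K (h n) (x.1, y.1)) * B ∂(refMeasure p) :=
          setLIntegral_le_lintegral _ _
      _ = B * surf p univ := by
          rw [lintegral_prod_mul (f := fun u => ENNReal.ofReal (scaledKernel K (h n) (x.1, u)))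
            (g := fun _ => B) (ha.measurable_right x.1).aemeasurable aemeasurable_const,
            ha.lintegral_eq_one, lintegral_const, one_mul]

/-- Integrability comes from `K² ≤ K + K⁴`. Positivity allows `K²` to be normalized into a symmetric
density. -/
lemma radialKernel_sq {K : ℝ → ℝ} (hK : RadialKernel K) :
    Integrable (fun x => K x ^ 2) ∧ 0 < ∫ x, K x ^ 2 := by
  have hKi : Integrable K := by
    refine ⟨hK.measurable.aestronglyMeasurable, ?_⟩
    rw [hasFiniteIntegral_iff_ofReal (Eventually.of_forall hK.nonneg), hK.integral_eq_one]
    exact ENNReal.one_lt_top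
  have hi : Integrable (fun x => K x ^ 2) := by
    refine (hKi.add hK.integrable_pow_four).mono' (hK.measurable.pow_const 2).aestronglyMeasurable
      (Eventually.of_forall fun x => ?_)
    have h0 := hK.nonneg x
    simp only [Pi.add_apply, Real.norm_eq_abs, abs_of_nonneg (sq_nonneg (K x))]
    rcases le_total (K x) 1 with h | h
    · have : 0 ≤ K x ^ 4 := by positivity
      nlinarith
    · have : K x ^ 2 ≤ K x ^ 4 := pow_le_pow_right₀ h (by norm_num)
      linarith
  refine ⟨hi, ?_⟩
  refine lt_of_le_of_ne (integral_nonneg fun x => sq_nonneg _) fun h0 => ?_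
  have hz := (integral_eq_zero_iff_of_nonneg (fun x => sq_nonneg _) hi).1 h0.symm
  have : ∫⁻ x, ENNReal.ofReal (K x) = 0 := by
    rw [lintegral_eq_zero_iff (hK.measurable.ennreal_ofReal)]
    filter_upwards [hz] with x hx
    have : K x = 0 := by simpa using hx
    simp [this]
  rw [hK.integral_eq_one] at this
  exact one_ne_zero this

/-- The kernel of the `U`-statistic estimating `𝓜²`. -/
def deviationKernel (p : ℕ) (K : ℝ → ℝ) (h κ : ℝ) (q : (ℝ × Sph p) × (ℝ × Sph p)) : ℝ :=
  scaledKernel K h (q.1.1, q.2.1) *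
    (langevinDensity p κ (inner ℝ (q.1.2 : E p) (q.2.2 : E p)) - (sphereArea p)⁻¹)

lemma measurable_deviationKernel (p : ℕ) {K : ℝ → ℝ} (hK : Measurable K) (h κ : ℝ) :
    Measurable (deviationKernel p K h κ) := by
  have h1 := (continuous_langevinDensity p κ).measurable
  have h2 : Continuous fun q : (ℝ × Sph p) × (ℝ × Sph p) =>
    inner ℝ (q.1.2 : E p) (q.2.2 : E p) := by fun_prop
  have h3 : Measurable (scaledKernel K h) := by unfold scaledKernel; fun_prop
  unfold deviationKernel
  exact (h3.comp (by fun_prop)).mul ((h1.comp h2.measurable).sub_const _)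

lemma deviationKernel_symm (p : ℕ) {K : ℝ → ℝ} (hK : RadialKernel K) (h κ : ℝ)
    (x y : ℝ × Sph p) : deviationKernel p K h κ (x, y) = deviationKernel p K h κ (y, x) := by
  simp only [deviationKernel, scaledKernel]
  rw [← hK.symm, ← neg_div, neg_sub, real_inner_comm]

/-- Second moment of the kernel of the `U`-statistic. -/
lemma lintegral_deviationKernel_sq_le {p : ℕ} (hp : 2 ≤ p) {K : ℝ → ℝ} (hK : RadialKernel K)
    {h κ B : ℝ} (hh : 0 < h)
    (hB : ∀ t ≤ 1, langevinDensity p κ t + (sphereArea p)⁻¹ ≤ B)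
    {F : ℝ × Sph p → ℝ} (hF : Measurable F) :
    ∫⁻ q, ‖deviationKernel p K h κ q‖ₑ ^ 2 *
        (ENNReal.ofReal (F q.1) * ENNReal.ofReal (F q.2)) ∂((refMeasure p).prod (refMeasure p)) ≤
      ENNReal.ofReal (B * ((∫ x, K x ^ 2) / h)) *
        (2 * ∫⁻ x, ENNReal.ofReal (F x) ^ 2 ∂(refMeasure p)) := by
  obtain ⟨hK2i, hm⟩ := radialKernel_sq hK
  set m := ∫ x, K x ^ 2 with hmdef
  have hω := sphereArea_pos (p := p) (by omega)
  -- With `K²` normalized, `K_h² = (m / h) φ_h`, and `(L - ω⁻¹)² ≤ B (L + ω⁻¹)` for the normalized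
  -- Langevin density `L`. Thus the squared kernel is at most `B m / h` times the sum of the two
  -- symmetric Markov kernels `k₁` and `k₂`.
  set φ : ℝ → ℝ := fun x => m⁻¹ * K x ^ 2 with hφ
  have hφm : Measurable φ := by have := hK.measurable; fun_prop
  have hφ0 : ∀ x, 0 ≤ φ x := fun x => by positivity
  have hφ1 : ∫⁻ x, ENNReal.ofReal (φ x) = 1 := by
    rw [← ofReal_integral_eq_lintegral_ofReal (hK2i.const_mul _) (Eventually.of_forall hφ0),
      integral_const_mul, inv_mul_cancel₀ hm.ne', ENNReal.ofReal_one]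
  have ha := isSymmMarkov_scaledKernel hφm (fun x => by simp [hφ, hK.symm]) hφ1 hh
  obtain ⟨k₁, hk₁⟩ : ∃ k : (ℝ × Sph p) × (ℝ × Sph p) → ℝ≥0∞, k = fun q =>
    ENNReal.ofReal (scaledKernel φ h (q.1.1, q.2.1)) *
      ENNReal.ofReal (langevinDensity p κ (inner ℝ (q.1.2 : E p) (q.2.2 : E p))) := ⟨_, rfl⟩
  obtain ⟨k₂, hk₂⟩ : ∃ k : (ℝ × Sph p) × (ℝ × Sph p) → ℝ≥0∞, k = fun q =>
    ENNReal.ofReal (scaledKernel φ h (q.1.1, q.2.1)) * ENNReal.ofReal (sphereArea p)⁻¹ := ⟨_, rfl⟩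
  have h1 : IsSymmMarkov (refMeasure p) k₁ := by
    rw [hk₁]; exact ha.prod (isSymmMarkov_langevin hp κ)
  have h2 : IsSymmMarkov (refMeasure p) k₂ := by
    rw [hk₂]; exact ha.prod (isSymmMarkov_const (p := p) (by omega))
  have hg : Measurable fun x => ENNReal.ofReal (F x) := hF.ennreal_ofReal
  have b1 := h1.lintegral_mul_mul_le hg
  have b2 := h2.lintegral_mul_mul_le hg
  have hpt : ∀ q : (ℝ × Sph p) × (ℝ × Sph p), ‖deviationKernel p K h κ q‖ₑ ^ 2 ≤
      ENNReal.ofReal (B * (m / h)) * (k₁ q + k₂ q) := by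
    intro q
    simp only [hk₁, hk₂]
    set t := inner ℝ (q.1.2 : E p) (q.2.2 : E p) with ht
    have ht1 : t ≤ 1 := by
      have := real_inner_le_norm (q.1.2 : E p) (q.2.2 : E p)
      simpa using this
    have hL := langevinDensity_pos hp κ t
    have hLB := hB t ht1
    have hω' : 0 < (sphereArea p)⁻¹ := inv_pos.2 hω
    have hB0 : 0 ≤ B := by linarith
    have hs0 : 0 ≤ scaledKernel φ h (q.1.1, q.2.1) := mul_nonneg (by positivity) (hφ0 _)
    rw [← ENNReal.ofReal_mul hs0, ← ENNReal.ofReal_mul hs0, ← ENNReal.ofReal_add (by positivity)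
      (by positivity), ← ENNReal.ofReal_mul (by positivity), ← ofReal_norm,
      ← ENNReal.ofReal_pow (norm_nonneg _)]
    refine ENNReal.ofReal_le_ofReal ?_
    rw [Real.norm_eq_abs, sq_abs, deviationKernel, ← ht, mul_pow]
    have e : B * (m / h) * (scaledKernel φ h (q.1.1, q.2.1) * langevinDensity p κ t +
        scaledKernel φ h (q.1.1, q.2.1) * (sphereArea p)⁻¹) =
        scaledKernel K h (q.1.1, q.2.1) ^ 2 *
          (B * (langevinDensity p κ t + (sphereArea p)⁻¹)) := by
      simp only [scaledKernel, hφ]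
      field_simp
    rw [e]
    gcongr
    nlinarith
  have hF1 := h1.measurable
  have hF2 := h2.measurable
  calc _ ≤ ∫⁻ q, ENNReal.ofReal (B * (m / h)) *
        (k₁ q * (ENNReal.ofReal (F q.1) * ENNReal.ofReal (F q.2)) +
        k₂ q * (ENNReal.ofReal (F q.1) * ENNReal.ofReal (F q.2)))
        ∂((refMeasure p).prod (refMeasure p)) := by
        refine lintegral_mono fun q => ?_
        rw [← add_mul]
        exact (mul_le_mul_left (hpt q) _).trans_eq (mul_assoc _ _ _)
    _ ≤ _ := by
        have hmF : Measurable fun q : (ℝ × Sph p) × (ℝ × Sph p) =>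
          ENNReal.ofReal (F q.1) * ENNReal.ofReal (F q.2) := by fun_prop
        have hm1 : Measurable fun q : (ℝ × Sph p) × (ℝ × Sph p) =>
          k₁ q * (ENNReal.ofReal (F q.1) * ENNReal.ofReal (F q.2)) := hF1.mul hmF
        have hm2 : Measurable fun q : (ℝ × Sph p) × (ℝ × Sph p) =>
          k₂ q * (ENNReal.ofReal (F q.1) * ENNReal.ofReal (F q.2)) := hF2.mul hmF
        have hm12 : Measurable fun q : (ℝ × Sph p) × (ℝ × Sph p) =>
          k₁ q * (ENNReal.ofReal (F q.1) * ENNReal.ofReal (F q.2)) +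
          k₂ q * (ENNReal.ofReal (F q.1) * ENNReal.ofReal (F q.2)) := hm1.add hm2
        rw [lintegral_const_mul _ hm12, lintegral_add_left hm1, two_mul]
        gcongr

end SmoothingKernels

/-! ### Central limit theorem for a sample with density `F`. -/

section DensityCLT

open scoped ENNReal

/-- Integrating the kernel of the `U`-statistic against the density smooths the deviation of the
density from its directional mean. -/
lemma ae_integral_deviationKernel {p : ℕ} (hp : 2 ≤ p) {K : ℝ → ℝ} (hK : RadialKernel K)
    {h κ : ℝ} (hh : 0 < h) {F : ℝ × Sph p → ℝ} (hF : Measurable F)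
    (hi : Integrable F (refMeasure p)) {r : ℝ → ℝ} (hr : Measurable r) (hri : Integrable r)
    (hrm : ∀ᵐ u, sphereArea p * r u = ∫ v, F (u, v) ∂(surf p)) :
    ∀ᵐ x ∂(refMeasure p), ∫ y, F y * deviationKernel p K h κ (x, y) ∂(refMeasure p) =
      ∫ y, (F y - r y.1) ∂((refMeasure p).withDensity fun y => smoothing p K h κ (x, y)) := by
  have hω := sphereArea_pos (p := p) (by omega)
  have hs := isSymmMarkov_smoothing (κ := κ) hp hK hh
  have hs0 : IsSymmMarkov (refMeasure p) (fun q : (ℝ × Sph p) × (ℝ × Sph p) =>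
      ENNReal.ofReal (scaledKernel K h (q.1.1, q.2.1)) * ENNReal.ofReal (sphereArea p)⁻¹) :=
    (isSymmMarkov_scaledKernel hK.measurable hK.symm hK.integral_eq_one hh).prod
      (isSymmMarkov_const (p := p) (by omega))
  have hrp : Integrable (fun y : ℝ × Sph p => r y.1) (refMeasure p) := hri.comp_fst (surf p)
  have hrpm : Measurable (fun y : ℝ × Sph p => r y.1) := hr.comp measurable_fst
  filter_upwards [hs.ae_integrable hF hi, hs.ae_integrable hrpm hrp, hs0.ae_integrable hF hi]
    with x h1 h2 h3
  set a : ℝ → ℝ := fun u => scaledKernel K h (x.1, u) with ha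
  set w : Sph p → ℝ := fun v => langevinDensity p κ (inner ℝ (x.2 : E p) (v : E p)) with hw
  have ha0 : ∀ u, 0 ≤ a u := fun u => mul_nonneg (by positivity) (hK.nonneg _)
  have hw0 : ∀ v, 0 ≤ w v := fun v => (langevinDensity_pos hp _ _).le
  have hk : ∀ y : ℝ × Sph p, (smoothing p K h κ (x, y)).toReal = a y.1 * w y.2 := fun y => by
    simp only [smoothing, ENNReal.toReal_mul]
    rw [ENNReal.toReal_ofReal (ha0 y.1), ENNReal.toReal_ofReal (hw0 y.2)]
  simp only [hk] at h1 h2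
  have h3' : Integrable (fun y => a y.1 * (sphereArea p)⁻¹ * F y) (refMeasure p) := by
    refine h3.congr (Eventually.of_forall fun y => ?_)
    have e := ENNReal.toReal_ofReal (ha0 y.1)
    simp only [ha] at e
    simp only [ENNReal.toReal_mul, ha]
    rw [e, ENNReal.toReal_ofReal (inv_pos.2 hω).le]
  have hw1 : ∫ v, w v ∂(surf p) = 1 := by
    have hwm : Measurable w := by
      have := (continuous_langevinDensity p κ).comp
        (by fun_prop : Continuous fun v : Sph p => inner ℝ (x.2 : E p) (v : E p))
      exact this.measurable
    rw [integral_eq_lintegral_of_nonneg_ae (Eventually.of_forall hw0) hwm.aestronglyMeasurable,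
      lintegral_langevinDensity hp]
    rfl
  -- The Langevin factor integrates to 1 and `r` is the directional mean of `F`. So smoothing `r`
  -- gives the same value as integrating `F` against `K_h · ω⁻¹`, which converts the subtracted
  -- constant in the kernel into the subtraction of `r`.
  have e1 : ∫ y : ℝ × Sph p, a y.1 * w y.2 * r y.1 ∂(refMeasure p) = ∫ u, a u * r u := by
    have : ∀ y : ℝ × Sph p, a y.1 * w y.2 * r y.1 = (a y.1 * r y.1) * w y.2 := fun y => by ring
    simp_rw [this]
    rw [integral_prod_mul (fun u => a u * r u) w, hw1, mul_one]
  have e2 : ∫ y : ℝ × Sph p, a y.1 * (sphereArea p)⁻¹ * F y ∂(refMeasure p) =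
      ∫ u, a u * r u := by
    rw [integral_prod _ h3']
    refine integral_congr_ae ?_
    filter_upwards [hrm] with u hu
    rw [integral_const_mul, ← hu]
    field_simp
  have hmk : Measurable fun y => smoothing p K h κ (x, y) := hs.measurable_right x
  rw [integral_withDensity_eq_integral_toReal_smul hmk
    (Eventually.of_forall fun y => by simp [smoothing, ENNReal.mul_lt_top])]
  simp only [hk, smul_eq_mul]
  calc ∫ y, F y * deviationKernel p K h κ (x, y) ∂(refMeasure p)
      = ∫ y : ℝ × Sph p, (a y.1 * w y.2 * F y - a y.1 * (sphereArea p)⁻¹ * F y)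
          ∂(refMeasure p) := by
        refine integral_congr_ae (Eventually.of_forall fun y => ?_)
        simp only [deviationKernel, ha, hw]; ring
    _ = ∫ y : ℝ × Sph p, a y.1 * w y.2 * F y ∂(refMeasure p) -
          ∫ y : ℝ × Sph p, a y.1 * w y.2 * r y.1 ∂(refMeasure p) := by
        rw [integral_sub h1 h3', e1, e2]
    _ = _ := by
        rw [← integral_sub h1 h2]
        refine integral_congr_ae (Eventually.of_forall fun y => ?_)
        simp only; ring

lemma memLp_three_of_integrable_cube {X : Type*} [MeasurableSpace X] {μ : Measure X} {F : X → ℝ}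
    (hF : Measurable F) (h0 : ∀ᵐ z ∂μ, 0 ≤ F z) (h3 : Integrable (fun z => F z ^ 3) μ) :
    MemLp F 3 μ := by
  rw [← integrable_norm_rpow_iff hF.aestronglyMeasurable (by norm_num) (by norm_num)]
  refine h3.congr ?_
  filter_upwards [h0] with z hz
  rw [Real.norm_of_nonneg hz]
  simp only [ENNReal.toReal_ofNat]
  norm_cast

/-- Second moments of the kernels of the `U`-statistics. -/
lemma memLp_deviationKernel {p : ℕ} (hp : 2 ≤ p)
    {F : ℝ × Sph p → ℝ} (hF : Measurable F) (h0 : ∀ z, 0 ≤ F z)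
    (hi : Integrable F (refMeasure p)) (h3 : Integrable (fun z => F z ^ 3) (refMeasure p))
    {K : ℝ → ℝ} (hK : RadialKernel K)
    {h κ : ℕ → ℝ} (hh : ∀ n, 0 < h n) (hκ : ∀ n, 0 < κ n) (hκlim : Tendsto κ atTop atTop)
    (hκh : Tendsto (fun n : ℕ => κ n ^ (((p : ℝ) - 1) / 2) / ((n : ℝ) * h n)) atTop (𝓝 0)) :
    (∀ n, MemLp (deviationKernel p K (h n) (κ n)) 2
      (((refMeasure p).withDensity fun z => ENNReal.ofReal (F z)).prod
        ((refMeasure p).withDensity fun z => ENNReal.ofReal (F z)))) ∧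
    Tendsto (fun n : ℕ => (∫ q, deviationKernel p K (h n) (κ n) q ^ 2
      ∂(((refMeasure p).withDensity fun z => ENNReal.ofReal (F z)).prod
        ((refMeasure p).withDensity fun z => ENNReal.ofReal (F z)))) / n) atTop (𝓝 0) := by
  have hω := sphereArea_pos (p := p) (by omega)
  have hFe : Measurable fun z => ENNReal.ofReal (F z) := hF.ennreal_ofReal
  have hF2 : Integrable (fun z => F z ^ 2) (refMeasure p) := by
    refine (hi.add h3).mono' (hF.pow_const 2).aestronglyMeasurable (Eventually.of_forall fun z => ?_)
    have := h0 z
    simp only [Pi.add_apply, Real.norm_eq_abs, abs_of_nonneg (sq_nonneg (F z))]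
    nlinarith [mul_nonneg this (sq_nonneg (F z - 1))]
  have hHm : ∀ n, Measurable (deviationKernel p K (h n) (κ n)) := fun n =>
    measurable_deviationKernel p hK.measurable _ _
  set c₂ : ℝ := ∫ z, F z ^ 2 ∂(refMeasure p) with hc₂
  have hc₂0 : 0 ≤ c₂ := integral_nonneg fun z => sq_nonneg _
  have hc₂e : ∫⁻ x, ENNReal.ofReal (F x) ^ 2 ∂(refMeasure p) = ENNReal.ofReal c₂ := by
    rw [hc₂, ofReal_integral_eq_lintegral_ofReal hF2 (Eventually.of_forall fun z => sq_nonneg _)]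
    simp_rw [ENNReal.ofReal_pow (h0 _)]
  set m := ∫ x, K x ^ 2 with hm
  have hm0 : 0 < m := (radialKernel_sq hK).2
  set B : ℕ → ℝ := fun n => langevinDensity p (κ n) 1 + (sphereArea p)⁻¹ with hB
  have hB0 : ∀ n, 0 < B n := fun n => add_pos (langevinDensity_pos hp _ _) (inv_pos.2 hω)
  have hHe : ∀ n, ∫⁻ q, ‖deviationKernel p K (h n) (κ n) q‖ₑ ^ 2 ∂(((refMeasure p).withDensity fun z => ENNReal.ofReal (F z)).prod
        ((refMeasure p).withDensity fun z => ENNReal.ofReal (F z))) ≤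
      ENNReal.ofReal (B n * (m / h n) * (2 * c₂)) := fun n => by
    have hb := lintegral_deviationKernel_sq_le (κ := κ n) (B := B n) hp hK (hh n)
      (fun t ht => by
        have := langevinDensity_le_one hp (hκ n).le ht
        simp only [hB]; linarith) hF
    rw [hc₂e] at hb
    have hBm : 0 ≤ B n * (m / h n) := mul_nonneg (hB0 n).le (div_nonneg hm0.le (hh n).le)
    have h2c : ENNReal.ofReal (2 * c₂) = 2 * ENNReal.ofReal c₂ := by
      rw [ENNReal.ofReal_mul (by norm_num), ENNReal.ofReal_ofNat]
    rw [ENNReal.ofReal_mul hBm, h2c]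
    refine le_trans (le_of_eq ?_) hb
    rw [ prod_withDensity hFe hFe, lintegral_withDensity_eq_lintegral_mul _ (by fun_prop)
      ((hHm n).enorm.pow_const 2)]
    refine lintegral_congr fun q => ?_
    simp only [Pi.mul_apply]; ring
  have hH2 : ∀ n, MemLp (deviationKernel p K (h n) (κ n)) 2 (((refMeasure p).withDensity fun z => ENNReal.ofReal (F z)).prod
        ((refMeasure p).withDensity fun z => ENNReal.ofReal (F z))) := fun n => by
    refine ⟨(hHm n).aestronglyMeasurable, ?_⟩
    rw [eLpNorm_lt_top_iff_lintegral_rpow_enorm_lt_top (by norm_num) (by norm_num)]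
    refine lt_of_le_of_lt (le_of_eq ?_) ((hHe n).trans_lt ENNReal.ofReal_lt_top)
    refine lintegral_congr fun q => ?_
    simp
  have hHi : ∀ n, ∫ q, deviationKernel p K (h n) (κ n) q ^ 2 ∂(((refMeasure p).withDensity fun z => ENNReal.ofReal (F z)).prod
        ((refMeasure p).withDensity fun z => ENNReal.ofReal (F z))) ≤
      B n * (m / h n) * (2 * c₂) := fun n => by
    rw [integral_eq_lintegral_of_nonneg_ae (Eventually.of_forall fun q => sq_nonneg _)
      ((hHm n).pow_const 2).aestronglyMeasurable]
    have : 0 ≤ B n * (m / h n) * (2 * c₂) :=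
      mul_nonneg (mul_nonneg (hB0 n).le (div_nonneg hm0.le (hh n).le)) (by positivity)
    refine ENNReal.toReal_le_of_le_ofReal this (le_trans (le_of_eq ?_) (hHe n))
    refine lintegral_congr fun q => ?_
    rw [← ofReal_norm, ← ENNReal.ofReal_pow (norm_nonneg _), Real.norm_eq_abs, sq_abs]
  refine ⟨hH2, ?_⟩
  -- For `κ ≥ 1`, hence eventually, `B n` is at most a constant times `κ ^ ((p-1)/2)`, and the bound
  -- divided by `n` becomes a multiple of `κ ^ ((p-1)/2) / (n h)`.
  obtain ⟨C, hC, hCb⟩ := exists_langevinDensity_le hp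
  have hsq := hκh.const_mul ((C + (sphereArea p)⁻¹) * (m * (2 * c₂)))
  rw [mul_zero] at hsq
  refine tendsto_of_tendsto_of_tendsto_of_le_of_le' tendsto_const_nhds hsq
    (Eventually.of_forall fun n => div_nonneg (integral_nonneg fun q => sq_nonneg _)
      (by positivity)) ?_
  filter_upwards [hκlim.eventually_ge_atTop 1, eventually_gt_atTop 0] with n hn hn0
  have hn0' : (0 : ℝ) < n := by exact_mod_cast hn0
  have hp2 : (2 : ℝ) ≤ p := by exact_mod_cast hp
  have hκ1 : 1 ≤ κ n ^ (((p : ℝ) - 1) / 2) := Real.one_le_rpow hn (by linarith)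
  have h1 := hCb (κ n) hn 1
  simp only [sub_self, mul_zero, Real.exp_zero, mul_one] at h1
  have hBn : B n ≤ (C + (sphereArea p)⁻¹) * κ n ^ (((p : ℝ) - 1) / 2) := by
    have : 0 < (sphereArea p)⁻¹ := inv_pos.2 hω
    simp only [hB]
    nlinarith
  have hhn := hh n
  calc (∫ q, deviationKernel p K (h n) (κ n) q ^ 2 ∂(((refMeasure p).withDensity fun z => ENNReal.ofReal (F z)).prod
        ((refMeasure p).withDensity fun z => ENNReal.ofReal (F z)))) / n
      ≤ (C + (sphereArea p)⁻¹) * κ n ^ (((p : ℝ) - 1) / 2) * (m / h n) * (2 * c₂) / n := by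
        have := hHi n
        have hmh : 0 ≤ m / h n := by positivity
        gcongr
        refine this.trans ?_
        gcongr
    _ = _ := by field_simp

/-- The projections of the kernels converge in mean square. -/
lemma tendsto_projection {p : ℕ} (hp : 2 ≤ p)
    {F : ℝ × Sph p → ℝ} (hF : Measurable F) (h0 : ∀ z, 0 ≤ F z)
    (hi : Integrable F (refMeasure p)) (hF3 : MemLp F 3 (refMeasure p))
    {r : ℝ → ℝ} (hr : Measurable r) (hri : Integrable r)
    (hrm : ∀ᵐ u, sphereArea p * r u = ∫ v, F (u, v) ∂(surf p))
    (hD3 : MemLp (fun z : ℝ × Sph p => F z - r z.1) 3 (refMeasure p))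
    {ν : Measure (ℝ × Sph p)} [IsProbabilityMeasure ν]
    (hν : ν = (refMeasure p).withDensity fun z => ENNReal.ofReal (F z))
    {K : ℝ → ℝ} (hK : RadialKernel K)
    {h κ : ℕ → ℝ} (hh : ∀ n, 0 < h n)
    (hκlim : Tendsto κ atTop atTop) (hhlim : Tendsto h atTop (𝓝 0)) :
    Tendsto (fun n => ∫ z, ((∫ z', deviationKernel p K (h n) (κ n) (z, z') ∂ν) -
      (F z - r z.1)) ^ 2 ∂ν) atTop (𝓝 0) := by
  have hFe : Measurable fun z => ENNReal.ofReal (F z) := hF.ennreal_ofReal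
  have hrpm : Measurable (fun y : ℝ × Sph p => r y.1) := hr.comp measurable_fst
  have hD : Measurable fun z : ℝ × Sph p => F z - r z.1 := hF.sub hrpm
  have hFlt : ∀ᵐ z ∂(refMeasure p), ENNReal.ofReal (F z) < ⊤ :=
    Eventually.of_forall fun z => ENNReal.ofReal_lt_top
  have hHm : ∀ n, Measurable (deviationKernel p K (h n) (κ n)) := fun n =>
    measurable_deviationKernel p hK.measurable _ _
  have hinc := tendsto_eLpNorm_increment (X := ℝ × Sph p) (μ := refMeasure p)
    (k := fun n => smoothing p K (h n) (κ n)) (φ := fun z => F z - r z.1)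
    (fun n => isSymmMarkov_smoothing (κ := κ n) hp hK (hh n))
    (fun δ hδ => smoothing_concentrates hp hK hh hκlim hhlim hδ) hD hD3
  have hbound : ∀ n, ENNReal.ofReal (∫ z, ((∫ z', deviationKernel p K (h n) (κ n) (z, z') ∂ν) -
      (F z - r z.1)) ^ 2 ∂ν) ≤ eLpNorm F 3 (refMeasure p) *
        eLpNorm (fun q : (ℝ × Sph p) × (ℝ × Sph p) => (F q.2 - r q.2.1) - (F q.1 - r q.1.1)) 3
          (((refMeasure p).prod (refMeasure p)).withDensity (smoothing p K (h n) (κ n))) ^ 2 := by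
    intro n
    have hs := isSymmMarkov_smoothing (κ := κ n) hp hK (hh n)
    refine le_trans ?_ (hs.lintegral_mul_average_sub_sq_le (φ := fun z => F z - r z.1) hF hD)
    have hgm : Measurable fun z => ∫ z', deviationKernel p K (h n) (κ n) (z, z') ∂ν :=
      measurable_section_integral (hHm n)
    have hsqm : Measurable fun z => ((∫ z', deviationKernel p K (h n) (κ n) (z, z') ∂ν) -
      (F z - r z.1)) ^ 2 := (hgm.sub hD).pow_const 2
    rw [integral_eq_lintegral_of_nonneg_ae (Eventually.of_forall fun q => sq_nonneg _)
      hsqm.aestronglyMeasurable]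
    refine ENNReal.ofReal_toReal_le.trans (le_of_eq ?_)
    have hw := lintegral_withDensity_eq_lintegral_mul (refMeasure p) hFe hsqm.ennreal_ofReal
    rw [← hν] at hw
    rw [hw]
    refine lintegral_congr_ae ?_
    filter_upwards [ae_integral_deviationKernel (κ := κ n) hp hK (hh n) hF hi hr hri hrm]
      with x hx
    rw [← hx]
    have : ∫ z', deviationKernel p K (h n) (κ n) (x, z') ∂ν =
        ∫ y, F y * deviationKernel p K (h n) (κ n) (x, y) ∂(refMeasure p) := by
      rw [hν, integral_withDensity_eq_integral_toReal_smul hFe hFlt]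
      simp only [ENNReal.toReal_ofReal (h0 _), smul_eq_mul]
    simp only [Pi.mul_apply]
    rw [this, ← ofReal_norm, Real.norm_of_nonneg (h0 x), ← ofReal_norm,
      ← ENNReal.ofReal_pow (norm_nonneg _), Real.norm_eq_abs, sq_abs]
  have hlim0 : Tendsto (fun n => eLpNorm F 3 (refMeasure p) *
        eLpNorm (fun q : (ℝ × Sph p) × (ℝ × Sph p) => (F q.2 - r q.2.1) - (F q.1 - r q.1.1)) 3
          (((refMeasure p).prod (refMeasure p)).withDensity (smoothing p K (h n) (κ n))) ^ 2)
      atTop (𝓝 0) := by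
    have h2 := ENNReal.Tendsto.pow (n := 2) hinc
    rw [zero_pow (by norm_num)] at h2
    simpa using ENNReal.Tendsto.const_mul h2 (Or.inr hF3.2.ne)
  have hof := tendsto_of_tendsto_of_tendsto_of_le_of_le tendsto_const_nhds hlim0
    (fun n => bot_le) hbound
  have := (ENNReal.tendsto_toReal ENNReal.zero_ne_top).comp hof
  refine this.congr fun n => ?_
  simp only [Function.comp]
  rw [ENNReal.toReal_ofReal (integral_nonneg fun q => sq_nonneg _)]

/-- Central limit theorem for the `U`-statistic, for a sample with density `F`. -/
theorem deviationKernel_clt {Ω : Type*} [MeasurableSpace Ω] {P : Measure Ω}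
    [IsProbabilityMeasure P] {p : ℕ} (hp : 2 ≤ p) {Z : ℕ → Ω → ℝ × Sph p}
    (hZm : ∀ i, Measurable (Z i)) (hZi : iIndepFun Z P)
    {F : ℝ × Sph p → ℝ} (hF : Measurable F) (h0 : ∀ z, 0 ≤ F z)
    (hi : Integrable F (refMeasure p)) (h3 : Integrable (fun z => F z ^ 3) (refMeasure p))
    {r : ℝ → ℝ} (hr : Measurable r) (hri : Integrable r) (hr0 : ∀ᵐ u, 0 ≤ r u)
    (hr3 : Integrable (fun u => r u ^ 3))
    (hrm : ∀ᵐ u, sphereArea p * r u = ∫ v, F (u, v) ∂(surf p))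
    (hQ : Integrable (fun z => F z * (F z - r z.1) ^ 2) (refMeasure p))
    (hZl : ∀ i, P.map (Z i) = (refMeasure p).withDensity fun z => ENNReal.ofReal (F z))
    {K : ℝ → ℝ} (hK : RadialKernel K)
    {h κ : ℕ → ℝ} (hh : ∀ n, 0 < h n) (hκ : ∀ n, 0 < κ n)
    (hκlim : Tendsto κ atTop atTop) (hhlim : Tendsto h atTop (𝓝 0))
    (hκh : Tendsto (fun n : ℕ => κ n ^ (((p : ℝ) - 1) / 2) / ((n : ℝ) * h n)) atTop (𝓝 0)) :
    (∀ n i j, i ≠ j → Integrable (fun ω => deviationKernel p K (h n) (κ n) (Z i ω, Z j ω)) P) ∧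
    TendstoInDistribution
      (fun (n : ℕ) (ω : Ω) => Real.sqrt n *
        (((n : ℝ) * (n - 1))⁻¹ * (∑ i ∈ Finset.range n, ∑ j ∈ (Finset.range n).erase i,
            deviationKernel p K (h n) (κ n) (Z i ω, Z j ω)) -
          ∫ ω', ((n : ℝ) * (n - 1))⁻¹ * (∑ i ∈ Finset.range n, ∑ j ∈ (Finset.range n).erase i,
            deviationKernel p K (h n) (κ n) (Z i ω', Z j ω')) ∂P))
      atTop (id : ℝ → ℝ) (fun _ => P) (gaussianReal 0 (Real.toNNReal (4 *
        Var[fun z => F z - r z.1; (refMeasure p).withDensity fun z => ENNReal.ofReal (F z)]))) := by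
  set ν := (refMeasure p).withDensity fun z => ENNReal.ofReal (F z) with hν
  have hνp : IsProbabilityMeasure ν := by
    rw [← hZl 0]; exact Measure.isProbabilityMeasure_map (hZm 0).aemeasurable
  have hFe : Measurable fun z => ENNReal.ofReal (F z) := hF.ennreal_ofReal
  have hrpm : Measurable (fun y : ℝ × Sph p => r y.1) := hr.comp measurable_fst
  have hD : Measurable fun z : ℝ × Sph p => F z - r z.1 := hF.sub hrpm
  have hF3 : MemLp F 3 (refMeasure p) :=
    memLp_three_of_integrable_cube hF (Eventually.of_forall h0) h3
  have hD3 : MemLp (fun z : ℝ × Sph p => F z - r z.1) 3 (refMeasure p) :=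
    hF3.sub (memLp_three_of_integrable_cube hrpm
      (Measure.quasiMeasurePreserving_fst.ae hr0) (hr3.comp_fst (surf p)))
  have hFlt : ∀ᵐ z ∂(refMeasure p), ENNReal.ofReal (F z) < ⊤ :=
    Eventually.of_forall fun z => ENNReal.ofReal_lt_top
  have hD2 : MemLp (fun z : ℝ × Sph p => F z - r z.1) 2 ν := by
    rw [memLp_two_iff_integrable_sq hD.aestronglyMeasurable, hν,
      integrable_withDensity_iff_integrable_smul' hFe hFlt]
    simpa only [ENNReal.toReal_ofReal (h0 _), smul_eq_mul] using hQ
  have hHm : ∀ n, Measurable (deviationKernel p K (h n) (κ n)) := fun n =>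
    measurable_deviationKernel p hK.measurable _ _
  obtain ⟨hH2, hlim⟩ := memLp_deviationKernel hp hF h0 hi h3 hK hh hκ hκlim hκh
  rw [← hν] at hlim
  simp only [← hν] at hH2
  have hproj := tendsto_projection hp hF h0 hi hF3 hr hri hrm hD3 hν hK hh hκlim hhlim
  refine ⟨fun n i j hij => ?_, ?_⟩
  · exact ((hH2 n).comp_measurePreserving
      (measurePreserving_pair hZm hZi hZl hij)).integrable (by norm_num)
  · exact tendstoInDistribution_uStatistic hZm hZi hZl hHm
      (fun n x y => deviationKernel_symm p hK _ _ x y) hH2 hlim hD hD2 hproj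

end DensityCLT

/-! ### The given density: extension by zero, cubic integrability, variance and minimal distance. -/

section Density

open scoped ENNReal

lemma polarExt_coe {p : ℕ} (f : ℝ → Sph p → ℝ) (u : ℝ) (v : Sph p) :
    polarExt f (u, (v : E p)) = f u v := by
  have hv : ‖(v : E p)‖ = 1 := by simp
  have h0 : (v : E p) ≠ 0 := fun h => by simp [h] at hv
  simp only [polarExt, radialExt, ne_eq, h0, not_false_eq_true, dite_true]
  congr 1
  ext1
  simp [hv]

lemma isOpen_polarDomain (p : ℕ) : IsOpen (Ioi (0 : ℝ) ×ˢ {x : E p | x ≠ 0}) :=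
  isOpen_Ioi.prod isOpen_ne

lemma mem_polarDomain {p : ℕ} {u : ℝ} (hu : 0 < u) (v : Sph p) :
    (u, (v : E p)) ∈ Ioi (0 : ℝ) ×ˢ {x : E p | x ≠ 0} := by
  refine ⟨hu, fun h => ?_⟩
  have hv : ‖(v : E p)‖ = 1 := by simp
  simp only at h
  simp [h] at hv

lemma SmoothDensity.continuousOn {p : ℕ} {f : ℝ → Sph p → ℝ} (hf : SmoothDensity f) :
    ContinuousOn (fun z : ℝ × Sph p => f z.1 z.2) (Ioi (0 : ℝ) ×ˢ univ) := by
  have h1 : ContinuousOn (fun z : ℝ × Sph p => ((z.1, (z.2 : E p)) : ℝ × E p))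
      (Ioi (0 : ℝ) ×ˢ univ) := by fun_prop
  refine (hf.differentiable.continuousOn.comp h1 fun z hz => mem_polarDomain hz.1 z.2).congr
    fun z _ => ?_
  exact (polarExt_coe f z.1 z.2).symm

/-- The density, extended by zero to nonpositive radii. -/
def zeroExt {p : ℕ} (f : ℝ → Sph p → ℝ) : ℝ × Sph p → ℝ :=
  (Ioi (0 : ℝ) ×ˢ univ).indicator fun z => f z.1 z.2

lemma zeroExt_of_pos {p : ℕ} (f : ℝ → Sph p → ℝ) {u : ℝ} (hu : 0 < u) (v : Sph p) :
    zeroExt f (u, v) = f u v := indicator_of_mem (by exact ⟨hu, mem_univ v⟩) _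

lemma zeroExt_of_nonpos {p : ℕ} (f : ℝ → Sph p → ℝ) {u : ℝ} (hu : u ≤ 0) (v : Sph p) :
    zeroExt f (u, v) = 0 := indicator_of_notMem (fun h => hu.not_gt h.1) _

lemma zeroExt_nonneg {p : ℕ} {f : ℝ → Sph p → ℝ} (h0 : ∀ u > 0, ∀ v, 0 ≤ f u v)
    (z : ℝ × Sph p) : 0 ≤ zeroExt f z := indicator_nonneg (fun z hz => h0 z.1 hz.1 z.2) z

lemma measurableSet_pos_prod (p : ℕ) : MeasurableSet (Ioi (0 : ℝ) ×ˢ (univ : Set (Sph p))) :=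
  measurableSet_Ioi.prod MeasurableSet.univ

lemma SmoothDensity.measurable_zeroExt {p : ℕ} {f : ℝ → Sph p → ℝ} (hf : SmoothDensity f) :
    Measurable (zeroExt f) := by
  classical
  have := hf.continuousOn.measurable_piecewise (continuousOn_const (c := (0 : ℝ)))
    (measurableSet_pos_prod p)
  have e : zeroExt f = (Ioi (0 : ℝ) ×ˢ (univ : Set (Sph p))).piecewise
      (fun z => f z.1 z.2) (fun _ => 0) := (piecewise_eq_indicator).symm
  rw [e]
  exact this

lemma polarMeasure_eq (p : ℕ) :
    polarMeasure p = (refMeasure p).restrict (Ioi (0 : ℝ) ×ˢ univ) := by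
  rw [polarMeasure, ← Measure.prod_restrict, Measure.restrict_univ]

lemma withDensity_polarMeasure {p : ℕ} (f : ℝ → Sph p → ℝ) :
    (polarMeasure p).withDensity (fun z => ENNReal.ofReal (f z.1 z.2)) =
      (refMeasure p).withDensity fun z => ENNReal.ofReal (zeroExt f z) := by
  rw [polarMeasure_eq, ← withDensity_indicator (measurableSet_pos_prod p)]
  congr 1
  ext z
  by_cases hz : z ∈ Ioi (0 : ℝ) ×ˢ (univ : Set (Sph p)) <;> simp [zeroExt, hz]

/-- The radial density divided by the area of the sphere: the directional mean of the density. -/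
def radialMean {p : ℕ} (f : ℝ → Sph p → ℝ) (u : ℝ) : ℝ :=
  (sphereArea p)⁻¹ * ∫ v, zeroExt f (u, v) ∂(surf p)

lemma radialMean_of_pos {p : ℕ} (f : ℝ → Sph p → ℝ) {u : ℝ} (hu : 0 < u) :
    radialMean f u = (sphereArea p)⁻¹ * marginal f u := by
  simp only [radialMean, marginal, zeroExt_of_pos f hu]

lemma radialMean_of_nonpos {p : ℕ} (f : ℝ → Sph p → ℝ) {u : ℝ} (hu : u ≤ 0) :
    radialMean f u = 0 := by
  simp [radialMean, zeroExt_of_nonpos f hu]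

lemma SmoothDensity.measurable_radialMean {p : ℕ} {f : ℝ → Sph p → ℝ} (hf : SmoothDensity f) :
    Measurable (radialMean f) :=
  hf.measurable_zeroExt.stronglyMeasurable.integral_prod_right'.measurable.const_mul _

lemma sphereArea_mul_radialMean {p : ℕ} (hp : 1 ≤ p) (f : ℝ → Sph p → ℝ) (u : ℝ) :
    sphereArea p * radialMean f u = ∫ v, zeroExt f (u, v) ∂(surf p) := by
  rw [radialMean, mul_inv_cancel_left₀ (sphereArea_pos hp).ne']

lemma zeroExt_mul_sq {p : ℕ} (f : ℝ → Sph p → ℝ) :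
    (fun z => zeroExt f z * (zeroExt f z - radialMean f z.1) ^ 2) =
      (Ioi (0 : ℝ) ×ˢ univ).indicator (varIntegrand f) := by
  ext ⟨u, v⟩
  rcases le_or_gt u 0 with hu | hu
  · rw [indicator_of_notMem fun h => hu.not_gt h.1]
    simp [zeroExt_of_nonpos f hu]
  · rw [indicator_of_mem (by exact ⟨hu, mem_univ v⟩)]
    simp [zeroExt_of_pos f hu, radialMean_of_pos f hu, varIntegrand]

/-- For almost every direction, the density is bounded along the ray. -/
lemma SmoothDensity.ae_bounded {p : ℕ} {f : ℝ → Sph p → ℝ} (hf : SmoothDensity f)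
    (h0 : ∀ u > 0, ∀ v, 0 ≤ f u v) (hi : Integrable (zeroExt f) (refMeasure p)) :
    ∀ᵐ v ∂(surf p), ∃ C, ∀ u > 0, f u v ≤ C := by
  -- By Fubini the density is integrable along almost every ray. Its radial derivatives are read off
  -- from the ambient derivative in the direction `(1, 0)`.
  filter_upwards [hi.prod_left_ae] with v hv
  have hO := isOpen_polarDomain p
  have hray : ∀ u, HasDerivAt (fun u : ℝ => ((u, (v : E p)) : ℝ × E p)) ((1 : ℝ), (0 : E p)) u :=
    fun u => (hasDerivAt_id u).prodMk (hasDerivAt_const u _)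
  have hd : ∀ u > 0, HasDerivAt (fun u => f u v)
      (fderiv ℝ (polarExt f) (u, (v : E p)) (1, 0)) u := fun u hu => by
    have h1 := (hf.differentiable.differentiableAt
      (hO.mem_nhds (mem_polarDomain hu v))).hasFDerivAt
    refine (h1.comp_hasDerivAt u (hray u)).congr_of_eventuallyEq
      (Eventually.of_forall fun t => ?_)
    exact (polarExt_coe f t v).symm
  have hd2 : ∀ u > 0, DifferentiableAt ℝ
      (fun u => fderiv ℝ (polarExt f) (u, (v : E p)) (1, 0)) u := fun u hu => by
    have h1 := hf.twice_differentiable.differentiableAt (hO.mem_nhds (mem_polarDomain hu v))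
    have h2 : DifferentiableAt ℝ (fun u => fderiv ℝ (polarExt f) (u, (v : E p))) u :=
      h1.comp u (hray u).differentiableAt
    exact h2.clm_apply (differentiableAt_const _)
  refine bounded_of_uniformContinuousOn_deriv_deriv (fun u hu => h0 u hu v) ?_
    (fun u hu => (hd u hu).differentiableAt.differentiableWithinAt) ?_ (hf.unif_radius v)
  · exact (hv.integrableOn (s := Ioi 0)).congr_fun (fun u hu => zeroExt_of_pos f hu v)
      measurableSet_Ioi
  · intro u hu
    refine ((hd2 u hu).congr_of_eventuallyEq ?_).differentiableWithinAt
    filter_upwards [Ioi_mem_nhds hu] with t ht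
    exact (hd t ht).deriv

/-- Boundedness along rays is made uniform off directions of measure `ω / 8` using rational radii
only, for the sake of measurability. Continuity of `f` then extends the bound to every radius. -/
lemma SmoothDensity.integrable_cube {p : ℕ} (hp : 1 ≤ p) {f : ℝ → Sph p → ℝ}
    (hf : SmoothDensity f) (h0 : ∀ u > 0, ∀ v, 0 ≤ f u v)
    (hi : Integrable (zeroExt f) (refMeasure p))
    (hQ : Integrable (fun z => zeroExt f z * (zeroExt f z - radialMean f z.1) ^ 2)
      (refMeasure p)) :
    Integrable (fun u => radialMean f u ^ 3) ∧
      Integrable (fun z => zeroExt f z ^ 3) (refMeasure p) := by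
  have hω := sphereArea_pos hp
  have hF := hf.measurable_zeroExt
  obtain ⟨G, hG, hGs, C, hC, hb⟩ := exists_uniform_bound (s := surf p)
    (ι := {q : ℚ // 0 < q}) (φ := fun q v => zeroExt f ((q : ℚ), v))
    (fun q => hF.comp measurable_prodMk_left)
    (by
      filter_upwards [hf.ae_bounded h0 hi] with v hv
      obtain ⟨C, hC⟩ := hv
      refine ⟨C, fun q => ?_⟩
      have hq : (0 : ℝ) < ((q : ℚ) : ℝ) := by exact_mod_cast q.2
      rw [zeroExt_of_pos f hq]
      exact hC _ hq) (ε := sphereArea p / 8) (by positivity)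
  refine integrable_cube_of_mean hF (zeroExt_nonneg h0) hi hf.measurable_radialMean
    (by rwa [surf_real_univ hp]) (Eventually.of_forall fun u => ?_) hQ hG
    (by rwa [surf_real_univ hp]) hC fun u v hv => ?_
  · rw [surf_real_univ hp, sphereArea_mul_radialMean hp]
  · rcases le_or_gt u 0 with hu | hu
    · rw [zeroExt_of_nonpos f hu]; exact hC
    · rw [zeroExt_of_pos f hu]
      by_contra! hlt
      have hc : ContinuousAt (fun t => f t v) u := by
        have h1 : ContinuousAt (fun z : ℝ × Sph p => f z.1 z.2) (u, v) :=
          hf.continuousOn.continuousAt ((isOpen_Ioi.prod isOpen_univ).mem_nhds ⟨hu, mem_univ v⟩)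
        exact h1.comp (f := fun t => (t, v)) (by fun_prop)
      have hev := (hc.eventually (lt_mem_nhds hlt)).and (Ioi_mem_nhds hu)
      obtain ⟨q, hq⟩ := (Rat.denseRange_cast (𝕜 := ℝ)).exists_mem_open isOpen_interior
        ⟨u, mem_interior_iff_mem_nhds.2 hev⟩
      obtain ⟨hq1, hq2⟩ := interior_subset hq
      have hq0 : 0 < q := by exact_mod_cast (show (0 : ℝ) < (q : ℝ) from hq2)
      have := hb ⟨q, hq0⟩ v hv
      rw [zeroExt_of_pos f hq2] at this
      exact (lt_irrefl _ (this.trans_lt hq1))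

lemma memLp_two_of_integrable_cube {X : Type*} [MeasurableSpace X] {μ : Measure X} {F : X → ℝ}
    (hF : Measurable F) (h0 : ∀ᵐ z ∂μ, 0 ≤ F z) (hi : Integrable F μ)
    (h3 : Integrable (fun z => F z ^ 3) μ) : MemLp F 2 μ := by
  rw [memLp_two_iff_integrable_sq hF.aestronglyMeasurable]
  refine (hi.add h3).mono' (hF.pow_const 2).aestronglyMeasurable ?_
  filter_upwards [h0] with z hz
  simp only [Pi.add_apply, Real.norm_eq_abs, abs_of_nonneg (sq_nonneg (F z))]
  nlinarith [mul_nonneg hz (sq_nonneg (F z - 1))]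

/-- The variance of the deviation of the density from its directional mean. -/
lemma variance_deviation {p : ℕ} (hp : 1 ≤ p) {F : ℝ × Sph p → ℝ} (hF : Measurable F)
    (h0 : ∀ z, 0 ≤ F z) {r : ℝ → ℝ} (hr : Measurable r)
    (hF2 : MemLp F 2 (refMeasure p)) (hr2 : MemLp (fun z : ℝ × Sph p => r z.1) 2 (refMeasure p))
    (hi : Integrable F (refMeasure p))
    (hrm : ∀ᵐ u, sphereArea p * r u = ∫ v, F (u, v) ∂(surf p))
    (hQ : Integrable (fun z => F z * (F z - r z.1) ^ 2) (refMeasure p))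
    [IsProbabilityMeasure ((refMeasure p).withDensity fun z => ENNReal.ofReal (F z))] :
    Var[fun z => F z - r z.1; (refMeasure p).withDensity fun z => ENNReal.ofReal (F z)] =
      ∫ z, F z * (F z - r z.1) ^ 2 ∂(refMeasure p) -
        (∫ z, (F z - r z.1) ^ 2 ∂(refMeasure p)) ^ 2 := by
  have hFe : Measurable fun z => ENNReal.ofReal (F z) := hF.ennreal_ofReal
  have hFlt : ∀ᵐ z ∂(refMeasure p), ENNReal.ofReal (F z) < ⊤ :=
    Eventually.of_forall fun z => ENNReal.ofReal_lt_top
  have hrpm : Measurable (fun y : ℝ × Sph p => r y.1) := hr.comp measurable_fst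
  have hD : Measurable fun z : ℝ × Sph p => F z - r z.1 := hF.sub hrpm
  have hD2 : MemLp (fun z : ℝ × Sph p => F z - r z.1) 2
      ((refMeasure p).withDensity fun z => ENNReal.ofReal (F z)) := by
    rw [memLp_two_iff_integrable_sq hD.aestronglyMeasurable,
      integrable_withDensity_iff_integrable_smul' hFe hFlt]
    simpa only [ENNReal.toReal_ofReal (h0 _), smul_eq_mul] using hQ
  have hDμ : MemLp (fun z : ℝ × Sph p => F z - r z.1) 2 (refMeasure p) := hF2.sub hr2
  have hrD : Integrable (fun z : ℝ × Sph p => r z.1 * (F z - r z.1)) (refMeasure p) :=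
    hr2.integrable_mul hDμ
  have hDD : Integrable (fun z : ℝ × Sph p => (F z - r z.1) ^ 2) (refMeasure p) :=
    hDμ.integrable_sq
  -- `F - r` has zero directional mean, so it is orthogonal to functions of the radius. Its mean
  -- under the law with density `F` is therefore `∫ (F - r)²`.
  have hz : ∫ z : ℝ × Sph p, r z.1 * (F z - r z.1) ∂(refMeasure p) = 0 := by
    rw [integral_prod _ hrD]
    refine integral_eq_zero_of_ae ?_
    filter_upwards [hrm, hi.prod_right_ae] with u hu hiu
    simp only [Pi.zero_apply]
    rw [integral_const_mul, integral_sub hiu (integrable_const _), ← hu, integral_const,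
      surf_real_univ hp, smul_eq_mul, sub_self, mul_zero]
  have hmean : ∫ z, F z * (F z - r z.1) ∂(refMeasure p) =
      ∫ z, (F z - r z.1) ^ 2 ∂(refMeasure p) := by
    rw [← add_zero (∫ z, (F z - r z.1) ^ 2 ∂(refMeasure p)), ← hz, ← integral_add hDD hrD]
    refine integral_congr_ae (Eventually.of_forall fun z => ?_)
    simp only; ring
  rw [variance_eq_sub hD2, integral_withDensity_eq_integral_toReal_smul hFe hFlt,
    integral_withDensity_eq_integral_toReal_smul hFe hFlt]
  simp only [ENNReal.toReal_ofReal (h0 _), smul_eq_mul, Pi.pow_apply]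
  rw [hmean]

/-- The mean minimises the mean square distance. -/
lemma lintegral_sub_mean_sq_le {S : Type*} [MeasurableSpace S] {s : Measure S} [IsFiniteMeasure s]
    {φ : S → ℝ} (hφ : MemLp φ 2 s) {m : ℝ} (hm : s.real univ * m = ∫ v, φ v ∂s) (c : ℝ) :
    ∫⁻ v, ENNReal.ofReal ((φ v - m) ^ 2) ∂s ≤ ∫⁻ v, ENNReal.ofReal ((φ v - c) ^ 2) ∂s := by
  have hsq : ∀ a : ℝ, Integrable (fun v => (φ v - a) ^ 2) s := fun a =>
    (hφ.sub (memLp_const a)).integrable_sq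
  have hi : Integrable φ s := hφ.integrable (by norm_num)
  rw [← ofReal_integral_eq_lintegral_ofReal (hsq m) (Eventually.of_forall fun v => sq_nonneg _),
    ← ofReal_integral_eq_lintegral_ofReal (hsq c) (Eventually.of_forall fun v => sq_nonneg _)]
  refine ENNReal.ofReal_le_ofReal ?_
  have hlin : Integrable (fun v => 2 * (m - c) * (φ v - m)) s :=
    (hi.sub (integrable_const m)).const_mul _
  have hz : ∫ v, 2 * (m - c) * (φ v - m) ∂s = 0 := by
    rw [integral_const_mul, integral_sub hi (integrable_const _), ← hm, integral_const,
      smul_eq_mul, sub_self, mul_zero]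
  calc ∫ v, (φ v - m) ^ 2 ∂s = ∫ v, ((φ v - m) ^ 2 + 2 * (m - c) * (φ v - m)) ∂s := by
        rw [integral_add (hsq m) hlin, hz, add_zero]
    _ ≤ _ := integral_mono ((hsq m).add hlin) (hsq c) fun v => by
        simp only
        nlinarith [sq_nonneg (m - c)]

/-- The minimal distance is attained at the radial density. -/
lemma SmoothDensity.deviation_eq {p : ℕ} (hp : 1 ≤ p) {f : ℝ → Sph p → ℝ}
    (hf : SmoothDensity f) (h0 : ∀ u > 0, ∀ v, 0 ≤ f u v)
    (h1 : ∫⁻ z, ENNReal.ofReal (zeroExt f z) ∂(refMeasure p) = 1) :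
    deviation f = ∫ z, (zeroExt f z - radialMean f z.1) ^ 2 ∂(refMeasure p) := by
  have hω := sphereArea_pos hp
  have hF := hf.measurable_zeroExt
  have hr := hf.measurable_radialMean
  have hD : Measurable fun z : ℝ × Sph p => zeroExt f z - radialMean f z.1 :=
    hF.sub (hr.comp measurable_fst)
  have hcont : ∀ u > 0, Continuous (f u) := fun u hu => by
    have := hf.continuousOn.comp (f := fun v : Sph p => (u, v)) (s := univ) (by fun_prop)
      (fun v _ => ⟨hu, mem_univ v⟩)
    exact continuousOn_univ.1 this
  have hbd : ∀ u > 0, MemLp (f u) 2 (surf p) := fun u hu => by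
    obtain ⟨C, hC⟩ := (isCompact_univ (X := Sph p)).exists_bound_of_continuousOn
      (hcont u hu).continuousOn
    exact MemLp.of_bound (hcont u hu).aestronglyMeasurable C
      (Eventually.of_forall fun v => hC v (mem_univ v))
  have hrm : ∀ u > 0, (surf p).real univ * radialMean f u = ∫ v, f u v ∂(surf p) := fun u hu => by
    rw [surf_real_univ hp, sphereArea_mul_radialMean hp]
    simp only [zeroExt_of_pos f hu]
  have hmarg : ∀ u > 0, marginal f u = sphereArea p * radialMean f u := fun u hu => by
    rw [radialMean_of_pos f hu, mul_inv_cancel_left₀ hω.ne']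
  have hrad : IsRadialDensity (marginal f) := by
    have hae : (fun u => sphereArea p * radialMean f u) =ᵐ[volume.restrict (Ioi (0 : ℝ))]
        marginal f := by
      filter_upwards [ae_restrict_mem measurableSet_Ioi] with u hu
      exact (hmarg u hu).symm
    refine ⟨fun u hu => integral_nonneg fun v => h0 u hu v,
      (hr.const_mul _).aemeasurable.congr hae, ?_⟩
    rw [← h1, lintegral_prod _ (hF.ennreal_ofReal).aemeasurable, ← lintegral_indicator
      measurableSet_Ioi]
    refine lintegral_congr fun u => ?_
    rcases le_or_gt u 0 with hu | hu
    · simp [zeroExt_of_nonpos f hu, hu]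
    · rw [indicator_of_mem (by exact hu)]
      simp only [zeroExt_of_pos f hu, marginal]
      exact ofReal_integral_eq_lintegral_ofReal ((hbd u hu).integrable (by norm_num))
        (Eventually.of_forall fun v => h0 u hu v)
  have hfm : AEMeasurable (fun z : ℝ × Sph p => f z.1 z.2) (polarMeasure p) := by
    refine hF.aemeasurable.congr ?_
    rw [polarMeasure_eq]
    filter_upwards [ae_restrict_mem (measurableSet_pos_prod p)] with z hz
    exact zeroExt_of_pos f hz.1 z.2
  have hmeas : ∀ g, IsRadialDensity g → AEMeasurable (fun z : ℝ × Sph p =>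
      ENNReal.ofReal ((f z.1 z.2 - g z.1 * (sphereArea p)⁻¹) ^ 2)) (polarMeasure p) :=
    fun g hg => by
      have : AEMeasurable (fun z : ℝ × Sph p => g z.1) (polarMeasure p) := hg.2.1.comp_fst
      exact ((hfm.sub (this.mul_const _)).pow_const 2).ennreal_ofReal
  -- The minimization decouples over radii: at each `u` the best constant is the directional mean,
  -- and the resulting `f_U` is itself an admissible density.
  have hmin : ∀ g, IsRadialDensity g → sqDist f (marginal f) ≤ sqDist f g := fun g hg => by
    have e1 := lintegral_prod _ (hmeas _ hrad)
    have e2 := lintegral_prod _ (hmeas _ hg)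
    rw [sqDist, sqDist, polarMeasure, e1, e2]
    refine lintegral_mono_ae ?_
    filter_upwards [ae_restrict_mem measurableSet_Ioi] with u hu
    rw [mul_comm (marginal f u), ← radialMean_of_pos f hu]
    exact lintegral_sub_mean_sq_le (hbd u hu) (hrm u hu) _
  have hinf : (⨅ (g : ℝ → ℝ) (_ : IsRadialDensity g), sqDist f g) = sqDist f (marginal f) :=
    le_antisymm (iInf₂_le _ hrad) (le_iInf₂ hmin)
  rw [deviation, hinf, integral_eq_lintegral_of_nonneg_ae (Eventually.of_forall fun z =>
    sq_nonneg _) (hD.pow_const 2).aestronglyMeasurable, sqDist, polarMeasure_eq,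
    ← lintegral_indicator (measurableSet_pos_prod p)]
  congr 1
  refine lintegral_congr fun z => ?_
  obtain ⟨u, v⟩ := z
  rcases le_or_gt u 0 with hu | hu
  · rw [indicator_of_notMem fun h => hu.not_gt h.1]
    simp [zeroExt_of_nonpos f hu, radialMean_of_nonpos f hu]
  · rw [indicator_of_mem (by exact ⟨hu, mem_univ v⟩)]
    simp only [zeroExt_of_pos f hu, radialMean_of_pos f hu]
    rw [mul_comm]

end Density

/-! ### From sample vectors to points of `ℝ × Sph p`. -/

section Sample

open scoped ENNReal

/-- Radius and direction of a vector, with direction `v₀` for the zero vector. -/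
def polarPoint {p : ℕ} (v₀ : Sph p) (y : E p) : ℝ × Sph p :=
  (‖y‖, ⟨if y = 0 then (v₀ : E p) else direction y, by
    split_ifs with hy
    · exact v₀.2
    · simp [direction, norm_smul, hy]⟩)

lemma measurable_polarPoint {p : ℕ} (v₀ : Sph p) : Measurable (polarPoint v₀) := by
  refine measurable_norm.prodMk (Measurable.subtype_mk ?_)
  refine Measurable.ite (measurableSet_singleton 0) measurable_const ?_
  unfold direction
  fun_prop

/-- The two double sums match term by term once `L / c₁` is replaced by the normalized density.
Nonzero vectors are required because `polarPoint` and `direction` disagree at the origin. -/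
lemma estDeviation_eq {p : ℕ} (hp : 2 ≤ p) (v₀ : Sph p) {K : ℝ → ℝ} {h κ : ℝ} (hκ : 0 < κ)
    (n : ℕ) {y : ℕ → E p} (hy : ∀ i, y i ≠ 0) :
    estDeviation K h κ n y = ((n : ℝ) * (n - 1))⁻¹ *
      (∑ i ∈ Finset.range n, ∑ j ∈ (Finset.range n).erase i,
        deviationKernel p K h κ (polarPoint v₀ (y i), polarPoint v₀ (y j))) := by
  simp only [estDeviation, estJoint, estRadial, Finset.mul_sum, ← Finset.sum_sub_distrib]
  refine Finset.sum_congr rfl fun i _ => Finset.sum_congr rfl fun j _ => ?_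
  simp only [deviationKernel, scaledKernel, polarPoint, hy, if_false, ← langevin_div_c1 hp hκ,
    mul_inv, div_eq_mul_inv]
  ring

lemma HasPolarDensity.map_eq_zeroExt {Ω : Type*} [MeasurableSpace Ω] {P : Measure Ω} {p : ℕ}
    {Y : Ω → E p} {f : ℝ → Sph p → ℝ} (hY : HasPolarDensity P Y f) :
    P.map (fun ω => (‖Y ω‖, direction (Y ω))) =
      ((refMeasure p).withDensity fun z => ENNReal.ofReal (zeroExt f z)).map
        (fun z => (z.1, (z.2 : E p))) := by
  rw [hY.map_eq, withDensity_polarMeasure]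

lemma measurable_direction (p : ℕ) : Measurable (direction : E p → E p) := by
  unfold direction
  fun_prop

/-- The law of `(‖Y‖, Y / ‖Y‖)` is the image of a measure absolutely continuous with respect to
`refMeasure`, for which radius zero is a null event. -/
lemma HasPolarDensity.ae_ne_zero {Ω : Type*} [MeasurableSpace Ω] {P : Measure Ω} {p : ℕ}
    {Y : Ω → E p} (hYm : Measurable Y) {f : ℝ → Sph p → ℝ} (hY : HasPolarDensity P Y f) :
    ∀ᵐ ω ∂P, Y ω ≠ 0 := by
  have hm : Measurable fun ω => (‖Y ω‖, direction (Y ω)) :=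
    hYm.norm.prodMk ((measurable_direction p).comp hYm)
  have hj : Measurable fun z : ℝ × Sph p => (z.1, (z.2 : E p)) := by fun_prop
  have hS : MeasurableSet {z : ℝ × E p | z.1 ≠ 0} :=
    (measurable_fst (measurableSet_singleton 0)).compl
  have h1 : ∀ᵐ z ∂(P.map (fun ω => (‖Y ω‖, direction (Y ω)))), z.1 ≠ 0 := by
    rw [hY.map_eq_zeroExt, ae_map_iff hj.aemeasurable hS]
    refine (withDensity_absolutelyContinuous _ _).ae_le ?_
    have h0 : ∀ᵐ u : ℝ, u ≠ 0 := by simp [ae_iff]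
    exact Measure.quasiMeasurePreserving_fst.ae h0
  rw [ae_map_iff hm.aemeasurable hS] at h1
  filter_upwards [h1] with ω hω
  exact norm_ne_zero_iff.1 hω

/-- The density hypothesis describes a law on `ℝ × E p`. The inclusion of the sphere is a measurable
embedding, so the law can be pulled back along it to `ℝ × Sph p`. -/
lemma HasPolarDensity.map_polarPoint {Ω : Type*} [MeasurableSpace Ω] {P : Measure Ω} {p : ℕ}
    {Y : Ω → E p} (hYm : Measurable Y) {f : ℝ → Sph p → ℝ} (hY : HasPolarDensity P Y f)
    (v₀ : Sph p) : P.map (fun ω => polarPoint v₀ (Y ω)) =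
      (refMeasure p).withDensity fun z => ENNReal.ofReal (zeroExt f z) := by
  have hj : MeasurableEmbedding fun z : ℝ × Sph p => (z.1, (z.2 : E p)) :=
    MeasurableEmbedding.id.prodMap
      (MeasurableEmbedding.subtype_coe Metric.isClosed_sphere.measurableSet)
  have hm : Measurable fun ω => polarPoint v₀ (Y ω) := (measurable_polarPoint v₀).comp hYm
  rw [← hj.comap_map (P.map fun ω => polarPoint v₀ (Y ω)), Measure.map_map hj.measurable hm,
    ← hj.comap_map ((refMeasure p).withDensity fun z => ENNReal.ofReal (zeroExt f z)),
    ← hY.map_eq_zeroExt]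
  congr 1
  refine Measure.map_congr ?_
  filter_upwards [hY.ae_ne_zero hYm] with ω hω
  simp [polarPoint, hω]

end Sample

end SphericalDeviation

end

/-! ### The main theorem. -/

open SphericalDeviation in
theorem mainTheorem3 {Ω : Type*} [MeasurableSpace Ω] (P : Measure Ω) [IsProbabilityMeasure P]
    (p : ℕ) (hp : 2 ≤ p)
    (Y : ℕ → Ω → EuclideanSpace ℝ (Fin p)) (hYm : ∀ i, Measurable (Y i)) (hYi : iIndepFun Y P)
    (f : ℝ → Metric.sphere (0 : EuclideanSpace ℝ (Fin p)) 1 → ℝ)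
    (hYf : ∀ i, HasPolarDensity P (Y i) f)
    (hf : SmoothDensity f)
    (hvar : Integrable (varIntegrand f) (polarMeasure p))
    (K : ℝ → ℝ) (hK : RadialKernel K)
    (h κ : ℕ → ℝ) (hh : ∀ n, 0 < h n) (hκ : ∀ n, 0 < κ n)
    (hκlim : Tendsto κ atTop atTop) (hhlim : Tendsto h atTop (𝓝 0))
    (hκh : Tendsto (fun n : ℕ => κ n ^ (((p : ℝ) - 1) / 2) / ((n : ℝ) * h n)) atTop (𝓝 0))
    (hM : 0 < deviation f) :
    0 ≤ asympVar f ∧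
    (∀ n, Integrable (fun ω => estDeviation K (h n) (κ n) n (fun i => Y i ω)) P) ∧
    TendstoInDistribution
      (fun (n : ℕ) (ω : Ω) => Real.sqrt n *
        (estDeviation K (h n) (κ n) n (fun i => Y i ω) -
          ∫ ω', estDeviation K (h n) (κ n) n (fun i => Y i ω') ∂P))
      atTop (id : ℝ → ℝ) (fun _ => P)
      (gaussianReal 0 (Real.toNNReal (4 * asympVar f))) := by
  have hp1 : 1 ≤ p := by omega
  obtain ⟨v₀⟩ : Nonempty (Sph p) := ⟨⟨EuclideanSpace.single ⟨0, by omega⟩ 1, by simp⟩⟩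
  have h0 : ∀ u > 0, ∀ v, 0 ≤ f u v := (hYf 0).nonneg
  have hF0 := zeroExt_nonneg h0
  have hF := hf.measurable_zeroExt
  have hr := hf.measurable_radialMean
  have hrp : Measurable fun z : ℝ × Sph p => radialMean f z.1 := hr.comp measurable_fst
  have hZm : ∀ i, Measurable fun ω => polarPoint v₀ (Y i ω) := fun i =>
    (measurable_polarPoint v₀).comp (hYm i)
  have hZl := fun i => (hYf i).map_polarPoint (hYm i) v₀
  have hZi : iIndepFun (fun i ω => polarPoint v₀ (Y i ω)) P :=
    hYi.comp (fun _ => polarPoint v₀) fun _ => measurable_polarPoint v₀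
  have hprob : IsProbabilityMeasure
      ((refMeasure p).withDensity fun z => ENNReal.ofReal (zeroExt f z)) := by
    rw [← hZl 0]; exact Measure.isProbabilityMeasure_map (hZm 0).aemeasurable
  have hmass : ∫⁻ z, ENNReal.ofReal (zeroExt f z) ∂(refMeasure p) = 1 := by
    rw [← hprob.measure_univ, withDensity_apply _ MeasurableSet.univ, Measure.restrict_univ]
  have hi : Integrable (zeroExt f) (refMeasure p) :=
    ⟨hF.aestronglyMeasurable, by
      rw [hasFiniteIntegral_iff_ofReal (Eventually.of_forall hF0), hmass]
      exact ENNReal.one_lt_top⟩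
  have hQ : Integrable (fun z => zeroExt f z * (zeroExt f z - radialMean f z.1) ^ 2)
      (refMeasure p) := by
    rw [zeroExt_mul_sq, integrable_indicator_iff (measurableSet_pos_prod p), IntegrableOn,
      ← polarMeasure_eq]
    exact hvar
  obtain ⟨hr3, hF3⟩ := hf.integrable_cube hp1 h0 hi hQ
  have hrm : ∀ᵐ u : ℝ, sphereArea p * radialMean f u = ∫ v, zeroExt f (u, v) ∂(surf p) :=
    Eventually.of_forall fun u => sphereArea_mul_radialMean hp1 f u
  have hr0 : ∀ u, 0 ≤ radialMean f u := fun u =>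
    mul_nonneg (inv_pos.2 (sphereArea_pos hp1)).le (integral_nonneg fun v => hF0 _)
  have hri : Integrable (radialMean f) := hi.integral_prod_left.const_mul _
  -- Identifies `σ²` with a variance, which gives both its nonnegativity and the variance of the
  -- limit law.
  have hvarD : Var[fun z => zeroExt f z - radialMean f z.1;
      (refMeasure p).withDensity fun z => ENNReal.ofReal (zeroExt f z)] = asympVar f := by
    rw [variance_deviation hp1 hF hF0 hr
      (memLp_two_of_integrable_cube hF (Eventually.of_forall hF0) hi hF3)
      (memLp_two_of_integrable_cube hrp (Eventually.of_forall fun z => hr0 z.1)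
        (hri.comp_fst _) (hr3.comp_fst _)) hi hrm hQ, asympVar, hf.deviation_eq hp1 h0 hmass,
      zeroExt_mul_sq, integral_indicator (measurableSet_pos_prod p), ← polarMeasure_eq]
  obtain ⟨hint, hclt⟩ := deviationKernel_clt hp hZm hZi hF hF0 hi hF3 hr hri
    (Eventually.of_forall hr0) hr3 hrm hQ hZl hK hh hκ hκlim hhlim hκh
  -- Almost surely no sample vector vanishes, so the estimator coincides almost everywhere with the
  -- U-statistic, and so do the means.
  have hest : ∀ n : ℕ, (fun ω => ((n : ℝ) * (n - 1))⁻¹ * (∑ i ∈ Finset.range n,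
      ∑ j ∈ (Finset.range n).erase i, deviationKernel p K (h n) (κ n)
        (polarPoint v₀ (Y i ω), polarPoint v₀ (Y j ω)))) =ᵐ[P]
      fun ω => estDeviation K (h n) (κ n) n (fun i => Y i ω) := fun n => by
    filter_upwards [ae_all_iff.2 fun i => (hYf i).ae_ne_zero (hYm i)] with ω hω
    exact (estDeviation_eq hp v₀ (hκ n) n hω).symm
  refine ⟨hvarD ▸ variance_nonneg _ _, fun n => ?_, ?_⟩
  · refine Integrable.congr (Integrable.const_mul ?_ _) (hest n)
    exact integrable_finsetSum _ fun i _ => integrable_finsetSum _ fun j hj =>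
      hint n i j (Finset.ne_of_mem_erase hj).symm
  · rw [hvarD] at hclt
    refine hclt.congr (fun n => ?_) (Eventually.of_forall fun _ => rfl)
    filter_upwards [hest n] with ω hω
    rw [hω, integral_congr_ae (hest n)]
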